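/- Let $\tfrac14<H<1$ and $d,N\ge 0$ be integers. Let $\bar{\mathcal H}$ be the Cameron–Martin space on $[0,1]$ of $d$-dimensional fractional Brownian motion with Hurst parameter $H$, that is, the Hilbert space of paths $h:[0,1]\to\mathbb R^d$ with reproducing kernel $R(s,t)\,\mathrm{Id}$, $R(s,t)=\tfrac12\left(s^{2H}+t^{2H}-|t-s|^{2H}\right)$. Let $T_N(\mathbb R^d)=\bigoplus_{k=0}^N(\mathbb R^d)^{\otimes k}$ be the tensor algebra truncated at degree $N$, $\mathfrak g_N(\mathbb R^d)$ its Lie subalgebra generated by the canonical basis $e_1,\dots,e_d$ of $\mathbb R^d$ (with $[a,b]=a\otimes b-b\otimes a$), and $\mathbb G_N(\mathbb R^d)=\exp(\mathfrak g_N(\mathbb R^d))\subset T_N(\mathbb R^d)$ the free Carnot group of step $N$. The signature of $h$ is $$S_N(h)_t=\sum_{k=0}^N\int_{0<s_1<\cdots<s_k<t}dh_{s_1}\otimes\cdots\otimes dh_{s_k},$$ with iterated Young integrals (limits of Riemann–Stieltjes sums over tagged partitions as the mesh tends to $0$). (1) For every $h\in\bar{\mathcal H}$ these integrals exist and $S_N(h)_t\in\mathbb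 G_N(\mathbb R^d)$ for all $t\in[0,1]$; the map $S_N(\cdot)_1:\bar{\mathcal H}\to T_N(\mathbb R^d)$ is $C^\infty$. For every $g\in\mathbb G_N(\mathbb R^d)$ there is a path $h\in\bar{\mathcal H}$ such that $S_N(h)_1=g$ and $S_N(\cdot)_1:\bar{\mathcal H}\to\mathbb G_N(\mathbb R^d)$ is non-degenerate (a submersion) at $h$: its Fréchet derivative at $h$ maps $\bar{\mathcal H}$ onto the tangent space $T_g\mathbb G_N(\mathbb R^d)$. (2) Let $\mathcal B$ be a basis of $\mathfrak g_N(\mathbb R^d)$, $n=\dim\mathfrak g_N(\mathbb R^d)$, write $[x]_{\mathcal B}\in\mathbb R^n$ for the coordinates of $x\in\mathfrak g_N(\mathbb R^d)$, and let $V_i$ be the vector field on $\mathbb R^n$ that corresponds, under $g\mapsto[\exp^{-1}g]_{\mathcal B}$, to the left invariant vector field on $\mathbb G_N(\mathbb R^d)$ with value $e_i$ at the identity $(i=1,\dots,d)$. For every $h\in\bar{\mathcal H}$ the Young equation $U_t=\sum_{i=1}^d\int_0^tV_i(U_s)\,dh^i_s$, $t\in[0,1]$, has exactly one solution $U=:\Psi(h)$;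 it is $\Psi(h)_t=[\exp^{-1}S_N(h)_t]_{\mathcal B}$, and the map $\Psi(\cdot)_1:\bar{\mathcal H}\to\mathbb R^n$ is $C^\infty$. For every $u\in\mathbb R^n$ there is a path $h\in\bar{\mathcal H}$ such that $\Psi(h)_1=u$ and $\Psi(\cdot)_1$ is non-degenerate at $h$, i.e. its Fréchet derivative at $h$ maps $\bar{\mathcal H}$ onto $\mathbb R^n$. -/

import Mathlib

open Finset MeasureTheory
open scoped unitInterval InnerProductSpace ContDiff

/-! ### The truncated tensor algebra and the free Carnot group -/

/-- Words of length at most `N` in the letters `0, …, d - 1`. -/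
abbrev Word (d N : ℕ) : Type := {w : List (Fin d) // w.length ≤ N}

noncomputable instance Word.instFintype (d N : ℕ) : Fintype (Word d N) :=
  (List.finite_length_le (Fin d) N).fintype

/-- The truncated tensor algebra `T_N(ℝ^d) = ⨁_{k ≤ N} (ℝ^d)^{⊗ k}`. The tensor `a` is given by its
coefficients: `a (i₁, …, i_k)` is the coefficient of `e_{i₁} ⊗ ⋯ ⊗ e_{i_k}`. -/
def TruncTensor (d N : ℕ) : Type := Word d N → ℝ

namespace TruncTensor

variable {d N : ℕ}

noncomputable instance instNormedAddCommGroup : NormedAddCommGroup (TruncTensor d N) :=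
  inferInstanceAs (NormedAddCommGroup (Word d N → ℝ))

noncomputable instance instNormedSpace : NormedSpace ℝ (TruncTensor d N) :=
  inferInstanceAs (NormedSpace ℝ (Word d N → ℝ))

/-- The prefix of length (at most) `i`. -/
def pre (w : Word d N) (i : ℕ) : Word d N :=
  ⟨w.1.take i, (List.length_take_le' i w.1).trans w.2⟩

/-- What remains after the first `i` letters. -/
def suf (w : Word d N) (i : ℕ) : Word d N :=
  ⟨w.1.drop i, by rw [List.length_drop]; exact (Nat.sub_le _ _).trans w.2⟩

/-- The tensor product, truncated at degree `N`. -/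
def tmul (a b : TruncTensor d N) : TruncTensor d N := fun w =>
  ∑ i ∈ range (w.1.length + 1), a (pre w i) * b (suf w i)

/-- The unit `(1, 0, …, 0)`. -/
def unit (d N : ℕ) : TruncTensor d N := fun w => if w.1 = [] then 1 else 0

theorem tmul_assoc (a b c : TruncTensor d N) : tmul (tmul a b) c = tmul a (tmul b c) := by
  funext w
  simp only [tmul, Finset.sum_mul, Finset.mul_sum]
  rw [Finset.sum_sigma', Finset.sum_sigma']
  refine Finset.sum_bij' (fun x _ => ⟨x.2, x.1 - x.2⟩) (fun x _ => ⟨x.1 + x.2, x.1⟩) ?_ ?_ ?_ ?_ ?_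
  · rintro ⟨i, j⟩ h
    simp only [pre, suf, mem_sigma, mem_range, List.length_take, List.length_drop] at h ⊢
    omega
  · rintro ⟨i, j⟩ h
    simp only [pre, suf, mem_sigma, mem_range, List.length_take, List.length_drop] at h ⊢
    omega
  · rintro ⟨i, j⟩ h
    simp only [pre, mem_sigma, mem_range, List.length_take] at h
    have : j + (i - j) = i := by omega
    simp [this]
  · rintro ⟨i, j⟩ h
    simp
  · rintro ⟨i, j⟩ h
    simp only [pre, mem_sigma, mem_range, List.length_take] at h
    have h1 : pre (pre w i) j = pre w j := by
      apply Subtype.ext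
      simp only [pre, List.take_take]
      congr 1
      omega
    have h2 : suf (pre w i) j = pre (suf w j) (i - j) := by
      apply Subtype.ext
      simp only [pre, suf, List.drop_take]
    have h3 : suf w i = suf (suf w j) (i - j) := by
      apply Subtype.ext
      simp only [suf, List.drop_drop]
      congr 1
      omega
    simp only [h1, h2, h3, mul_assoc]

theorem unit_tmul (a : TruncTensor d N) : tmul (unit d N) a = a := by
  funext w
  rw [tmul, Finset.sum_eq_single 0]
  · simp [unit, pre, suf]
  · intro i hi h0
    have : w.1.take i ≠ [] := by
      intro h
      have := congrArg List.length h
      simp only [mem_range, List.length_take, List.length_nil] at hi this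
      omega
    simp [unit, pre, this]
  · simp

theorem tmul_unit (a : TruncTensor d N) : tmul a (unit d N) = a := by
  funext w
  rw [tmul, Finset.sum_eq_single w.1.length]
  · simp [unit, pre, suf]
  · intro i hi h0
    have : w.1.drop i ≠ [] := by
      intro h
      have := congrArg List.length h
      simp only [mem_range, List.length_drop, List.length_nil] at hi this
      omega
    simp [unit, suf, this]
  · simp

theorem add_apply (a b : TruncTensor d N) (w : Word d N) : (a + b) w = a w + b w := rfl

theorem zero_apply (w : Word d N) : (0 : TruncTensor d N) w = 0 := rfl

theorem smul_apply (r : ℝ) (a : TruncTensor d N) (w : Word d N) : (r • a) w = r * a w := rfl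

theorem zero_tmul (a : TruncTensor d N) : tmul 0 a = 0 := by
  funext w
  simp [tmul, zero_apply]

theorem tmul_zero (a : TruncTensor d N) : tmul a 0 = 0 := by
  funext w
  simp [tmul, zero_apply]

theorem tmul_add (a b c : TruncTensor d N) : tmul a (b + c) = tmul a b + tmul a c := by
  funext w
  simp only [tmul, add_apply, mul_add, Finset.sum_add_distrib]

theorem add_tmul (a b c : TruncTensor d N) : tmul (a + b) c = tmul a c + tmul b c := by
  funext w
  simp only [tmul, add_apply, add_mul, Finset.sum_add_distrib]

theorem smul_tmul (r : ℝ) (a b : TruncTensor d N) : tmul (r • a) b = r • tmul a b := by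
  funext w
  simp only [tmul, smul_apply, mul_assoc, Finset.mul_sum]

theorem tmul_smul (r : ℝ) (a b : TruncTensor d N) : tmul a (r • b) = r • tmul a b := by
  funext w
  simp only [tmul, smul_apply, mul_left_comm _ r, Finset.mul_sum]

noncomputable instance instRing : Ring (TruncTensor d N) :=
  { (inferInstance : AddCommGroup (TruncTensor d N)) with
    mul := tmul
    one := unit d N
    mul_assoc := tmul_assoc
    one_mul := unit_tmul
    mul_one := tmul_unit
    zero_mul := zero_tmul
    mul_zero := tmul_zero
    left_distrib := tmul_add
    right_distrib := add_tmul }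

noncomputable instance instAlgebra : Algebra ℝ (TruncTensor d N) :=
  Algebra.ofModule smul_tmul tmul_smul

/-- The bracket `[a, b] = a ⊗ b - b ⊗ a`. -/
noncomputable instance instLieRing : LieRing (TruncTensor d N) := LieRing.ofAssociativeRing

noncomputable instance instLieAlgebra : LieAlgebra ℝ (TruncTensor d N) :=
  LieAlgebra.ofAssociativeAlgebra

/-- The canonical basis vector `e_i` of `ℝ^d`, as an element of degree one. -/
def letter (N : ℕ) (i : Fin d) : TruncTensor d N := fun w => if w.1 = [i] then 1 else 0

/-- `exp z = ∑_{k ≤ N} z^{⊗ k} / k!`. -/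
noncomputable def texp (z : TruncTensor d N) : TruncTensor d N :=
  ∑ k ∈ range (N + 1), ((k.factorial : ℝ)⁻¹) • z ^ k

end TruncTensor

/-- The Lie subalgebra `𝔤_N(ℝ^d)` of `T_N(ℝ^d)` generated by `e_1, …, e_d`, with the bracket
`[a, b] = a ⊗ b - b ⊗ a`. -/
noncomputable def freeNilpotentLie (d N : ℕ) : LieSubalgebra ℝ (TruncTensor d N) :=
  LieSubalgebra.lieSpan ℝ (TruncTensor d N) (Set.range (TruncTensor.letter N))

/-- The free Carnot group `𝔾_N(ℝ^d) = exp 𝔤_N(ℝ^d)`. -/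
def carnotGroup (d N : ℕ) : Set (TruncTensor d N) :=
  TruncTensor.texp '' (freeNilpotentLie d N : Set (TruncTensor d N))

/-- The tangent space of the submanifold `𝔾_N(ℝ^d)` of `T_N(ℝ^d)` at `g`: all velocities at time
zero of curves in the group that pass through `g` at time zero. -/
def carnotTangent {d N : ℕ} (g : TruncTensor d N) : Set (TruncTensor d N) :=
  {v | ∃ γ : ℝ → TruncTensor d N, (∀ ε, γ ε ∈ carnotGroup d N) ∧ γ 0 = g ∧ HasDerivAt γ v 0}

/-! ### Young integrals and signatures -/

/-- The Riemann--Stieltjes sums `∑ f(ξ_k) (x(t_{k+1}) - x(t_k))` over tagged partitions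
`0 = t_0 ≤ ⋯ ≤ t_m = t`, `ξ_k ∈ [t_k, t_{k+1}]`, converge to `J` as the mesh tends to zero: `J` is
the Young integral `∫_0^t f dx`. -/
def HasYoungIntegral (f x : I → ℝ) (t : I) (J : ℝ) : Prop :=
  ∀ ε > 0, ∃ δ > 0, ∀ (m : ℕ) (p ξ : ℕ → I), p 0 = 0 → p m = t →
    (∀ k < m, p k ≤ ξ k ∧ ξ k ≤ p (k + 1) ∧ (p (k + 1) : ℝ) - p k < δ) →
    |∑ k ∈ range m, f (ξ k) * (x (p (k + 1)) - x (p k)) - J| < ε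

open Classical in
/-- The Young integral `∫_0^t f dx` (zero if it does not exist). -/
noncomputable def youngIntegral (f x : I → ℝ) (t : I) : ℝ :=
  if h : ∃ J, HasYoungIntegral f x t J then h.choose else 0

/-- Iterated integrals: for the *reversed* word `(i_k, …, i_1)` this is
`∫_{0 < s_1 < ⋯ < s_k < t} dh^{i_1}_{s_1} ⋯ dh^{i_k}_{s_k}`. -/
noncomputable def iteratedIntegral {d : ℕ} (h : I → EuclideanSpace ℝ (Fin d)) :
    List (Fin d) → I → ℝ
  | [], _ => 1
  | i :: w, t => youngIntegral (iteratedIntegral h w) (fun s => h s i) t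

/-- The signature `S_N(h)_t` of order `N` of the path `h`. -/
noncomputable def signature {d : ℕ} (N : ℕ) (h : I → EuclideanSpace ℝ (Fin d)) (t : I) :
    TruncTensor d N :=
  fun w => iteratedIntegral h w.1.reverse t

/-- All the integrals that occur in `S_N(h)` exist. -/
def HasSignature {d : ℕ} (N : ℕ) (h : I → EuclideanSpace ℝ (Fin d)) : Prop :=
  ∀ (i : Fin d) (w : List (Fin d)), w.length < N → ∀ t : I,
    ∃ J, HasYoungIntegral (iteratedIntegral h w) (fun s => h s i) t J

/-! ### The Itô--Lyons map in exponential coordinates -/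

section ItoLyons

variable {d N n : ℕ}

/-- The point `exp (∑ u_j b_j)` of the group with coordinates `u` in the basis `b` of `𝔤_N(ℝ^d)`. -/
noncomputable def expCoord (b : Module.Basis (Fin n) ℝ (freeNilpotentLie d N)) (u : Fin n → ℝ) :
    TruncTensor d N :=
  TruncTensor.texp (b.equivFun.symm u : TruncTensor d N)

/-- The coordinates `[exp⁻¹ g]_b` of `g` in the group. -/
noncomputable def logCoord (b : Module.Basis (Fin n) ℝ (freeNilpotentLie d N))
    (g : TruncTensor d N) : Fin n → ℝ :=
  Function.invFun (expCoord b) g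

/-- The vector field `V_i` on `ℝ^n`: the left invariant vector field with value `e_i` at the
identity, read in the coordinates `logCoord`. -/
noncomputable def leftInvariantField (b : Module.Basis (Fin n) ℝ (freeNilpotentLie d N))
    (i : Fin d) (u : Fin n → ℝ) : Fin n → ℝ :=
  deriv (fun ε : ℝ => logCoord b (expCoord b u * TruncTensor.texp (ε • TruncTensor.letter N i))) 0

/-- `U_t = ∑_i ∫_0^t V_i(U_s) dh^i_s` for all `t`, with existing Young integrals. -/
def SolvesEquation (b : Module.Basis (Fin n) ℝ (freeNilpotentLie d N))
    (h : I → EuclideanSpace ℝ (Fin d)) (U : I → Fin n → ℝ) : Prop :=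
  ∀ (t : I) (j : Fin n), ∃ J : Fin d → ℝ,
    (∀ i, HasYoungIntegral (fun s => leftInvariantField b i (U s) j) (fun s => h s i) t (J i)) ∧
    U t j = ∑ i, J i

open Classical in
/-- The Itô--Lyons map `Ψ`: the solution of the equation driven by `h` (zero if there is none). -/
noncomputable def itoLyons (b : Module.Basis (Fin n) ℝ (freeNilpotentLie d N))
    (h : I → EuclideanSpace ℝ (Fin d)) : I → Fin n → ℝ :=
  if hU : ∃ U, SolvesEquation b h U then hU.choose else 0

end ItoLyons

/-! ### The Cameron--Martin space of fractional Brownian motion -/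

/-- The covariance `R(s, t) = (s^{2H} + t^{2H} - |t - s|^{2H}) / 2` of fractional Brownian motion
with Hurst parameter `H`. -/
noncomputable def fbmCov (H s t : ℝ) : ℝ := (s ^ (2 * H) + t ^ (2 * H) - |t - s| ^ (2 * H)) / 2

/-- The covariance kernel `R(s, t) Id` of `d`-dimensional fractional Brownian motion on `[0, 1]`. -/
noncomputable def fbmKernel (H : Set.Ioo (0 : ℝ) 1) (d : ℕ) :
    Matrix I I (EuclideanSpace ℝ (Fin d) →L[ℝ] EuclideanSpace ℝ (Fin d)) :=
  .of fun s t => fbmCov H s t • ContinuousLinearMap.id ℝ (EuclideanSpace ℝ (Fin d))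

theorem fbm_integrableOn (H : Set.Ioo (0 : ℝ) 1) (x : ℝ) :
    IntegrableOn (fun r : ℝ => (1 - Real.cos (x * r)) * r ^ (-1 - 2 * (H : ℝ))) (Set.Ioi 0) := by
  obtain ⟨H, h0, h1⟩ := H
  simp only
  have hm : Measurable (fun r : ℝ => (1 - Real.cos (x * r)) * r ^ (-1 - 2 * H)) := by fun_prop
  rw [← Set.Ioc_union_Ioi_eq_Ioi (zero_le_one' ℝ)]
  refine IntegrableOn.union ?_ ?_
  · have hi : IntegrableOn (fun r : ℝ => x ^ 2 / 2 * r ^ (1 - 2 * H)) (Set.Ioc 0 1) := by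
      refine Integrable.const_mul ?_ _
      have := (intervalIntegral.intervalIntegrable_rpow' (a := 0) (b := 1)
        (show -1 < 1 - 2 * H by linarith))
      rwa [intervalIntegrable_iff_integrableOn_Ioc_of_le zero_le_one] at this
    refine Integrable.mono' hi hm.aestronglyMeasurable ?_
    filter_upwards [ae_restrict_mem measurableSet_Ioc] with r hr
    have hr0 : 0 < r := hr.1
    have hp : 0 < r ^ (-1 - 2 * H) := Real.rpow_pos_of_pos hr0 _
    have hc : 0 ≤ 1 - Real.cos (x * r) := by linarith [Real.cos_le_one (x * r)]
    rw [Real.norm_of_nonneg (mul_nonneg hc hp.le)]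
    have h2 : 1 - Real.cos (x * r) ≤ (x * r) ^ 2 / 2 := by
      linarith [Real.one_sub_sq_div_two_le_cos (x := x * r)]
    have h3 : r ^ (1 - 2 * H) = r ^ 2 * r ^ (-1 - 2 * H) := by
      rw [← Real.rpow_natCast r 2, ← Real.rpow_add hr0]
      congr 1
      push_cast
      ring
    calc _ ≤ (x * r) ^ 2 / 2 * r ^ (-1 - 2 * H) := mul_le_mul_of_nonneg_right h2 hp.le
      _ = _ := by rw [h3]; ring
  · have hi : IntegrableOn (fun r : ℝ => 2 * r ^ (-1 - 2 * H)) (Set.Ioi 1) :=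
      (integrableOn_Ioi_rpow_of_lt (by linarith) one_pos).const_mul 2
    refine Integrable.mono' hi hm.aestronglyMeasurable ?_
    filter_upwards [ae_restrict_mem measurableSet_Ioi] with r hr
    have hr0 : 0 < r := one_pos.trans hr
    have hp : 0 < r ^ (-1 - 2 * H) := Real.rpow_pos_of_pos hr0 _
    have hc : 0 ≤ 1 - Real.cos (x * r) := by linarith [Real.cos_le_one (x * r)]
    rw [Real.norm_of_nonneg (mul_nonneg hc hp.le)]
    exact mul_le_mul_of_nonneg_right (by linarith [Real.neg_one_le_cos (x * r)]) hp.le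

/-- The constant in the spectral representation of `|x|^{2H}`. -/
noncomputable def fbmConst (H : ℝ) : ℝ :=
  ∫ r in Set.Ioi (0 : ℝ), (1 - Real.cos r) * r ^ (-1 - 2 * H)

theorem fbmConst_pos (H : Set.Ioo (0 : ℝ) 1) : 0 < fbmConst H := by
  have hint := fbm_integrableOn H 1
  simp only [one_mul] at hint
  have hnn : ∀ r ∈ Set.Ioi (0 : ℝ), 0 ≤ (1 - Real.cos r) * r ^ (-1 - 2 * (H : ℝ)) := fun r hr =>
    mul_nonneg (by linarith [Real.cos_le_one r]) (Real.rpow_nonneg (le_of_lt hr) _)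
  rw [fbmConst, setIntegral_pos_iff_support_of_nonneg_ae
    ((ae_restrict_iff' measurableSet_Ioi).2 (Filter.Eventually.of_forall hnn)) hint]
  refine lt_of_lt_of_le ?_ (measure_mono (s := Set.Ioo (1 : ℝ) 2) ?_)
  · simp
  · intro r hr
    have hr0 : 0 < r := one_pos.trans hr.1
    refine ⟨?_, hr0⟩
    rw [Function.mem_support]
    refine mul_ne_zero ?_ (Real.rpow_pos_of_pos hr0 _).ne'
    have : Real.cos r < 1 := by
      have := Real.cos_lt_cos_of_nonneg_of_le_pi (le_refl 0)
        (by linarith [Real.pi_gt_three, hr.2]) hr0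
      simpa using this
    linarith

theorem fbm_spectral (H : Set.Ioo (0 : ℝ) 1) (x : ℝ) :
    ∫ r in Set.Ioi (0 : ℝ), (1 - Real.cos (x * r)) * r ^ (-1 - 2 * (H : ℝ)) =
      |x| ^ (2 * (H : ℝ)) * fbmConst H := by
  have hH : (0 : ℝ) < H := H.2.1
  rcases eq_or_ne x 0 with rfl | hx
  · simp [Real.zero_rpow (by linarith : 2 * (H : ℝ) ≠ 0)]
  have hx' : 0 < |x| := abs_pos.2 hx
  have key := integral_comp_mul_left_Ioi
    (fun r : ℝ => (1 - Real.cos r) * r ^ (-1 - 2 * (H : ℝ))) 0 hx'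
  rw [mul_zero, smul_eq_mul] at key
  have h1 : ∫ r in Set.Ioi (0 : ℝ), (1 - Real.cos (|x| * r)) * (|x| * r) ^ (-1 - 2 * (H : ℝ)) =
      |x| ^ (-1 - 2 * (H : ℝ)) *
        ∫ r in Set.Ioi (0 : ℝ), (1 - Real.cos (x * r)) * r ^ (-1 - 2 * (H : ℝ)) := by
    rw [← integral_const_mul]
    refine setIntegral_congr_fun measurableSet_Ioi fun r hr => ?_
    have hr0 : 0 < r := hr
    have hc : Real.cos (|x| * r) = Real.cos (x * r) := by
      rw [← Real.cos_abs (x * r), abs_mul, abs_of_pos hr0]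
    simp only [hc, Real.mul_rpow hx'.le hr0.le]
    ring
  rw [h1] at key
  have h2 : |x| ^ (2 * (H : ℝ)) = (|x| ^ (-1 - 2 * (H : ℝ)))⁻¹ * |x|⁻¹ := by
    rw [← Real.rpow_neg hx'.le, ← Real.rpow_neg_one |x|, ← Real.rpow_add hx']
    congr 1
    ring
  have hne : |x| ^ (-1 - 2 * (H : ℝ)) ≠ 0 := (Real.rpow_pos_of_pos hx' _).ne'
  rw [h2, mul_assoc, fbmConst, ← key, inv_mul_cancel_left₀ hne]

theorem fbm_cov_spectral (H : Set.Ioo (0 : ℝ) 1) {s t : ℝ} (hs : 0 ≤ s) (ht : 0 ≤ t) :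
    IntegrableOn (fun r : ℝ => ((1 - Real.cos (s * r)) * (1 - Real.cos (t * r)) +
      Real.sin (s * r) * Real.sin (t * r)) * r ^ (-1 - 2 * (H : ℝ))) (Set.Ioi 0) ∧
    ∫ r in Set.Ioi (0 : ℝ), ((1 - Real.cos (s * r)) * (1 - Real.cos (t * r)) +
      Real.sin (s * r) * Real.sin (t * r)) * r ^ (-1 - 2 * (H : ℝ)) =
      2 * fbmConst H * fbmCov H s t := by
  have e : (fun r : ℝ => ((1 - Real.cos (s * r)) * (1 - Real.cos (t * r)) +
      Real.sin (s * r) * Real.sin (t * r)) * r ^ (-1 - 2 * (H : ℝ))) =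
      fun r : ℝ => (1 - Real.cos (s * r)) * r ^ (-1 - 2 * (H : ℝ)) +
        (1 - Real.cos (t * r)) * r ^ (-1 - 2 * (H : ℝ)) -
        (1 - Real.cos ((t - s) * r)) * r ^ (-1 - 2 * (H : ℝ)) := by
    funext r
    rw [sub_mul t s r, Real.cos_sub]
    ring
  have i1 := fbm_integrableOn H s
  have i2 := fbm_integrableOn H t
  have i3 := fbm_integrableOn H (t - s)
  rw [e]
  have i12 : IntegrableOn (fun r : ℝ => (1 - Real.cos (s * r)) * r ^ (-1 - 2 * (H : ℝ)) +
      (1 - Real.cos (t * r)) * r ^ (-1 - 2 * (H : ℝ))) (Set.Ioi 0) := i1.add i2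
  refine ⟨i12.sub i3, ?_⟩
  rw [integral_sub i12 i3, integral_add i1 i2, fbm_spectral, fbm_spectral, fbm_spectral,
    abs_of_nonneg hs, abs_of_nonneg ht, fbmCov]
  ring

theorem fbmKernel_posSemidef (H : Set.Ioo (0 : ℝ) 1) (d : ℕ) : (fbmKernel H d).PosSemidef := by
  have key := (RKHS.posSemidef_tfae (K := fbmKernel H d)).out 0 2
  refine key.2 ⟨?_, fun v => ?_⟩
  · ext1 s t
    have : fbmCov H t s = fbmCov H s t := by
      rw [fbmCov, fbmCov, abs_sub_comm]
      ring
    simp only [fbmKernel, Matrix.conjTranspose_apply, Matrix.of_apply, this, star_smul,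
      star_trivial, ContinuousLinearMap.star_eq_adjoint]
    exact congrArg _ ContinuousLinearMap.adjoint_id
  · have hc := fbmConst_pos H
    have e : (v.sum fun x w => v.sum fun x' w' => ⟪fbmKernel H d x' x w, w'⟫_ℝ) =
        (2 * fbmConst H)⁻¹ * ∫ r in Set.Ioi (0 : ℝ),
          (‖∑ x ∈ v.support, (1 - Real.cos (x * r)) • v x‖ ^ 2 +
            ‖∑ x ∈ v.support, Real.sin (x * r) • v x‖ ^ 2) * r ^ (-1 - 2 * (H : ℝ)) := by
      have e1 : ∀ r : ℝ, (‖∑ x ∈ v.support, (1 - Real.cos (x * r)) • v x‖ ^ 2 +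
            ‖∑ x ∈ v.support, Real.sin (x * r) • v x‖ ^ 2) * r ^ (-1 - 2 * (H : ℝ)) =
          ∑ x ∈ v.support, ∑ x' ∈ v.support, ⟪v x, v x'⟫_ℝ *
            (((1 - Real.cos (x' * r)) * (1 - Real.cos (x * r)) +
              Real.sin (x' * r) * Real.sin (x * r)) * r ^ (-1 - 2 * (H : ℝ))) := by
        intro r
        simp only [← real_inner_self_eq_norm_sq, sum_inner, inner_sum, real_inner_smul_left,
          real_inner_smul_right, ← Finset.sum_add_distrib, Finset.sum_mul]
        rw [Finset.sum_comm]
        refine Finset.sum_congr rfl fun x _ => Finset.sum_congr rfl fun x' _ => ?_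
        rw [real_inner_comm]
        ring
      simp only [e1]
      rw [integral_finsetSum _ fun x _ => integrable_finsetSum _ fun x' _ =>
        ((fbm_cov_spectral H x'.2.1 x.2.1).1.const_mul _)]
      rw [Finset.mul_sum]
      refine Finset.sum_congr rfl fun x _ => ?_
      rw [integral_finsetSum _ fun x' _ => ((fbm_cov_spectral H x'.2.1 x.2.1).1.const_mul _),
        Finset.mul_sum]
      refine Finset.sum_congr rfl fun x' _ => ?_
      rw [integral_const_mul, (fbm_cov_spectral H x'.2.1 x.2.1).2]
      simp only [fbmKernel, Matrix.of_apply, FunLike.coe_smul, Pi.smul_apply,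
        ContinuousLinearMap.id_apply, real_inner_smul_left]
      field_simp
    simp only [RCLike.re_to_real]
    rw [e]
    refine mul_nonneg (by positivity) (setIntegral_nonneg measurableSet_Ioi fun r hr => ?_)
    exact mul_nonneg (by positivity) (Real.rpow_nonneg (le_of_lt hr) _)

instance fbmKernel_fact (H : Set.Ioo (0 : ℝ) 1) (d : ℕ) : Fact (fbmKernel H d).PosSemidef :=
  ⟨fbmKernel_posSemidef H d⟩

/-- The Cameron--Martin space `H̄([0, 1])` of `d`-dimensional fractional Brownian motion with Hurst
parameter `H`: the Hilbert space of paths `[0, 1] → ℝ^d` with reproducing kernel `R(s, t) Id`. An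
element `h` is a path, `h t` is its value at time `t`. -/
abbrev CameronMartin (H : Set.Ioo (0 : ℝ) 1) (d : ℕ) : Type := RKHS.OfKernel (fbmKernel H d)

/-! Analysis. All is reduced to one normed space of scalar paths. Each component of a Cameron–Martin
path satisfies `∑ |Δh|² / |Δt|^θ ≤ 2 ‖h‖²` over every partition, with `θ = min (2H) 1`: its
increments are inner products with increments of the kernel, whose covariances have row sums at most
`2 |Δt|^θ`, and a dual Schur test applies (`rieszSum_cameronMartin_le`). For two paths of finite
variation in this sense, a product of increments over `[s, t]` is at most `(t - s)^θ` times a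
superadditive function. Hence the Young integral exists and is a bounded bilinear map of the space
into itself (`exists_youngIntegral`, `integralCLM`); signatures are continuous polynomials in `h`,
and so smooth.

Algebra. The logarithm is a polynomial map on the truncated tensor algebra, so it can be
differentiated without charts. By a first order chain rule (`chain_rule`), the logarithm of the
signature solves the Young equation driven by the left invariant fields. These fields preserve the
Lie algebra and are triangular: arguments that agree below degree `k` give values that agree below
degree `k + 1` (`leftField_sub_mem`). A finite induction on the degree therefore replaces Picard
iteration. It shows that solutions are unique and that the logarithm stays in the Lie algebra, that
is, the signature stays in the group.

Non-degeneracy. Smooth paths from the origin lie in the Cameron–Martin space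
(`exists_cameronMartin_of_contDiff`, by the spectral form of the kernel). A smooth path that follows
the axes one after the other has a product of exponentials `exp (τ e_i)` as signature. If the path
is a loop in the group, prolonging one step moves the endpoint in the direction `g e_i g⁻¹`, with
`g` the product of the earlier steps. The span of all such conjugates is stable under brackets with
letters, so it contains the Lie algebra, and a loop whose directions span a maximal subspace
realizes all of them (`exists_loop_lieSub_le`). At this loop the endpoint map is a submersion with
value zero. Submersions are open, so a neighbourhood of zero is reached by non-degenerate paths; as
scaling a path dilates its signature, every point is reached (`exists_submersion`). The statement on
the group follows through the exponential chart (`range_fderiv_expCoord`). -/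

/-! ### Controls and the sewing estimate -/

/-- A superadditive, nonnegative function of subintervals of `[0, 1]`. -/
structure IsControl (ν : I → I → ℝ) : Prop where
  nonneg : ∀ s t, s ≤ t → 0 ≤ ν s t
  superadd : ∀ s u t, s ≤ u → u ≤ t → ν s u + ν u t ≤ ν s t

namespace IsControl

variable {ν ν' : I → I → ℝ}

theorem mono (hν : IsControl ν) {s s' t' t : I} (h1 : s ≤ s') (h2 : s' ≤ t') (h3 : t' ≤ t) :
    ν s' t' ≤ ν s t := by
  have a1 := hν.superadd s s' t h1 (h2.trans h3)
  have a2 := hν.superadd s' t' t h2 h3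
  have a3 := hν.nonneg s s' h1
  have a4 := hν.nonneg t' t h3
  linarith

theorem sum_le (hν : IsControl ν) {p : ℕ → I} (m : ℕ) (hp : ∀ k < m, p k ≤ p (k + 1)) :
    p 0 ≤ p m ∧ ∑ k ∈ range m, ν (p k) (p (k + 1)) ≤ ν (p 0) (p m) := by
  induction m with
  | zero => simpa using hν.nonneg _ _ le_rfl
  | succ m ih =>
    obtain ⟨h1, h2⟩ := ih fun k hk => hp k (hk.trans (Nat.lt_succ_self m))
    have h3 := hp m (Nat.lt_succ_self m)
    refine ⟨h1.trans h3, ?_⟩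
    rw [Finset.sum_range_succ]
    linarith [hν.superadd _ _ _ h1 h3]

theorem add (hν : IsControl ν) (hν' : IsControl ν') : IsControl fun s t => ν s t + ν' s t where
  nonneg s t h := add_nonneg (hν.nonneg s t h) (hν'.nonneg s t h)
  superadd s u t h h' := by linarith [hν.superadd s u t h h', hν'.superadd s u t h h']

theorem const_mul (hν : IsControl ν) {c : ℝ} (hc : 0 ≤ c) : IsControl fun s t => c * ν s t where
  nonneg s t h := mul_nonneg hc (hν.nonneg s t h)
  superadd s u t h h' := by
    rw [← mul_add]
    exact mul_le_mul_of_nonneg_left (hν.superadd s u t h h') hc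

theorem zero : IsControl fun _ _ => 0 where
  nonneg _ _ _ := le_rfl
  superadd _ _ _ _ _ := by simp

theorem sum {ι : Type*} (A : Finset ι) {w : ι → I → I → ℝ} (h : ∀ i ∈ A, IsControl (w i)) :
    IsControl fun s t => ∑ i ∈ A, w i s t where
  nonneg s t hst := Finset.sum_nonneg fun i hi => (h i hi).nonneg s t hst
  superadd s u t h1 h2 := by
    rw [← Finset.sum_add_distrib]
    exact Finset.sum_le_sum fun i hi => (h i hi).superadd s u t h1 h2

/-- The geometric mean of two controls is a control. -/
theorem sqrt_mul_sqrt (hν : IsControl ν) (hν' : IsControl ν') :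
    IsControl fun s t => √(ν s t) * √(ν' s t) where
  nonneg s t _ := by positivity
  superadd s u t h h' := by
    have e : √(ν s u) * √(ν' s u) + √(ν u t) * √(ν' u t) ≤
        √(ν s u + ν u t) * √(ν' s u + ν' u t) := by
      rw [← Real.sqrt_mul (add_nonneg (hν.nonneg _ _ h) (hν.nonneg _ _ h'))]
      refine Real.le_sqrt_of_sq_le ?_
      have b1 := Real.sq_sqrt (hν.nonneg _ _ h)
      have b2 := Real.sq_sqrt (hν.nonneg _ _ h')
      have b3 := Real.sq_sqrt (hν'.nonneg _ _ h)
      have b4 := Real.sq_sqrt (hν'.nonneg _ _ h')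
      set a := √(ν s u)
      set b := √(ν u t)
      set c := √(ν' s u)
      set e := √(ν' u t)
      rw [← b1, ← b2, ← b3, ← b4]
      -- Cauchy–Schwarz in the plane, with defect `(a e - b c)²`.
      nlinarith [sq_nonneg (a * e - b * c)]
    refine e.trans ?_
    gcongr
    · exact hν.superadd s u t h h'
    · exact hν'.superadd s u t h h'

end IsControl

/-- The constant of the sewing estimate with exponent `θ`. -/
noncomputable def sewingConst (θ : ℝ) : ℝ := 2 / (1 - (1 / 2 : ℝ) ^ θ)

theorem half_rpow_lt_one {θ : ℝ} (hθ : 0 < θ) : (1 / 2 : ℝ) ^ θ < 1 :=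
  Real.rpow_lt_one (by norm_num) (by norm_num) hθ

theorem sewingConst_pos {θ : ℝ} (hθ : 0 < θ) : 0 < sewingConst θ :=
  div_pos two_pos (by linarith [half_rpow_lt_one hθ])

/-- The pair `f`, `x` is dominated, for Young integration, by the control `ν`. -/
def YoungBound (θ : ℝ) (ν : I → I → ℝ) (f x : I → ℝ) : Prop :=
  ∀ s u v v' t : I, s ≤ u → u ≤ t → s ≤ v → v ≤ v' → v' ≤ t →
    |f u - f s| * |x v' - x v| ≤ ((t : ℝ) - s) ^ θ * ν s t

theorem exists_index_between {c : I} (p : ℕ → I) (m : ℕ) (hm : 0 < m) (h0 : p 0 ≤ c)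
    (h1 : c ≤ p m) : ∃ j < m, p j ≤ c ∧ c ≤ p (j + 1) := by
  induction m with
  | zero => exact absurd hm (lt_irrefl 0)
  | succ m ih =>
    rcases le_total (p m) c with h | h
    · exact ⟨m, Nat.lt_succ_self m, h, h1⟩
    · rcases Nat.eq_zero_or_pos m with rfl | hm'
      · exact ⟨0, Nat.lt_succ_self 0, h0, h1⟩
      · obtain ⟨j, hj, h2⟩ := ih hm' h
        exact ⟨j, hj.trans (Nat.lt_succ_self m), h2⟩

/-- The Young--Loève estimate for left point sums. -/
theorem sewing_estimate {θ : ℝ} (hθ : 0 < θ) {ν : I → I → ℝ} (hν : IsControl ν) {f x : I → ℝ}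
    (hfx : YoungBound θ ν f x) (m : ℕ) : ∀ p : ℕ → I, (∀ k < m, p k ≤ p (k + 1)) →
    |∑ k ∈ range m, f (p k) * (x (p (k + 1)) - x (p k)) - f (p 0) * (x (p m) - x (p 0))| ≤
      sewingConst θ * (((p m : ℝ) - p 0) ^ θ * ν (p 0) (p m)) := by
  induction m using Nat.strong_induction_on with
  | _ m ih =>
  intro p hp
  have hmon : ∀ i j, i ≤ j → j ≤ m → p i ≤ p j := by
    intro i j hij hj
    have := (IsControl.zero.sum_le (p := fun k => p (i + k)) (j - i)
      (fun k hk => by simpa [add_assoc] using hp (i + k) (by omega))).1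
    simpa [Nat.add_sub_cancel' hij] using this
  rcases Nat.eq_zero_or_pos m with rfl | hm
  · have := (sewingConst_pos hθ).le
    have := hν.nonneg (p 0) (p 0) le_rfl
    simp only [range_zero, sum_empty, sub_self, mul_zero, abs_zero]
    positivity
  have h0m : p 0 ≤ p m := hmon 0 m (Nat.zero_le m) le_rfl
  have h0m' : (p 0 : ℝ) ≤ p m := h0m
  -- Remove the interval that contains the midpoint. Both remaining pieces are at most half as long,
  -- which gains the factor `(1/2)^θ`, while superadditivity keeps the sum of their controls below
  -- the total. Recombining the pieces costs two terms bounded by `YoungBound`.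
  let c : I := ⟨((p 0 : ℝ) + p m) / 2, by
    have := (p 0).2.1; have := (p m).2.1; have := (p 0).2.2; have := (p m).2.2
    constructor <;> linarith⟩
  have hc0 : p 0 ≤ c := Subtype.coe_le_coe.1 (by simp only [c]; linarith)
  have hc1 : c ≤ p m := Subtype.coe_le_coe.1 (by simp only [c]; linarith)
  obtain ⟨j, hj, hjc, hcj⟩ := exists_index_between p m hm hc0 hc1
  have hjc' : (p j : ℝ) ≤ ((p 0 : ℝ) + p m) / 2 := hjc
  have hcj' : ((p 0 : ℝ) + p m) / 2 ≤ p (j + 1) := hcj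
  have hL := ih j hj p fun k hk => hp k (hk.trans hj)
  have hR := ih (m - j - 1) (by omega) (fun k => p (j + 1 + k))
    fun k hk => by simpa [add_assoc] using hp (j + 1 + k) (by omega)
  have em : j + 1 + (m - j - 1) = m := by omega
  simp only [add_zero, em] at hR
  have esum : ∑ k ∈ range m, f (p k) * (x (p (k + 1)) - x (p k)) =
      ∑ k ∈ range j, f (p k) * (x (p (k + 1)) - x (p k)) + f (p j) * (x (p (j + 1)) - x (p j)) +
      ∑ k ∈ range (m - j - 1), f (p (j + 1 + k)) * (x (p (j + 1 + (k + 1))) - x (p (j + 1 + k))) := by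
    conv_lhs => rw [← em, Finset.sum_range_add, Finset.sum_range_succ]
    rfl
  have o1 : p 0 ≤ p j := hmon 0 j (Nat.zero_le _) hj.le
  have o2 : p j ≤ p (j + 1) := hp j hj
  have o3 : p (j + 1) ≤ p m := hmon (j + 1) m hj le_rfl
  have o1' : (p 0 : ℝ) ≤ p j := o1
  have o3' : (p (j + 1) : ℝ) ≤ p m := o3
  have t1 := hfx (p 0) (p j) (p j) (p (j + 1)) (p m) o1 (o2.trans o3) o1 o2 o3
  have t2 := hfx (p 0) (p (j + 1)) (p (j + 1)) (p m) (p m) (o1.trans o2) o3 (o1.trans o2) o3 le_rfl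
  set D := (p m : ℝ) - p 0 with hD
  have hD0 : 0 ≤ D := by linarith
  set r : ℝ := (1 / 2) ^ θ with hr
  have hr0 : 0 < r := Real.rpow_pos_of_pos (by norm_num) _
  have hhalf : ∀ y : ℝ, 0 ≤ y → y ≤ D / 2 → y ^ θ ≤ r * D ^ θ := fun y hy hyD => by
    calc y ^ θ ≤ (1 / 2 * D) ^ θ := Real.rpow_le_rpow hy (by linarith) hθ.le
      _ = _ := Real.mul_rpow (by norm_num) hD0
  have a1 := hhalf ((p j : ℝ) - p 0) (by linarith) (by linarith)
  have a2 := hhalf ((p m : ℝ) - p (j + 1)) (by linarith) (by linarith)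
  have w1 := hν.nonneg (p 0) (p j) o1
  have w2 := hν.nonneg (p (j + 1)) (p m) o3
  have w3 : ν (p 0) (p j) + ν (p (j + 1)) (p m) ≤ ν (p 0) (p m) := by
    have q1 := hν.superadd (p 0) (p j) (p m) o1 (o2.trans o3)
    have q2 := hν.mono (s := p j) (t := p m) o2 o3 le_rfl
    linarith
  have hC := sewingConst_pos hθ
  -- `sewingConst` is chosen as the fixed point of `C ↦ C r + 2`, which closes the induction.
  have hCr : sewingConst θ * r + 2 = sewingConst θ := by
    have : (1 - (1 / 2 : ℝ) ^ θ) ≠ 0 := by linarith [half_rpow_lt_one hθ]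
    simp only [sewingConst, hr]
    field_simp
    ring
  have hDθ : 0 ≤ D ^ θ := by positivity
  have b1 : sewingConst θ * (((p j : ℝ) - p 0) ^ θ * ν (p 0) (p j)) +
      sewingConst θ * (((p m : ℝ) - p (j + 1)) ^ θ * ν (p (j + 1)) (p m)) ≤
      sewingConst θ * r * (D ^ θ * ν (p 0) (p m)) := by
    calc _ ≤ sewingConst θ * ((r * D ^ θ) * ν (p 0) (p j)) +
        sewingConst θ * ((r * D ^ θ) * ν (p (j + 1)) (p m)) := by gcongr
      _ = sewingConst θ * r * (D ^ θ * (ν (p 0) (p j) + ν (p (j + 1)) (p m))) := by ring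
      _ ≤ _ := by gcongr
  rw [esum]
  have e2 : ∀ A B : ℝ, A + f (p j) * (x (p (j + 1)) - x (p j)) + B - f (p 0) * (x (p m) - x (p 0)) =
      (A - f (p 0) * (x (p j) - x (p 0))) + (B - f (p (j + 1)) * (x (p m) - x (p (j + 1)))) +
      (f (p j) - f (p 0)) * (x (p (j + 1)) - x (p j)) +
      (f (p (j + 1)) - f (p 0)) * (x (p m) - x (p (j + 1))) := fun A B => by ring
  rw [e2]
  rw [← abs_mul] at t1 t2
  calc _ ≤ sewingConst θ * (((p j : ℝ) - p 0) ^ θ * ν (p 0) (p j)) +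
      sewingConst θ * (((p m : ℝ) - p (j + 1)) ^ θ * ν (p (j + 1)) (p m)) +
      D ^ θ * ν (p 0) (p m) + D ^ θ * ν (p 0) (p m) := by
        refine (abs_add_le _ _).trans (add_le_add ((abs_add_le _ _).trans
          (add_le_add ((abs_add_le _ _).trans (add_le_add hL hR)) t1)) t2)
    _ ≤ sewingConst θ * r * (D ^ θ * ν (p 0) (p m)) + 2 * (D ^ θ * ν (p 0) (p m)) := by linarith
    _ = _ := by rw [← add_mul, hCr]

/-! ### Young integrals -/

/-- The point `k / n` of `[0, 1]` (`1` if `k > n`). -/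
noncomputable def gridPoint (n k : ℕ) : I := Set.projIcc 0 1 zero_le_one ((k : ℝ) / n)

theorem gridPoint_zero (n : ℕ) : gridPoint n 0 = 0 := by
  simp [gridPoint]

theorem gridPoint_self {n : ℕ} (hn : n ≠ 0) : gridPoint n n = 1 := by
  simp [gridPoint, hn]

theorem gridPoint_mono (n : ℕ) : Monotone (gridPoint n) := fun k l h =>
  Set.monotone_projIcc _ (by gcongr)

theorem gridPoint_succ_sub_le (n k : ℕ) : (gridPoint n (k + 1) : ℝ) - gridPoint n k ≤ 1 / n := by
  have h1 : ((k + 1 : ℕ) : ℝ) / n = (k : ℝ) / n + 1 / n := by push_cast; ring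
  have h2 : (0 : ℝ) ≤ 1 / n := by positivity
  simp only [gridPoint, Set.coe_projIcc, h1]
  rcases le_total (1 : ℝ) ((k : ℝ) / n) with h | h
  · rw [min_eq_left h, min_eq_left (h.trans (by linarith))]
    simp
  · have : (0 : ℝ) ≤ (k : ℝ) / n := by positivity
    rw [min_eq_right h, max_eq_right this]
    have := min_le_right (1 : ℝ) ((k : ℝ) / n + 1 / n)
    have : (0 : ℝ) ≤ min 1 ((k : ℝ) / n + 1 / n) := le_min zero_le_one (by positivity)
    rw [max_eq_right this]
    linarith

theorem min_sub_min_le {a b t : I} (h : a ≤ b) : ((min b t : I) : ℝ) - (min a t : I) ≤ (b : ℝ) - a := by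
  have h' : (a : ℝ) ≤ b := h
  rcases le_total b t with h1 | h1
  · rw [min_eq_left h1, min_eq_left (h.trans h1)]
  · rw [min_eq_right h1]
    have h1' : (t : ℝ) ≤ b := h1
    rcases le_total a t with h2 | h2
    · rw [min_eq_left h2]; linarith
    · rw [min_eq_right h2]; linarith

/-- A fine uniform grid stopped at `t` is admissible for both limits, so one sum is close to both
values. -/
theorem HasYoungIntegral.unique {f x : I → ℝ} {t : I} {J J' : ℝ} (h : HasYoungIntegral f x t J)
    (h' : HasYoungIntegral f x t J') : J = J' := by
  by_contra hne
  have hpos : 0 < |J - J'| / 2 := half_pos (abs_pos.2 (sub_ne_zero.2 hne))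
  obtain ⟨δ, hδ, H⟩ := h _ hpos
  obtain ⟨δ', hδ', H'⟩ := h' _ hpos
  obtain ⟨n, hn⟩ := exists_nat_one_div_lt (lt_min hδ hδ')
  have hp : ∀ k < n + 1, min (gridPoint (n + 1) k) t ≤ min (gridPoint (n + 1) k) t ∧
      min (gridPoint (n + 1) k) t ≤ min (gridPoint (n + 1) (k + 1)) t ∧
      ((min (gridPoint (n + 1) (k + 1)) t : I) : ℝ) - (min (gridPoint (n + 1) k) t : I) <
        min δ δ' := by
    intro k _
    have hm := gridPoint_mono (n + 1) (Nat.le_succ k)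
    refine ⟨le_rfl, min_le_min_right _ hm, (min_sub_min_le hm).trans_lt ?_⟩
    refine (gridPoint_succ_sub_le _ _).trans_lt ?_
    push_cast
    exact hn
  have e0 : min (gridPoint (n + 1) 0) t = 0 := by
    rw [gridPoint_zero]; exact min_eq_left t.2.1
  have e1 : min (gridPoint (n + 1) (n + 1)) t = t := by
    rw [gridPoint_self (Nat.succ_ne_zero n)]; exact min_eq_right t.2.2
  have a1 := H (n + 1) (fun k => min (gridPoint (n + 1) k) t) (fun k => min (gridPoint (n + 1) k) t)
    e0 e1 fun k hk => ⟨(hp k hk).1, (hp k hk).2.1, (hp k hk).2.2.trans_le (min_le_left _ _)⟩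
  have a2 := H' (n + 1) (fun k => min (gridPoint (n + 1) k) t) (fun k => min (gridPoint (n + 1) k) t)
    e0 e1 fun k hk => ⟨(hp k hk).1, (hp k hk).2.1, (hp k hk).2.2.trans_le (min_le_right _ _)⟩
  rw [abs_sub_lt_iff] at a1 a2
  rcases abs_cases (J - J') with ⟨h, _⟩ | ⟨h, _⟩ <;> linarith [a1.1, a1.2, a2.1, a2.2]

/-- Superadditivity sums the local errors to at most `ν 0 1`, and the power `θ` of the mesh makes
the result small. This identifies a Young integral from the local expansion of its increments. -/
theorem HasYoungIntegral.of_control {θ C : ℝ} (hθ : 0 < θ) {ν : I → I → ℝ} (hν : IsControl ν)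
    {f x F : I → ℝ} (hfx : YoungBound θ ν f x) (hF0 : F 0 = 0)
    (hF : ∀ s t, s ≤ t → |F t - F s - f s * (x t - x s)| ≤ C * (((t : ℝ) - s) ^ θ * ν s t))
    (t : I) : HasYoungIntegral f x t (F t) := by
  intro ε hε
  set K := |C| + 1 with hK
  have hK0 : 0 < K := by positivity
  have hw : 0 ≤ ν 0 1 := hν.nonneg 0 1 zero_le_one
  -- Chosen so that `K * δ ^ θ * ν 0 1 < ε`; the `+ 1` covers `ν 0 1 = 0`.
  set δ := (ε / (K * ν 0 1 + 1)) ^ θ⁻¹ with hδ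
  have hq : 0 < ε / (K * ν 0 1 + 1) := by positivity
  have hδθ : δ ^ θ = ε / (K * ν 0 1 + 1) := Real.rpow_inv_rpow hq.le hθ.ne'
  refine ⟨δ, Real.rpow_pos_of_pos hq _, fun m p ξ h0 hm hp => ?_⟩
  have hmono : ∀ k < m, p k ≤ p (k + 1) := fun k hk => (hp k hk).1.trans (hp k hk).2.1
  have e : F t = ∑ k ∈ range m, (F (p (k + 1)) - F (p k)) := by
    rw [Finset.sum_range_sub (fun k => F (p k)), h0, hm, hF0, sub_zero]
  rw [e, ← Finset.sum_sub_distrib]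
  have hterm : ∀ k ∈ range m, |f (ξ k) * (x (p (k + 1)) - x (p k)) - (F (p (k + 1)) - F (p k))| ≤
      K * δ ^ θ * ν (p k) (p (k + 1)) := by
    intro k hk
    have hk' := mem_range.1 hk
    obtain ⟨h1, h2, h3⟩ := hp k hk'
    have a1 := hF _ _ (hmono k hk')
    have a2 := hfx (p k) (ξ k) (p k) (p (k + 1)) (p (k + 1)) h1 h2 le_rfl (h1.trans h2) le_rfl
    have hle : (p k : ℝ) ≤ p (k + 1) := hmono k hk'
    have hn := hν.nonneg _ _ (hmono k hk')
    have e1 : f (ξ k) * (x (p (k + 1)) - x (p k)) - (F (p (k + 1)) - F (p k)) =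
        (f (ξ k) - f (p k)) * (x (p (k + 1)) - x (p k)) -
        (F (p (k + 1)) - F (p k) - f (p k) * (x (p (k + 1)) - x (p k))) := by ring
    rw [e1]
    have hpow : ((p (k + 1) : ℝ) - p k) ^ θ ≤ δ ^ θ :=
      Real.rpow_le_rpow (by linarith) h3.le hθ.le
    have hpos : 0 ≤ ((p (k + 1) : ℝ) - p k) ^ θ := Real.rpow_nonneg (by linarith) _
    calc _ ≤ |(f (ξ k) - f (p k)) * (x (p (k + 1)) - x (p k))| +
          |F (p (k + 1)) - F (p k) - f (p k) * (x (p (k + 1)) - x (p k))| := abs_sub _ _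
      _ ≤ ((p (k + 1) : ℝ) - p k) ^ θ * ν (p k) (p (k + 1)) +
          |C| * (((p (k + 1) : ℝ) - p k) ^ θ * ν (p k) (p (k + 1))) := by
            rw [abs_mul]
            exact add_le_add a2 (a1.trans (mul_le_mul_of_nonneg_right (le_abs_self C)
              (by positivity)))
      _ = K * (((p (k + 1) : ℝ) - p k) ^ θ * ν (p k) (p (k + 1))) := by rw [hK]; ring
      _ ≤ K * (δ ^ θ * ν (p k) (p (k + 1))) := by gcongr
      _ = _ := by ring
  have hsum : ∑ k ∈ range m, ν (p k) (p (k + 1)) ≤ ν 0 1 :=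
    (hν.sum_le m hmono).2.trans (hν.mono (p 0).2.1 (hν.sum_le m hmono).1 (p m).2.2)
  calc _ ≤ ∑ k ∈ range m, K * δ ^ θ * ν (p k) (p (k + 1)) :=
        (Finset.abs_sum_le_sum_abs _ _).trans (Finset.sum_le_sum hterm)
    _ = K * δ ^ θ * ∑ k ∈ range m, ν (p k) (p (k + 1)) := by rw [Finset.mul_sum]
    _ ≤ K * δ ^ θ * ν 0 1 := by
      have : 0 ≤ δ ^ θ := by rw [hδθ]; exact hq.le
      gcongr
    _ < ε := by
      rw [hδθ, mul_div_assoc', div_mul_eq_mul_div, div_lt_iff₀ (by positivity)]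
      nlinarith

/-- Left point sums over a uniform grid. -/
noncomputable def gridSum (f x : I → ℝ) (n : ℕ) (t : I) : ℝ :=
  ∑ k ∈ range n, f (gridPoint n k) * (x (min (gridPoint n (k + 1)) t) - x (min (gridPoint n k) t))

/-- The sewing estimate applies to the grid clipped to `[s, t]`. Clipping moves the left point only
in a cell that contains `s`, and this causes the second term, which vanishes as `n` grows. -/
theorem gridSum_estimate {θ : ℝ} (hθ : 0 < θ) {ν : I → I → ℝ} (hν : IsControl ν) {f x : I → ℝ}
    (hfx : YoungBound θ ν f x) {n : ℕ} (hn : n ≠ 0) {s t : I} (hst : s ≤ t) :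
    |gridSum f x n t - gridSum f x n s - f s * (x t - x s)| ≤
      sewingConst θ * (((t : ℝ) - s) ^ θ * ν s t) + (1 / (n : ℝ)) ^ θ * ν 0 1 := by
  set g := gridPoint n with hg
  set p : ℕ → I := fun k => max s (min (g k) t) with hp
  have gm : ∀ k, g k ≤ g (k + 1) := fun k => gridPoint_mono n (Nat.le_succ k)
  have pm : ∀ k < n, p k ≤ p (k + 1) := fun k _ => max_le_max_left _ (min_le_min_right _ (gm k))
  have p0 : p 0 = s := by
    simp only [hp, hg, gridPoint_zero]
    exact max_eq_left ((min_le_left _ _).trans s.2.1)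
  have pn : p n = t := by
    simp only [hp, hg, gridPoint_self hn]
    rw [min_eq_right unitInterval.le_one', max_eq_right hst]
  have key := sewing_estimate hθ hν hfx n p pm
  rw [p0, pn] at key
  have e1 : ∀ k, x (min (g k) t) - x (min (g k) s) = x (p k) - x s := by
    intro k
    simp only [hp]
    rcases le_total (g k) s with h | h
    · rw [min_eq_left h, min_eq_left (h.trans hst), max_eq_left h, sub_self, sub_self]
    · rw [min_eq_right h, max_eq_right (le_min h hst)]
  have e2 : gridSum f x n t - gridSum f x n s =
      ∑ k ∈ range n, f (p k) * (x (p (k + 1)) - x (p k)) +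
      ∑ k ∈ range n, (f (g k) - f (p k)) * (x (p (k + 1)) - x (p k)) := by
    rw [gridSum, gridSum, ← Finset.sum_sub_distrib, ← Finset.sum_add_distrib]
    refine Finset.sum_congr rfl fun k _ => ?_
    have h1 := e1 k
    have h2 := e1 (k + 1)
    linear_combination f (g k) * (h2 - h1)
  have herr : ∀ k ∈ range n, |(f (g k) - f (p k)) * (x (p (k + 1)) - x (p k))| ≤
      (1 / (n : ℝ)) ^ θ * ν (g k) (g (k + 1)) := by
    intro k _
    have hnn : 0 ≤ (1 / (n : ℝ)) ^ θ * ν (g k) (g (k + 1)) :=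
      mul_nonneg (by positivity) (hν.nonneg _ _ (gm k))
    rcases le_total (g (k + 1)) s with h | h
    · have h1 : p (k + 1) = p k := by
        simp only [hp]
        rw [max_eq_left ((min_le_left _ _).trans h),
          max_eq_left ((min_le_left _ _).trans ((gm k).trans h))]
      simpa [h1] using hnn
    rcases le_total t (g k) with h' | h'
    · have h1 : p (k + 1) = p k := by
        simp only [hp]
        rw [min_eq_right h', min_eq_right (h'.trans (gm k))]
      simpa [h1] using hnn
    rcases le_total s (g k) with h'' | h''
    · have h1 : p k = g k := by
        simp only [hp]
        rw [min_eq_left h', max_eq_right h'']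
      simpa [h1] using hnn
    have h1 : p k = s := by
      simp only [hp]
      rw [min_eq_left h', max_eq_left h'']
    have h2 : p (k + 1) ≤ g (k + 1) := max_le h (min_le_left _ _)
    have h3 : s ≤ p (k + 1) := le_max_left _ _
    have := hfx (g k) s s (p (k + 1)) (g (k + 1)) h'' h h'' h3 h2
    rw [h1, abs_mul, abs_sub_comm (f (g k))]
    refine this.trans (mul_le_mul_of_nonneg_right ?_ (hν.nonneg _ _ (gm k)))
    refine Real.rpow_le_rpow ?_ (gridPoint_succ_sub_le n k) hθ.le
    exact sub_nonneg.2 (gm k)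
  have herr' : |∑ k ∈ range n, (f (g k) - f (p k)) * (x (p (k + 1)) - x (p k))| ≤
      (1 / (n : ℝ)) ^ θ * ν 0 1 := by
    refine (Finset.abs_sum_le_sum_abs _ _).trans ((Finset.sum_le_sum herr).trans ?_)
    rw [← Finset.mul_sum]
    refine mul_le_mul_of_nonneg_left ?_ (by positivity)
    have := (hν.sum_le (p := g) n fun k _ => gm k).2
    rwa [hg, gridPoint_zero, gridPoint_self hn] at this
  rw [e2]
  calc _ = |(∑ k ∈ range n, f (p k) * (x (p (k + 1)) - x (p k)) - f s * (x t - x s)) +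
      ∑ k ∈ range n, (f (g k) - f (p k)) * (x (p (k + 1)) - x (p k))| := by congr 1; ring
    _ ≤ _ := (abs_add_le _ _).trans (add_le_add key herr')

/-- Existence of Young integrals, with the sewing estimate. -/
theorem exists_youngIntegral {θ : ℝ} (hθ : 0 < θ) {ν : I → I → ℝ} (hν : IsControl ν) {f x : I → ℝ}
    (hfx : YoungBound θ ν f x) : ∃ F : I → ℝ, F 0 = 0 ∧ ∀ s t, s ≤ t →
      |F t - F s - f s * (x t - x s)| ≤ sewingConst θ * (((t : ℝ) - s) ^ θ * ν s t) := by
  have h0 : ∀ n, gridSum f x n 0 = 0 := fun n => by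
    refine Finset.sum_eq_zero fun k _ => ?_
    rw [min_eq_right unitInterval.nonneg', min_eq_right unitInterval.nonneg', sub_self,
      mul_zero]
  -- Bounded sequences converge along a free ultrafilter, so no Cauchy estimate is needed. The bound
  -- survives in the limit and characterizes the integral by `HasYoungIntegral.of_control`.
  have hlim : ∀ t, ∃ y, Filter.Tendsto (fun n => gridSum f x (n + 1) t)
      (Filter.hyperfilter ℕ : Filter ℕ) (nhds y) := by
    intro t
    set B := sewingConst θ * (((t : ℝ) - (0 : I)) ^ θ * ν 0 t) + ν 0 1 + |f 0 * (x t - x 0)|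
    have hB : ∀ n, gridSum f x (n + 1) t ∈ Set.Icc (-B) B := by
      intro n
      have h1 := gridSum_estimate hθ hν hfx (Nat.succ_ne_zero n) (unitInterval.nonneg' (t := t))
      have h2 : (1 / ((n + 1 : ℕ) : ℝ)) ^ θ * ν 0 1 ≤ ν 0 1 := by
        refine mul_le_of_le_one_left (hν.nonneg _ _ zero_le_one) ?_
        refine Real.rpow_le_one (by positivity) ?_ hθ.le
        rw [div_le_one (by positivity)]
        push_cast
        linarith [Nat.cast_nonneg (α := ℝ) n]
      change |gridSum f x (n + 1) t - gridSum f x (n + 1) 0 - f 0 * (x t - x 0)| ≤ _ at h1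
      rw [h0, sub_zero] at h1
      rw [Set.mem_Icc, ← abs_le]
      have h3 := abs_sub_abs_le_abs_sub (gridSum f x (n + 1) t) (f 0 * (x t - x 0))
      have h1' := h1.trans (add_le_add_right h2 _)
      change _ ≤ sewingConst θ * (((t : ℝ) - (0 : I)) ^ θ * ν 0 t) + ν 0 1 at h1'
      linarith
    obtain ⟨y, _, hy⟩ := (isCompact_Icc (a := -B) (b := B)).ultrafilter_le_nhds
      ((Filter.hyperfilter ℕ).map fun n => gridSum f x (n + 1) t) (by
        rw [Filter.le_principal_iff]
        exact Filter.mem_map.2 (Filter.univ_mem' hB))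
    exact ⟨y, hy⟩
  choose F hF using hlim
  refine ⟨F, ?_, fun s t hst => ?_⟩
  · refine tendsto_nhds_unique (hF 0) ?_
    simp only [h0]
    exact tendsto_const_nhds
  · have l1 := (((hF t).sub (hF s)).sub_const (f s * (x t - x s))).abs
    have l2 : Filter.Tendsto (fun n : ℕ => sewingConst θ * (((t : ℝ) - s) ^ θ * ν s t) +
        (1 / ((n + 1 : ℕ) : ℝ)) ^ θ * ν 0 1) (Filter.hyperfilter ℕ : Filter ℕ)
        (nhds (sewingConst θ * (((t : ℝ) - s) ^ θ * ν s t) + 0 ^ θ * ν 0 1)) := by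
      refine Filter.Tendsto.mono_left ?_ (Nat.hyperfilter_le_atTop)
      refine Filter.Tendsto.const_add _ (Filter.Tendsto.mul_const _ ?_)
      refine Filter.Tendsto.rpow_const ?_ (Or.inr hθ.le)
      push_cast
      exact tendsto_one_div_add_atTop_nhds_zero_nat
    rw [Real.zero_rpow hθ.ne', zero_mul, add_zero] at l2
    exact le_of_tendsto_of_tendsto' l1 l2 fun n =>
      gridSum_estimate hθ hν hfx (Nat.succ_ne_zero n) hst

/-! ### Paths of finite Riesz variation -/

/-- The sum `∑ (f(p_{k+1}) - f(p_k))² / (p_{k+1} - p_k)^θ`. -/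
noncomputable def rieszSum (θ : ℝ) (f : I → ℝ) (m : ℕ) (p : ℕ → I) : ℝ :=
  ∑ k ∈ range m, (f (p (k + 1)) - f (p k)) ^ 2 / ((p (k + 1) : ℝ) - p k) ^ θ

/-- Through this identity Minkowski's inequality makes the Riesz variation a seminorm. -/
theorem sqrt_rieszSum_eq_norm {θ : ℝ} {f : I → ℝ} {m : ℕ} {p : ℕ → I} (hp : Monotone p) :
    √(rieszSum θ f m p) = ‖WithLp.toLp 2 fun k : Fin m =>
      (f (p (k + 1)) - f (p k)) / √(((p (k + 1) : ℝ) - p k) ^ θ)‖ := by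
  rw [EuclideanSpace.norm_eq, rieszSum, ← Fin.sum_univ_eq_sum_range
    (fun k => (f (p (k + 1)) - f (p k)) ^ 2 / ((p (k + 1) : ℝ) - p k) ^ θ)]
  congr 1
  refine Finset.sum_congr rfl fun k _ => ?_
  rw [Real.norm_eq_abs, sq_abs, div_pow, Real.sq_sqrt]
  exact Real.rpow_nonneg (sub_nonneg.2 (hp (Nat.le_succ _))) _

theorem sqrt_rieszSum_add_le {θ : ℝ} {f g : I → ℝ} {m : ℕ} {p : ℕ → I} (hp : Monotone p) :
    √(rieszSum θ (f + g) m p) ≤ √(rieszSum θ f m p) + √(rieszSum θ g m p) := by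
  rw [sqrt_rieszSum_eq_norm hp, sqrt_rieszSum_eq_norm hp, sqrt_rieszSum_eq_norm hp]
  refine le_trans (le_of_eq ?_) (norm_add_le _ _)
  congr 1
  ext k
  simp only [Pi.add_apply, PiLp.add_apply]
  ring

theorem rieszSum_smul {θ c : ℝ} {f : I → ℝ} {m : ℕ} {p : ℕ → I} :
    rieszSum θ (c • f) m p = c ^ 2 * rieszSum θ f m p := by
  rw [rieszSum, rieszSum, Finset.mul_sum]
  refine Finset.sum_congr rfl fun k _ => ?_
  simp only [Pi.smul_apply, smul_eq_mul]
  ring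

/-- The functions on `[0, 1]` of finite Riesz variation. -/
noncomputable def youngSubmodule (θ : ℝ) : Submodule ℝ (I → ℝ) where
  carrier := {f | ∃ C, ∀ m p, Monotone p → √(rieszSum θ f m p) ≤ C}
  add_mem' := by
    rintro f g ⟨C, hC⟩ ⟨D, hD⟩
    exact ⟨C + D, fun m p hp => (sqrt_rieszSum_add_le hp).trans
      (add_le_add (hC m p hp) (hD m p hp))⟩
  zero_mem' := ⟨0, fun m p hp => by simp [rieszSum]⟩
  smul_mem' := by
    rintro c f ⟨C, hC⟩
    refine ⟨|c| * C, fun m p hp => ?_⟩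
    rw [rieszSum_smul, Real.sqrt_mul (sq_nonneg c), Real.sqrt_sq_eq_abs]
    exact mul_le_mul_of_nonneg_left (hC m p hp) (abs_nonneg c)

/-- The normed space of functions on `[0, 1]` of finite Riesz variation with exponent `θ`. -/
def YoungPath (θ : ℝ) : Type := youngSubmodule θ

namespace YoungPath

variable {θ : ℝ}

noncomputable instance : AddCommGroup (YoungPath θ) :=
  inferInstanceAs (AddCommGroup (youngSubmodule θ))

noncomputable instance : Module ℝ (YoungPath θ) :=
  inferInstanceAs (Module ℝ (youngSubmodule θ))

instance : CoeFun (YoungPath θ) fun _ => I → ℝ := ⟨fun f => f.1⟩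

theorem coe_smul (c : ℝ) (f : YoungPath θ) : ((c • f : YoungPath θ) : I → ℝ) = c • f.1 := rfl

theorem coe_zero : ((0 : YoungPath θ) : I → ℝ) = 0 := rfl

theorem ext {f g : YoungPath θ} (h : ∀ t, f t = g t) : f = g := Subtype.ext (funext h)

noncomputable instance : Norm (YoungPath θ) :=
  ⟨fun f => |f 0| + ⨆ P : ℕ × {p : ℕ → I // Monotone p}, √(rieszSum θ f P.1 P.2.1)⟩

theorem norm_def (f : YoungPath θ) :
    ‖f‖ = |f 0| + ⨆ P : ℕ × {p : ℕ → I // Monotone p}, √(rieszSum θ f P.1 P.2.1) := rfl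

instance : Nonempty (ℕ × {p : ℕ → I // Monotone p}) := ⟨0, fun _ => 0, monotone_const⟩

theorem bddAbove (f : YoungPath θ) :
    BddAbove (Set.range fun P : ℕ × {p : ℕ → I // Monotone p} => √(rieszSum θ f P.1 P.2.1)) := by
  obtain ⟨C, hC⟩ := f.2
  exact ⟨C, by rintro _ ⟨P, rfl⟩; exact hC _ _ P.2.2⟩

theorem sqrt_rieszSum_le_iSup (f : YoungPath θ) {m : ℕ} {p : ℕ → I} (hp : Monotone p) :
    √(rieszSum θ f m p) ≤
      ⨆ P : ℕ × {p : ℕ → I // Monotone p}, √(rieszSum θ f P.1 P.2.1) :=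
  le_ciSup (bddAbove f) (m, ⟨p, hp⟩)

theorem sqrt_rieszSum_le (f : YoungPath θ) {m : ℕ} {p : ℕ → I} (hp : Monotone p) :
    √(rieszSum θ f m p) ≤ ‖f‖ :=
  (sqrt_rieszSum_le_iSup f hp).trans (le_add_of_nonneg_left (abs_nonneg _))

theorem norm_le {f : YoungPath θ} {A B : ℝ} (h0 : |f 0| ≤ A)
    (h : ∀ m p, Monotone p → √(rieszSum θ f m p) ≤ B) : ‖f‖ ≤ A + B :=
  add_le_add h0 (ciSup_le fun P => h _ _ P.2.2)

theorem norm_nonneg' (f : YoungPath θ) : 0 ≤ ‖f‖ :=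
  (Real.sqrt_nonneg _).trans (sqrt_rieszSum_le f (m := 0) (p := fun _ => 0) monotone_const)

theorem rieszSum_le (f : YoungPath θ) {m : ℕ} {p : ℕ → I} (hp : Monotone p) :
    rieszSum θ f m p ≤ ‖f‖ ^ 2 :=
  (Real.sqrt_le_left (norm_nonneg' f)).1 (sqrt_rieszSum_le f hp)

theorem abs_apply_zero_le (f : YoungPath θ) : |f 0| ≤ ‖f‖ :=
  le_add_of_nonneg_right ((Real.sqrt_nonneg _).trans
    (sqrt_rieszSum_le_iSup f (m := 0) (p := fun _ => 0) monotone_const))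

end YoungPath

/-- The Riesz variation of `f` on `[s, t]`. -/
noncomputable def rieszVar (θ : ℝ) (f : I → ℝ) (s t : I) : ℝ :=
  sSup {x | ∃ m p, Monotone p ∧ s ≤ p 0 ∧ p m ≤ t ∧ rieszSum θ f m p = x}

namespace YoungPath

variable {θ : ℝ} (f : YoungPath θ)

theorem rieszVar_bddAbove (s t : I) :
    BddAbove {x | ∃ m p, Monotone p ∧ s ≤ p 0 ∧ p m ≤ t ∧ rieszSum θ f m p = x} :=
  ⟨‖f‖ ^ 2, by rintro _ ⟨m, p, hp, _, _, rfl⟩; exact rieszSum_le f hp⟩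

theorem rieszSum_le_rieszVar {s t : I} {m : ℕ} {p : ℕ → I} (hp : Monotone p) (h0 : s ≤ p 0)
    (hm : p m ≤ t) : rieszSum θ f m p ≤ rieszVar θ f s t :=
  le_csSup (rieszVar_bddAbove f s t) ⟨m, p, hp, h0, hm, rfl⟩

theorem rieszVar_set_nonempty {s t : I} (h : s ≤ t) :
    {x | ∃ m p, Monotone p ∧ s ≤ p 0 ∧ p m ≤ t ∧ rieszSum θ f m p = x}.Nonempty :=
  ⟨_, 0, fun _ => s, monotone_const, le_rfl, h, rfl⟩

theorem rieszVar_le {s t : I} (h : s ≤ t) : rieszVar θ f s t ≤ ‖f‖ ^ 2 :=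
  csSup_le (rieszVar_set_nonempty f h) (by
    rintro _ ⟨m, p, hp, _, _, rfl⟩; exact rieszSum_le f hp)

theorem isControl_rieszVar : IsControl (rieszVar θ f) where
  nonneg s t h := by
    have := rieszSum_le_rieszVar f (m := 0) (p := fun _ => s) monotone_const le_rfl h
    simpa [rieszSum] using this
  superadd s u t hsu hut := by
    rw [← le_sub_iff_add_le]
    refine csSup_le (rieszVar_set_nonempty f hsu) ?_
    rintro _ ⟨m, p, hp, h0, hm, rfl⟩
    rw [le_sub_comm]
    refine csSup_le (rieszVar_set_nonempty f hut) ?_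
    rintro _ ⟨m', p', hp', h0', hm', rfl⟩
    rw [le_sub_iff_add_le']
    -- Concatenation of the two partitions. The joining interval, of index `m`, adds a nonnegative
    -- term.
    set q : ℕ → I := fun k => if k ≤ m then p k else p' (k - (m + 1)) with hq
    have hqm : Monotone q := by
      intro k l hkl
      simp only [hq]
      by_cases h1 : l ≤ m
      · rw [if_pos h1, if_pos (hkl.trans h1)]; exact hp hkl
      · rw [if_neg h1]
        by_cases h2 : k ≤ m
        · rw [if_pos h2]
          exact (hp h2).trans (hm.trans (h0'.trans (hp' (Nat.zero_le _))))
        · rw [if_neg h2]; exact hp' (by omega)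
    have q0 : s ≤ q 0 := by simpa [hq] using h0
    have qm : q (m + 1 + m') ≤ t := by
      simp only [hq]
      rw [if_neg (by omega), Nat.add_sub_cancel_left]
      exact hm'
    refine le_trans ?_ (rieszSum_le_rieszVar f hqm q0 qm)
    rw [rieszSum, rieszSum, rieszSum, Finset.sum_range_add, Finset.sum_range_succ]
    have e1 : ∀ k ∈ range m, (f (q (k + 1)) - f (q k)) ^ 2 / ((q (k + 1) : ℝ) - q k) ^ θ =
        (f (p (k + 1)) - f (p k)) ^ 2 / ((p (k + 1) : ℝ) - p k) ^ θ := by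
      intro k hk
      have hk := mem_range.1 hk
      simp only [hq]
      rw [if_pos (by omega), if_pos hk.le]
    have e2 : ∀ k ∈ range m', (f (q (m + 1 + k + 1)) - f (q (m + 1 + k))) ^ 2 /
        ((q (m + 1 + k + 1) : ℝ) - q (m + 1 + k)) ^ θ =
        (f (p' (k + 1)) - f (p' k)) ^ 2 / ((p' (k + 1) : ℝ) - p' k) ^ θ := by
      intro k hk
      simp only [hq]
      have i1 : m + 1 + k + 1 - (m + 1) = k + 1 := by omega
      have i2 : m + 1 + k - (m + 1) = k := by omega
      rw [if_neg (by omega), if_neg (by omega), i1, i2]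
    have e2' := Finset.sum_congr rfl e2
    simp only [add_assoc] at e2' ⊢
    rw [Finset.sum_congr rfl e1, e2']
    have : 0 ≤ (f (q (m + 1)) - f (q m)) ^ 2 / ((q (m + 1) : ℝ) - q m) ^ θ :=
      div_nonneg (sq_nonneg _) (Real.rpow_nonneg (sub_nonneg.2 (hqm (Nat.le_succ m))) _)
    linarith

/-- The two-point partition competes in the supremum; if the points coincide, both sides are
nonnegative or zero as needed. -/
theorem sq_sub_le {s t : I} (h : s ≤ t) :
    (f t - f s) ^ 2 ≤ ((t : ℝ) - s) ^ θ * rieszVar θ f s t := by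
  rcases eq_or_lt_of_le h with rfl | hlt
  · simp only [sub_self, ne_eq, OfNat.ofNat_ne_zero, not_false_eq_true, zero_pow]
    exact mul_nonneg (Real.rpow_nonneg le_rfl _) ((isControl_rieszVar f).nonneg _ _ le_rfl)
  · have hpos : 0 < ((t : ℝ) - s) ^ θ := Real.rpow_pos_of_pos (sub_pos.2 hlt) _
    rw [mul_comm, ← div_le_iff₀ hpos]
    have := rieszSum_le_rieszVar f (s := s) (t := t) (m := 1) (p := fun k => if k = 0 then s else t)
      (by
        intro k l hkl
        dsimp only
        split_ifs with h1 h2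
        · exact le_rfl
        · exact h
        · omega
        · exact le_rfl) (by simp) (by simp)
    simpa [rieszSum] using this

theorem abs_sub_le {s t : I} (h : s ≤ t) :
    |f t - f s| ≤ √(((t : ℝ) - s) ^ θ) * √(rieszVar θ f s t) := by
  rw [← Real.sqrt_mul (Real.rpow_nonneg (sub_nonneg.2 h) _)]
  exact Real.abs_le_sqrt (sq_sub_le f h)

theorem abs_apply_le (hθ : 0 < θ) (t : I) : |f t| ≤ 2 * ‖f‖ := by
  have h1 := abs_apply_zero_le f
  have h2 := abs_sub_le f (s := 0) (t := t) unitInterval.nonneg'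
  have h3 : √(((t : ℝ) - (0 : I)) ^ θ) ≤ 1 := by
    rw [Real.sqrt_le_one]
    refine Real.rpow_le_one ?_ ?_ hθ.le
    · simpa using t.2.1
    · simpa using t.2.2
  have h4 : √(rieszVar θ f 0 t) ≤ ‖f‖ :=
    (Real.sqrt_le_left (norm_nonneg' f)).2 (rieszVar_le f unitInterval.nonneg')
  have h5 : |f t| ≤ |f t - f 0| + |f 0| := by
    simpa using abs_add_le (f t - f 0) (f 0)
  have h6 : √(((t : ℝ) - (0 : I)) ^ θ) * √(rieszVar θ f 0 t) ≤ 1 * ‖f‖ :=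
    mul_le_mul h3 h4 (Real.sqrt_nonneg _) zero_le_one
  linarith

/-- Each increment contributes `(t - s)^(θ/2)` and the root of a control. The product of two such
roots is again a control (`IsControl.sqrt_mul_sqrt`), so any `θ > 0` suffices for Young integration.
-/
theorem youngBound (hθ : 0 < θ) (f x : YoungPath θ) :
    YoungBound θ (fun s t => √(rieszVar θ f s t) * √(rieszVar θ x s t)) f x := by
  intro s u v v' t hsu hut hsv hvv hvt
  have a1 := abs_sub_le f hsu
  have a2 := abs_sub_le x hvv
  have b1 : √(((u : ℝ) - s) ^ θ) ≤ √(((t : ℝ) - s) ^ θ) :=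
    Real.sqrt_le_sqrt (Real.rpow_le_rpow (sub_nonneg.2 hsu) (by
      have h1 : (u : ℝ) ≤ t := hut
      linarith) hθ.le)
  have b2 : √(((v' : ℝ) - v) ^ θ) ≤ √(((t : ℝ) - s) ^ θ) :=
    Real.sqrt_le_sqrt (Real.rpow_le_rpow (sub_nonneg.2 hvv) (by
      have h1 : (v' : ℝ) ≤ t := hvt
      have h2 : (s : ℝ) ≤ v := hsv
      linarith) hθ.le)
  have c1 : √(rieszVar θ f s u) ≤ √(rieszVar θ f s t) :=
    Real.sqrt_le_sqrt ((isControl_rieszVar f).mono le_rfl hsu hut)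
  have c2 : √(rieszVar θ x v v') ≤ √(rieszVar θ x s t) :=
    Real.sqrt_le_sqrt ((isControl_rieszVar x).mono hsv hvv hvt)
  have hst : (0 : ℝ) ≤ (t : ℝ) - s := sub_nonneg.2 (hsu.trans hut)
  calc _ ≤ (√(((t : ℝ) - s) ^ θ) * √(rieszVar θ f s t)) *
        (√(((t : ℝ) - s) ^ θ) * √(rieszVar θ x s t)) := by
        refine mul_le_mul (a1.trans ?_) (a2.trans ?_) (abs_nonneg _) (by positivity)
        · gcongr
        · gcongr
    _ = (√(((t : ℝ) - s) ^ θ) * √(((t : ℝ) - s) ^ θ)) *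
        (√(rieszVar θ f s t) * √(rieszVar θ x s t)) := by ring
    _ = _ := by rw [Real.mul_self_sqrt (Real.rpow_nonneg hst _)]

end YoungPath

/-- Converse of `YoungPath.sq_sub_le`; new paths are shown to have finite Riesz variation in this
way. -/
theorem rieszSum_le_of_control {θ : ℝ} {f : I → ℝ} {ν : I → I → ℝ} (hν : IsControl ν)
    (h : ∀ s t, s ≤ t → (f t - f s) ^ 2 ≤ ((t : ℝ) - s) ^ θ * ν s t) {m : ℕ} {p : ℕ → I}
    (hp : Monotone p) : rieszSum θ f m p ≤ ν 0 1 := by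
  have h1 := hν.sum_le (p := p) m fun k _ => hp (Nat.le_succ k)
  refine le_trans (Finset.sum_le_sum fun k _ => ?_)
    (h1.2.trans (hν.mono unitInterval.nonneg' h1.1 unitInterval.le_one'))
  have hk : p k ≤ p (k + 1) := hp (Nat.le_succ k)
  refine div_le_of_le_mul₀ (Real.rpow_nonneg (sub_nonneg.2 hk) _) (hν.nonneg _ _ hk) ?_
  rw [mul_comm]
  exact h _ _ hk

theorem mem_youngSubmodule_of_control {θ : ℝ} {f : I → ℝ} {ν : I → I → ℝ} (hν : IsControl ν)
    (h : ∀ s t, s ≤ t → (f t - f s) ^ 2 ≤ ((t : ℝ) - s) ^ θ * ν s t) : f ∈ youngSubmodule θ :=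
  ⟨√(ν 0 1), fun _ _ hp => Real.sqrt_le_sqrt (rieszSum_le_of_control hν h hp)⟩

namespace YoungPath

variable {θ : ℝ}

theorem normedSpaceCore : NormedSpace.Core ℝ (YoungPath θ) where
  norm_nonneg := norm_nonneg'
  norm_smul c f := by
    rw [norm_def, norm_def, coe_smul, Real.norm_eq_abs, mul_add, Real.mul_iSup_of_nonneg
      (abs_nonneg c)]
    congr 1
    · simp [abs_mul]
    · congr 1
      funext P
      rw [rieszSum_smul, Real.sqrt_mul (sq_nonneg c), Real.sqrt_sq_eq_abs]
  norm_triangle f g := by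
    have : ‖f‖ + ‖g‖ = (|f 0| + |g 0|) +
        ((⨆ P : ℕ × {p : ℕ → I // Monotone p}, √(rieszSum θ f P.1 P.2.1)) +
        ⨆ P : ℕ × {p : ℕ → I // Monotone p}, √(rieszSum θ g P.1 P.2.1)) := by
      rw [norm_def, norm_def]; ring
    rw [this]
    refine norm_le (abs_add_le _ _) fun m p hp => (sqrt_rieszSum_add_le hp).trans ?_
    exact add_le_add (sqrt_rieszSum_le_iSup f hp) (sqrt_rieszSum_le_iSup g hp)
  norm_eq_zero_iff f := by
    constructor
    · intro h
      refine ext fun t => ?_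
      have h0 := abs_apply_zero_le f
      have h1 := sq_sub_le f (s := 0) (t := t) unitInterval.nonneg'
      have h2 := rieszVar_le f (s := 0) (t := t) unitInterval.nonneg'
      have h3 := (isControl_rieszVar f).nonneg 0 t unitInterval.nonneg'
      rw [h] at h0 h2
      have h4 : rieszVar θ f 0 t = 0 := by
        refine le_antisymm (by simpa using h2) h3
      have h5 : f 0 = 0 := by simpa using h0
      rw [h4, mul_zero, h5, sub_zero] at h1
      have : f t = 0 := by nlinarith [sq_nonneg (f t)]
      exact this
    · rintro rfl
      simp [norm_def, coe_zero, rieszSum]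

noncomputable instance : NormedAddCommGroup (YoungPath θ) :=
  NormedAddCommGroup.ofCore normedSpaceCore

noncomputable instance : NormedSpace ℝ (YoungPath θ) := NormedSpace.ofCore normedSpaceCore

/-- Evaluation at a point, as a linear map. -/
noncomputable def evalLM (θ : ℝ) (t : I) : YoungPath θ →ₗ[ℝ] ℝ where
  toFun f := f t
  map_add' _ _ := rfl
  map_smul' _ _ := rfl

/-- Evaluation at a point, as a continuous linear map. -/
noncomputable def evalCLM (hθ : 0 < θ) (t : I) : YoungPath θ →L[ℝ] ℝ :=
  (evalLM θ t).mkContinuous 2 fun f => abs_apply_le f hθ t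

end YoungPath

/-! ### Linearity of the Young integral and the Young integral as a bilinear map -/

namespace HasYoungIntegral

variable {f g x y : I → ℝ} {t : I} {J J' : ℝ}

theorem youngIntegral_eq (h : HasYoungIntegral f x t J) : youngIntegral f x t = J := by
  have hex : ∃ J, HasYoungIntegral f x t J := ⟨J, h⟩
  rw [youngIntegral, dif_pos hex]
  exact hex.choose_spec.unique h

theorem zero_left (x : I → ℝ) (t : I) : HasYoungIntegral (fun _ => 0) x t 0 := fun ε hε =>
  ⟨1, one_pos, fun m p ξ _ _ _ => by simpa using hε⟩

/-- Phrased for single summands so that additivity in the integrand and in the integrator are both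
instances. -/
theorem add_of_sums {f₁ f₂ x₁ x₂ f₃ x₃ : I → ℝ} (h : HasYoungIntegral f₁ x₁ t J)
    (h' : HasYoungIntegral f₂ x₂ t J')
    (e : ∀ u s s', f₃ u * (x₃ s' - x₃ s) = f₁ u * (x₁ s' - x₁ s) + f₂ u * (x₂ s' - x₂ s)) :
    HasYoungIntegral f₃ x₃ t (J + J') := by
  intro ε hε
  obtain ⟨δ, hδ, H⟩ := h _ (half_pos hε)
  obtain ⟨δ', hδ', H'⟩ := h' _ (half_pos hε)
  refine ⟨min δ δ', lt_min hδ hδ', fun m p ξ h0 hm hp => ?_⟩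
  have a1 := H m p ξ h0 hm fun k hk =>
    ⟨(hp k hk).1, (hp k hk).2.1, (hp k hk).2.2.trans_le (min_le_left _ _)⟩
  have a2 := H' m p ξ h0 hm fun k hk =>
    ⟨(hp k hk).1, (hp k hk).2.1, (hp k hk).2.2.trans_le (min_le_right _ _)⟩
  simp only [e, Finset.sum_add_distrib]
  rw [add_sub_add_comm]
  exact (abs_add_le _ _).trans_lt (by linarith)

theorem const_mul_of_sums {f₃ x₃ : I → ℝ} (c : ℝ) (h : HasYoungIntegral f x t J)
    (e : ∀ u s s', f₃ u * (x₃ s' - x₃ s) = c * (f u * (x s' - x s))) :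
    HasYoungIntegral f₃ x₃ t (c * J) := by
  intro ε hε
  obtain ⟨δ, hδ, H⟩ := h (ε / (|c| + 1)) (by positivity)
  refine ⟨δ, hδ, fun m p ξ h0 hm hp => ?_⟩
  have a1 := H m p ξ h0 hm hp
  simp only [e, ← Finset.mul_sum]
  rw [← mul_sub, abs_mul]
  rw [lt_div_iff₀ (by positivity)] at a1
  nlinarith [abs_nonneg c, abs_nonneg (∑ k ∈ range m, f (ξ k) * (x (p (k + 1)) - x (p k)) - J)]

theorem add (h : HasYoungIntegral f x t J) (h' : HasYoungIntegral g x t J') :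
    HasYoungIntegral (fun s => f s + g s) x t (J + J') :=
  h.add_of_sums h' fun _ _ _ => by ring

theorem add_right (h : HasYoungIntegral f x t J) (h' : HasYoungIntegral f y t J') :
    HasYoungIntegral f (fun s => x s + y s) t (J + J') :=
  h.add_of_sums h' fun _ _ _ => by ring

theorem const_mul (c : ℝ) (h : HasYoungIntegral f x t J) :
    HasYoungIntegral (fun s => c * f s) x t (c * J) :=
  h.const_mul_of_sums c fun _ _ _ => by ring

theorem const_mul_right (c : ℝ) (h : HasYoungIntegral f x t J) :
    HasYoungIntegral f (fun s => c * x s) t (c * J) :=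
  h.const_mul_of_sums c fun _ _ _ => by ring

theorem sum {ι : Type*} (A : Finset ι) {f : ι → I → ℝ} {J : ι → ℝ}
    (h : ∀ i ∈ A, HasYoungIntegral (f i) x t (J i)) :
    HasYoungIntegral (fun s => ∑ i ∈ A, f i s) x t (∑ i ∈ A, J i) := by
  classical
  induction A using Finset.induction_on with
  | empty => simpa using zero_left x t
  | insert a A ha ih =>
    simp only [Finset.sum_insert ha]
    exact (h a (mem_insert_self a A)).add (ih fun i hi => h i (mem_insert_of_mem hi))

end HasYoungIntegral

namespace YoungPath

variable {θ : ℝ}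

theorem exists_integral (hθ : 0 < θ) (f x : YoungPath θ) : ∃ F : I → ℝ, F 0 = 0 ∧
    (∀ s t, s ≤ t → |F t - F s - f s * (x t - x s)| ≤
      sewingConst θ * (((t : ℝ) - s) ^ θ * (√(rieszVar θ f s t) * √(rieszVar θ x s t)))) ∧
    ∀ t, HasYoungIntegral f x t (F t) := by
  have hc := (isControl_rieszVar f).sqrt_mul_sqrt (isControl_rieszVar x)
  obtain ⟨F, h0, hF⟩ := exists_youngIntegral hθ hc (youngBound hθ f x)
  exact ⟨F, h0, hF, HasYoungIntegral.of_control hθ hc (youngBound hθ f x) h0 hF⟩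

theorem hasYoungIntegral (hθ : 0 < θ) (f x : YoungPath θ) (t : I) :
    HasYoungIntegral f x t (youngIntegral f x t) := by
  obtain ⟨F, _, _, h⟩ := exists_integral hθ f x
  rw [(h t).youngIntegral_eq]
  exact h t

theorem youngIntegral_zero (hθ : 0 < θ) (f x : YoungPath θ) : youngIntegral f x 0 = 0 := by
  obtain ⟨F, h0, _, h⟩ := exists_integral hθ f x
  rw [(h 0).youngIntegral_eq, h0]

theorem youngIntegral_estimate (hθ : 0 < θ) (f x : YoungPath θ) {s t : I} (hst : s ≤ t) :
    |youngIntegral f x t - youngIntegral f x s - f s * (x t - x s)| ≤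
      sewingConst θ * (((t : ℝ) - s) ^ θ * (√(rieszVar θ f s t) * √(rieszVar θ x s t))) := by
  obtain ⟨F, _, hF, h⟩ := exists_integral hθ f x
  rw [(h t).youngIntegral_eq, (h s).youngIntegral_eq]
  exact hF s t hst

theorem sub_rpow_mem_Icc (hθ : 0 < θ) {s t : I} (hst : s ≤ t) :
    ((t : ℝ) - s) ^ θ ∈ Set.Icc (0 : ℝ) 1 := by
  have h : (0 : ℝ) ≤ (t : ℝ) - s := sub_nonneg.2 hst
  refine ⟨Real.rpow_nonneg h _, Real.rpow_le_one h ?_ hθ.le⟩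
  linarith [t.2.2, s.2.1]

/-- The integral inherits its variation from the integrator. The main term `f s * (x t - x s)`
obviously does; the sewing error has the factor `D = (t - s)^θ ≤ 1` and hence `D ≤ √D`. -/
theorem sq_youngIntegral_sub_le (hθ : 0 < θ) (f x : YoungPath θ) {s t : I} (hst : s ≤ t) :
    (youngIntegral f x t - youngIntegral f x s) ^ 2 ≤
      ((t : ℝ) - s) ^ θ * (((2 + sewingConst θ) * ‖f‖) ^ 2 * rieszVar θ x s t) := by
  have h1 := youngIntegral_estimate hθ f x hst
  have h2 := abs_sub_le x hst
  have h3 := abs_apply_le f hθ s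
  have h4 : √(rieszVar θ f s t) ≤ ‖f‖ :=
    (Real.sqrt_le_left (norm_nonneg f)).2 (rieszVar_le f hst)
  obtain ⟨h5, h6⟩ := sub_rpow_mem_Icc hθ hst
  have hC := (sewingConst_pos hθ).le
  set D := ((t : ℝ) - s) ^ θ with hD
  have h7 : D ≤ √D := Real.le_sqrt_of_sq_le (by nlinarith)
  have hx := (isControl_rieszVar x).nonneg _ _ hst
  have h8 : |youngIntegral f x t - youngIntegral f x s| ≤
      √D * (((2 + sewingConst θ) * ‖f‖) * √(rieszVar θ x s t)) := by
    have e : youngIntegral f x t - youngIntegral f x s =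
      (youngIntegral f x t - youngIntegral f x s - f s * (x t - x s)) + f s * (x t - x s) := by ring
    rw [e]
    refine (abs_add_le _ _).trans ?_
    rw [abs_mul]
    calc _ ≤ sewingConst θ * (√D * (‖f‖ * √(rieszVar θ x s t))) +
        2 * ‖f‖ * (√D * √(rieszVar θ x s t)) := by
          refine add_le_add (h1.trans ?_) ?_
          · gcongr
          · gcongr
      _ = _ := by ring
  calc _ = |youngIntegral f x t - youngIntegral f x s| ^ 2 := (sq_abs _).symm
    _ ≤ (√D * (((2 + sewingConst θ) * ‖f‖) * √(rieszVar θ x s t))) ^ 2 := by gcongr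
    _ = _ := by rw [mul_pow, mul_pow, Real.sq_sqrt h5, Real.sq_sqrt hx]

theorem isControl_integral (f x : YoungPath θ) :
    IsControl fun s t => ((2 + sewingConst θ) * ‖f‖) ^ 2 * rieszVar θ x s t :=
  (isControl_rieszVar x).const_mul (sq_nonneg _)

/-- The path `t ↦ ∫_0^t f dx`. -/
noncomputable def integral (hθ : 0 < θ) (f x : YoungPath θ) : YoungPath θ :=
  ⟨fun t => youngIntegral f x t, mem_youngSubmodule_of_control (isControl_integral f x)
    fun _ _ h => sq_youngIntegral_sub_le hθ f x h⟩

theorem integral_apply (hθ : 0 < θ) (f x : YoungPath θ) (t : I) :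
    integral hθ f x t = youngIntegral f x t := rfl

theorem norm_integral_le (hθ : 0 < θ) (f x : YoungPath θ) :
    ‖integral hθ f x‖ ≤ (2 + sewingConst θ) * ‖f‖ * ‖x‖ := by
  have hC := (sewingConst_pos hθ).le
  have := norm_le (f := integral hθ f x) (A := 0) (B := (2 + sewingConst θ) * ‖f‖ * ‖x‖)
    (by rw [integral_apply, youngIntegral_zero hθ, abs_zero]) fun m p hp => by
      refine (Real.sqrt_le_left (by positivity)).2 ?_
      refine (rieszSum_le_of_control (isControl_integral f x)
        (fun _ _ h => sq_youngIntegral_sub_le hθ f x h) hp).trans ?_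
      rw [mul_pow _ ‖x‖]
      exact mul_le_mul_of_nonneg_left (rieszVar_le x zero_le_one) (sq_nonneg _)
  simpa using this

/-- The Young integral as a continuous bilinear map. -/
noncomputable def integralCLM (hθ : 0 < θ) : YoungPath θ →L[ℝ] YoungPath θ →L[ℝ] YoungPath θ :=
  LinearMap.mkContinuous₂ (LinearMap.mk₂ ℝ (integral hθ)
    (fun f g x => ext fun t => ((hasYoungIntegral hθ f x t).add
      (hasYoungIntegral hθ g x t)).youngIntegral_eq)
    (fun c f x => ext fun t => ((hasYoungIntegral hθ f x t).const_mul c).youngIntegral_eq)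
    (fun f x y => ext fun t => ((hasYoungIntegral hθ f x t).add_right
      (hasYoungIntegral hθ f y t)).youngIntegral_eq)
    (fun c f x => ext fun t => ((hasYoungIntegral hθ f x t).const_mul_right c).youngIntegral_eq))
    (2 + sewingConst θ) (norm_integral_le hθ)

/-- Constant paths. -/
noncomputable def const (θ c : ℝ) : YoungPath θ :=
  ⟨fun _ => c, 0, fun m p _ => by simp [rieszSum]⟩

theorem const_apply (c : ℝ) (t : I) : const θ c t = c := rfl

/-- By the local characterization, `F - F 0` is the Young integral of zero against zero. -/
theorem constant_of_control (hθ : 0 < θ) {ν : I → I → ℝ} (hν : IsControl ν) {F : I → ℝ} {C : ℝ}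
    (hF : ∀ s t, s ≤ t → |F t - F s| ≤ C * (((t : ℝ) - s) ^ θ * ν s t)) (t : I) : F t = F 0 := by
  have h := HasYoungIntegral.of_control hθ hν (f := fun _ => 0) (x := fun _ => 0)
    (F := fun t => F t - F 0) (C := C)
    (fun s u v v' t h1 h2 h3 h4 h5 => by
      simp only [sub_self, abs_zero, mul_zero]
      exact mul_nonneg (Real.rpow_nonneg (sub_nonneg.2 (h1.trans h2)) _)
        (hν.nonneg _ _ (h1.trans h2))) (sub_self _)
    (fun s t hst => by simpa using hF s t hst) t
  exact sub_eq_zero.1 (h.unique (HasYoungIntegral.zero_left _ t))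

/-- A path whose increments are approximated by those of a sum of Young integrals is that sum. -/
theorem eq_sum_youngIntegral {ι : Type*} [Fintype ι] (hθ : 0 < θ) {ν : I → I → ℝ}
    (hν : IsControl ν) (f x : ι → YoungPath θ) {F : I → ℝ} {C : ℝ}
    (hF : ∀ s t, s ≤ t → |F t - F s - ∑ i, f i s * (x i t - x i s)| ≤
      C * (((t : ℝ) - s) ^ θ * ν s t)) (t : I) :
    F t - F 0 = ∑ i, youngIntegral (f i) (x i) t := by
  have hC := (sewingConst_pos hθ).le
  set w : I → I → ℝ := fun s t => |C| * ν s t +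
    ∑ i, sewingConst θ * (√(rieszVar θ (f i) s t) * √(rieszVar θ (x i) s t)) with hw
  have hwc : IsControl w := (hν.const_mul (abs_nonneg C)).add (IsControl.sum _ fun i _ =>
    ((isControl_rieszVar (f i)).sqrt_mul_sqrt (isControl_rieszVar (x i))).const_mul hC)
  -- The leading terms of both sides cancel, so their difference has increments of sewing order and
  -- is constant.
  have key := constant_of_control hθ hwc (C := 1)
    (F := fun t => F t - ∑ i, youngIntegral (f i) (x i) t) (fun s t hst => ?_) t
  · simp only [youngIntegral_zero hθ, Finset.sum_const_zero, sub_zero] at key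
    linarith
  · have e : F t - ∑ i, youngIntegral (f i) (x i) t - (F s - ∑ i, youngIntegral (f i) (x i) s) =
        (F t - F s - ∑ i, f i s * (x i t - x i s)) -
        ∑ i, (youngIntegral (f i) (x i) t - youngIntegral (f i) (x i) s -
          f i s * (x i t - x i s)) := by
      simp only [Finset.sum_sub_distrib]
      ring
    rw [e]
    have hpos : 0 ≤ ((t : ℝ) - s) ^ θ * ν s t :=
      mul_nonneg (sub_rpow_mem_Icc hθ hst).1 (hν.nonneg _ _ hst)
    calc _ ≤ |C| * (((t : ℝ) - s) ^ θ * ν s t) + ∑ i, sewingConst θ * (((t : ℝ) - s) ^ θ *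
          (√(rieszVar θ (f i) s t) * √(rieszVar θ (x i) s t))) := by
          refine (abs_sub _ _).trans (add_le_add ((hF s t hst).trans
            (mul_le_mul_of_nonneg_right (le_abs_self C) hpos)) ?_)
          exact (Finset.abs_sum_le_sum_abs _ _).trans
            (Finset.sum_le_sum fun i _ => youngIntegral_estimate hθ (f i) (x i) hst)
      _ = 1 * (((t : ℝ) - s) ^ θ * w s t) := by
          rw [hw]
          simp only [mul_add, Finset.mul_sum]
          congr 1
          · ring
          · exact Finset.sum_congr rfl fun i _ => by ring

end YoungPath

/-! ### Signatures of paths of finite Riesz variation -/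

namespace YoungPath

variable {θ : ℝ} {d : ℕ}

/-- The iterated integrals of a tuple of paths, as paths. -/
noncomputable def iterated (hθ : 0 < θ) (x : Fin d → YoungPath θ) : List (Fin d) → YoungPath θ
  | [] => const θ 1
  | i :: w => integralCLM hθ (iterated hθ x w) (x i)

/-- Each letter applies a bounded bilinear map, so an iterated integral is a continuous polynomial
in the paths. -/
theorem contDiff_iterated (hθ : 0 < θ) (w : List (Fin d)) :
    ContDiff ℝ ∞ fun x : Fin d → YoungPath θ => iterated hθ x w := by
  induction w with
  | nil => exact contDiff_const
  | cons i w ih =>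
    exact ((integralCLM hθ).contDiff.comp ih).clm_apply (contDiff_apply ℝ (YoungPath θ) i)

theorem iteratedIntegral_eq (hθ : 0 < θ) (x : Fin d → YoungPath θ)
    {h : I → EuclideanSpace ℝ (Fin d)} (hx : ∀ i t, h t i = x i t) (w : List (Fin d)) :
    iteratedIntegral h w = iterated hθ x w := by
  induction w with
  | nil => rfl
  | cons i w ih =>
    funext t
    have e : (fun s => h s i) = x i := funext (hx i)
    rw [iteratedIntegral, ih, e]
    rfl

theorem hasSignature (hθ : 0 < θ) (x : Fin d → YoungPath θ)
    {h : I → EuclideanSpace ℝ (Fin d)} (hx : ∀ i t, h t i = x i t) (N : ℕ) : HasSignature N h := by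
  intro i w _ t
  have e : (fun s => h s i) = x i := funext (hx i)
  rw [iteratedIntegral_eq hθ x hx, e]
  exact ⟨_, hasYoungIntegral hθ _ _ t⟩

theorem signature_apply (hθ : 0 < θ) (x : Fin d → YoungPath θ)
    {h : I → EuclideanSpace ℝ (Fin d)} (hx : ∀ i t, h t i = x i t) {N : ℕ} (t : I)
    (w : Word d N) : signature N h t w = iterated hθ x w.1.reverse t := by
  rw [signature, iteratedIntegral_eq hθ x hx]

end YoungPath

/-- Characterization of the iterated integrals by the equations that they satisfy. -/
theorem iteratedIntegral_unique {d : ℕ} {h : I → EuclideanSpace ℝ (Fin d)} {N : ℕ}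
    (Y : List (Fin d) → I → ℝ) (h0 : ∀ t, Y [] t = 1)
    (hY : ∀ i w, w.length < N → ∀ t, HasYoungIntegral (Y w) (fun s => h s i) t (Y (i :: w) t))
    (w : List (Fin d)) (hw : w.length ≤ N) : iteratedIntegral h w = Y w := by
  induction w with
  | nil => exact funext fun t => (h0 t).symm
  | cons i w ih =>
    funext t
    rw [iteratedIntegral, ih (by simp at hw; omega)]
    exact (hY i w (by simpa using hw) t).youngIntegral_eq

/-- A Young integral against a continuously differentiable path. -/
theorem HasYoungIntegral.of_hasDerivAt {f x F : I → ℝ} {f' x' F' : ℝ → ℝ} {K M : ℝ}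
    (hf : ∀ s t : I, |f t - f s| ≤ K * |(t : ℝ) - s|) (hM : ∀ t : I, |x' t| ≤ M)
    (hx : ∀ t, HasDerivAt f' (x' t) t) (hxx : ∀ t : I, x t = f' t)
    (hF : ∀ t : I, HasDerivAt F' (f t * x' t) t) (hFF : ∀ t : I, F t = F' t) (hF0 : F 0 = 0)
    (t : I) : HasYoungIntegral f x t (F t) := by
  have hK : 0 ≤ K := by
    have := (abs_nonneg _).trans (hf 0 1)
    simpa using this
  have hM0 : 0 ≤ M := (abs_nonneg _).trans (hM 0)
  have hlen : IsControl fun s t : I => (t : ℝ) - s :=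
    ⟨fun s t h => sub_nonneg.2 h, fun s u t _ _ => by linarith⟩
  have hxinc : ∀ s t : I, s ≤ t → |x t - x s| ≤ M * ((t : ℝ) - s) := by
    intro s t hst
    have := (convex_Icc (0 : ℝ) 1).norm_image_sub_le_of_norm_hasDerivWithin_le (f := f')
      (f' := x') (C := M) (fun u _ => (hx u).hasDerivWithinAt) (fun u hu => hM ⟨u, hu⟩) s.2 t.2
    rw [hxx, hxx]
    simpa [Real.norm_eq_abs, abs_of_nonneg (sub_nonneg.2 (show (s : ℝ) ≤ t from hst))] using this
  -- Both paths are Lipschitz, so products of increments are quadratic in the length: exponent `θ =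
  -- 1` times a multiple of the length as control.
  refine HasYoungIntegral.of_control (θ := 1) (C := 1) (ν := fun s t => (K * M) * ((t : ℝ) - s))
    one_pos (hlen.const_mul (by positivity)) ?_ hF0 ?_ t
  · intro s u v v' t h1 h2 h3 h4 h5
    have h1' : (s : ℝ) ≤ u := h1
    have h2' : (u : ℝ) ≤ t := h2
    have h3' : (s : ℝ) ≤ v := h3
    have h4' : (v : ℝ) ≤ v' := h4
    have h5' : (v' : ℝ) ≤ t := h5
    have a1 := hf s u
    rw [abs_of_nonneg (sub_nonneg.2 h1')] at a1
    rw [Real.rpow_one]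
    calc _ ≤ (K * ((t : ℝ) - s)) * (M * ((t : ℝ) - s)) := by
          refine mul_le_mul (a1.trans ?_) ((hxinc v v' h4).trans ?_) (abs_nonneg _) ?_
          · gcongr
          · gcongr
          · have : (0 : ℝ) ≤ (t : ℝ) - s := by linarith
            positivity
      _ = _ := by ring
  · intro s t hst
    have hst' : (s : ℝ) ≤ t := hst
    -- Mean value inequality for `u ↦ F' u - f s * f' u`, whose derivative is `(f u - f s) * x' u`.
    -- The case split only extends `f` beyond `[0, 1]`.
    have key := (convex_Icc (s : ℝ) t).norm_image_sub_le_of_norm_hasDerivWithin_le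
      (f := fun u => F' u - f s * f' u)
      (f' := fun u => (if hu : u ∈ Set.Icc (0 : ℝ) 1 then f ⟨u, hu⟩ * x' u else 0) -
        f s * x' u) (C := K * ((t : ℝ) - s) * M)
      (fun u hu => by
        have hu' : u ∈ Set.Icc (0 : ℝ) 1 := ⟨s.2.1.trans hu.1, hu.2.trans t.2.2⟩
        rw [dif_pos hu']
        exact ((hF ⟨u, hu'⟩).sub ((hx u).const_mul (f s))).hasDerivWithinAt)
      (fun u hu => by
        have hu' : u ∈ Set.Icc (0 : ℝ) 1 := ⟨s.2.1.trans hu.1, hu.2.trans t.2.2⟩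
        rw [dif_pos hu', ← sub_mul, norm_mul, Real.norm_eq_abs,
          Real.norm_eq_abs]
        have a1 := hf s ⟨u, hu'⟩
        refine mul_le_mul (a1.trans ?_) (hM ⟨u, hu'⟩) (abs_nonneg _)
          (mul_nonneg hK (by linarith))
        rw [abs_of_nonneg (sub_nonneg.2 hu.1)]
        exact mul_le_mul_of_nonneg_left (by linarith [hu.2]) hK)
      (Set.left_mem_Icc.2 hst') (Set.right_mem_Icc.2 hst')
    rw [Real.rpow_one, one_mul, hFF, hFF, hxx, hxx]
    rw [Real.norm_eq_abs, Real.norm_eq_abs, abs_of_nonneg (sub_nonneg.2 hst')] at key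
    calc _ = |F' t - f s * f' t - (F' s - f s * f' s)| := by congr 1; ring
      _ ≤ _ := key
      _ = _ := by ring

/-! ### Cameron--Martin paths have finite Riesz variation -/

/-- The two inner points are convex combinations of the outer ones with exchanged weights. Applied
to `± r^(2H)`, this fixes the sign of the covariance of disjoint increments. -/
theorem ConvexOn.four_point {φ : ℝ → ℝ} (hφ : ConvexOn ℝ (Set.Ici 0) φ) {x u v : ℝ} (hx : 0 ≤ x)
    (hu : 0 ≤ u) (hv : 0 ≤ v) : φ (x + u) + φ (x + v) ≤ φ (x + u + v) + φ x := by
  rcases (add_nonneg hu hv).eq_or_lt with h | h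
  · have h1 : u = 0 := by linarith
    have h2 : v = 0 := by linarith
    simp [h1, h2]
  have hx2 : x + u + v ∈ Set.Ici (0 : ℝ) := by simp only [Set.mem_Ici]; positivity
  have e : v / (u + v) + u / (u + v) = 1 := by field_simp; ring
  have e' : u / (u + v) + v / (u + v) = 1 := by field_simp
  have a1 := hφ.2 (Set.mem_Ici.2 hx) hx2 (div_nonneg hv h.le) (div_nonneg hu h.le) e
  have a2 := hφ.2 (Set.mem_Ici.2 hx) hx2 (div_nonneg hu h.le) (div_nonneg hv h.le) e'
  simp only [smul_eq_mul] at a1 a2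
  have b1 : v / (u + v) * x + u / (u + v) * (x + u + v) = x + u := by field_simp; ring
  have b2 : u / (u + v) * x + v / (u + v) * (x + u + v) = x + v := by field_simp; ring
  rw [b1] at a1
  rw [b2] at a2
  have b3 : v / (u + v) * φ x + u / (u + v) * φ x = φ x := by rw [← add_mul, e, one_mul]
  have b4 : u / (u + v) * φ (x + u + v) + v / (u + v) * φ (x + u + v) = φ (x + u + v) := by
    rw [← add_mul, e', one_mul]
  linarith

/-- Bernoulli's inequality for the quotient `x / y`, together with `y ^ p ≤ y` on `[0, 1]`. -/
theorem rpow_sub_rpow_le_two_mul {p x y : ℝ} (hp : 1 ≤ p) (hp2 : p ≤ 2) (hx : 0 ≤ x) (hxy : x ≤ y)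
    (hy : y ≤ 1) : y ^ p - x ^ p ≤ 2 * (y - x) := by
  rcases (hx.trans hxy).eq_or_lt with h | h
  · have : x = 0 := by linarith
    simp [this, ← h]
  have hb := one_add_mul_self_le_rpow_one_add (s := (x - y) / y) (by
    rw [le_div_iff₀ h]; linarith) hp
  have e1 : 1 + (x - y) / y = x / y := by field_simp; ring
  rw [e1, Real.div_rpow hx h.le] at hb
  have hyp : 0 < y ^ p := Real.rpow_pos_of_pos h _
  rw [le_div_iff₀ hyp] at hb
  have h1 : y ^ p ≤ y := by
    calc y ^ p ≤ y ^ (1 : ℝ) := Real.rpow_le_rpow_of_exponent_ge h hy hp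
      _ = y := Real.rpow_one y
  have h2 : y ^ p / y ≤ 1 := (div_le_one h).2 h1
  have h3 : (1 + p * ((x - y) / y)) * y ^ p = y ^ p - p * (y - x) * (y ^ p / y) := by ring
  rw [h3] at hb
  have h4 : p * (y - x) * (y ^ p / y) ≤ 2 * (y - x) * 1 := by
    have : 0 ≤ y - x := by linarith
    gcongr
  linarith

/-- A dual form of Schur's test. -/
theorem sum_sq_inner_div_le {E : Type*} [NormedAddCommGroup E] [InnerProductSpace ℝ E] (h : E)
    (m : ℕ) (v : ℕ → E) (B : ℕ → ℝ) (hB : ∀ k < m, ∑ l ∈ range m, |⟪v k, v l⟫_ℝ| ≤ B k) :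
    ∑ k ∈ range m, ⟪h, v k⟫_ℝ ^ 2 / B k ≤ ‖h‖ ^ 2 := by
  set c : ℕ → ℝ := fun k => ⟪h, v k⟫_ℝ / B k with hc
  set Q := ∑ k ∈ range m, ⟪h, v k⟫_ℝ ^ 2 / B k with hQ
  have hB0 : ∀ k < m, 0 ≤ B k := fun k hk =>
    (Finset.sum_nonneg fun l _ => abs_nonneg _).trans (hB k hk)
  have hQ0 : 0 ≤ Q := Finset.sum_nonneg fun k hk =>
    div_nonneg (sq_nonneg _) (hB0 k (mem_range.1 hk))
  -- The combination with coefficients `c k` has inner product `Q` with `h` and squared norm at most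
  -- `Q`, the latter by Schur's test; so `Q ≤ ‖h‖ √Q`.
  have e1 : Q = ⟪h, ∑ k ∈ range m, c k • v k⟫_ℝ := by
    rw [inner_sum, hQ]
    refine Finset.sum_congr rfl fun k _ => ?_
    rw [real_inner_smul_right, hc]
    ring
  have e2 : ‖∑ k ∈ range m, c k • v k‖ ^ 2 ≤ Q := by
    rw [← real_inner_self_eq_norm_sq, sum_inner]
    simp only [inner_sum, real_inner_smul_left, real_inner_smul_right]
    have hterm : ∀ k l, c l * (c k * ⟪v k, v l⟫_ℝ) ≤
        c k ^ 2 / 2 * |⟪v k, v l⟫_ℝ| + c l ^ 2 / 2 * |⟪v l, v k⟫_ℝ| := by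
      intro k l
      rw [real_inner_comm (v k) (v l)]
      calc c l * (c k * ⟪v k, v l⟫_ℝ) ≤ |c l * (c k * ⟪v k, v l⟫_ℝ)| := le_abs_self _
        _ = |c k| * |c l| * |⟪v k, v l⟫_ℝ| := by rw [abs_mul, abs_mul]; ring
        _ ≤ (c k ^ 2 / 2 + c l ^ 2 / 2) * |⟪v k, v l⟫_ℝ| := by
          gcongr
          nlinarith [sq_nonneg (|c k| - |c l|), sq_abs (c k), sq_abs (c l)]
        _ = _ := by ring
    calc _ ≤ ∑ k ∈ range m, ∑ l ∈ range m, (c k ^ 2 / 2 * |⟪v k, v l⟫_ℝ| +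
          c l ^ 2 / 2 * |⟪v l, v k⟫_ℝ|) :=
          Finset.sum_le_sum fun k _ => Finset.sum_le_sum fun l _ => hterm k l
      _ = 2 * ∑ k ∈ range m, c k ^ 2 / 2 * ∑ l ∈ range m, |⟪v k, v l⟫_ℝ| := by
          simp only [Finset.sum_add_distrib, Finset.mul_sum]
          rw [Finset.sum_comm (f := fun k l => c l ^ 2 / 2 * |⟪v l, v k⟫_ℝ|), ← two_mul]
          simp only [Finset.mul_sum]
      _ ≤ 2 * ∑ k ∈ range m, c k ^ 2 / 2 * B k := by
          gcongr with k hk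
          exact hB k (mem_range.1 hk)
      _ = Q := by
          rw [Finset.mul_sum, hQ]
          refine Finset.sum_congr rfl fun k _ => ?_
          -- Division by zero gives zero on both sides.
          rcases eq_or_ne (B k) 0 with h0 | h0
          · simp [h0]
          · simp only [hc]
            field_simp
  have e3 : Q ≤ ‖h‖ * ‖∑ k ∈ range m, c k • v k‖ := by
    rw [e1]; exact real_inner_le_norm _ _
  have hn := norm_nonneg h
  set n := ‖∑ k ∈ range m, c k • v k‖
  have hn' : 0 ≤ n := norm_nonneg _
  nlinarith [sq_nonneg (‖h‖ - n)]

section CameronMartin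

variable (H : Set.Ioo (0 : ℝ) 1) {d : ℕ}

theorem fbmCov_symm (s t : ℝ) : fbmCov H s t = fbmCov H t s := by
  rw [fbmCov, fbmCov, abs_sub_comm]
  ring

theorem inner_kerFun_kerFun (s t : I) (v w : EuclideanSpace ℝ (Fin d)) :
    ⟪RKHS.kerFun (CameronMartin H d) s v, RKHS.kerFun (CameronMartin H d) t w⟫_ℝ =
      fbmCov H s t * ⟪v, w⟫_ℝ := by
  rw [← RKHS.kernel_inner, RKHS.OfKernel.kernel_ofKernel, fbmCov_symm]
  simp [fbmKernel, real_inner_smul_left]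

/-- The covariance of two increments of fractional Brownian motion. -/
noncomputable def fbmIncCov (a b c e : ℝ) : ℝ :=
  (|e - a| ^ (2 * (H : ℝ)) + |c - b| ^ (2 * (H : ℝ)) - |c - a| ^ (2 * (H : ℝ)) -
    |e - b| ^ (2 * (H : ℝ))) / 2

theorem fbmCov_increments (a b c e : ℝ) :
    fbmCov H b e - fbmCov H b c - fbmCov H a e + fbmCov H a c = fbmIncCov H a b c e := by
  simp only [fbmCov, fbmIncCov]
  ring

theorem fbmIncCov_symm (a b c e : ℝ) : fbmIncCov H a b c e = fbmIncCov H c e a b := by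
  simp only [fbmIncCov]
  rw [abs_sub_comm e a, abs_sub_comm c b, abs_sub_comm c a, abs_sub_comm e b]
  ring

theorem fbmIncCov_self {a b : ℝ} (h : a ≤ b) : fbmIncCov H a b a b = (b - a) ^ (2 * (H : ℝ)) := by
  have h0 : (2 * (H : ℝ)) ≠ 0 := by have := H.2.1; positivity
  simp only [fbmIncCov, sub_self, abs_zero, Real.zero_rpow h0]
  rw [abs_sub_comm a b, abs_of_nonneg (sub_nonneg.2 h)]
  ring

/-- The four-point inequality for the convex function `-r^(2H)`, with `x` the gap between the
intervals and `u`, `v` their lengths. -/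
theorem fbmIncCov_nonpos (hH : (H : ℝ) ≤ 1 / 2) {a b c e : ℝ} (h1 : a ≤ b) (h2 : b ≤ c)
    (h3 : c ≤ e) : fbmIncCov H a b c e ≤ 0 := by
  have hc := (Real.concaveOn_rpow (p := 2 * (H : ℝ)) (by have := H.2.1; positivity)
    (by linarith)).neg
  have := hc.four_point (sub_nonneg.2 h2) (sub_nonneg.2 h1) (sub_nonneg.2 h3)
  simp only [Pi.neg_apply] at this
  rw [show c - b + (b - a) = c - a by ring, show c - b + (e - c) = e - b by ring,
    show c - a + (e - c) = e - a by ring] at this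
  rw [fbmIncCov, abs_of_nonneg (by linarith), abs_of_nonneg (by linarith),
    abs_of_nonneg (by linarith), abs_of_nonneg (by linarith)]
  linarith

theorem fbmIncCov_nonneg (hH : 1 / 2 ≤ (H : ℝ)) {a b c e : ℝ} (h1 : a ≤ b) (h2 : b ≤ c)
    (h3 : c ≤ e) : 0 ≤ fbmIncCov H a b c e := by
  have hc := (convexOn_rpow (p := 2 * (H : ℝ)) (by linarith))
  have := hc.four_point (sub_nonneg.2 h2) (sub_nonneg.2 h1) (sub_nonneg.2 h3)
  rw [show c - b + (b - a) = c - a by ring, show c - b + (e - c) = e - b by ring,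
    show c - a + (e - c) = e - a by ring] at this
  rw [fbmIncCov, abs_of_nonneg (by linarith), abs_of_nonneg (by linarith),
    abs_of_nonneg (by linarith), abs_of_nonneg (by linarith)]
  linarith

/-- The increments over a partition have absolutely summable covariances. -/
theorem sum_abs_fbmIncCov_le {p : ℕ → I} (hp : Monotone p) {m k : ℕ} (hk : k < m) :
    ∑ l ∈ range m, |fbmIncCov H (p k) (p (k + 1)) (p l) (p (l + 1))| ≤
      2 * ((p (k + 1) : ℝ) - p k) ^ min (2 * (H : ℝ)) 1 := by
  have hle : ∀ i j, i ≤ j → (p i : ℝ) ≤ p j := fun i j h => hp h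
  have htot : ∑ l ∈ range m, fbmIncCov H (p k) (p (k + 1)) (p l) (p (l + 1)) =
      fbmIncCov H (p k) (p (k + 1)) (p 0) (p m) := by
    have e : ∀ l, fbmIncCov H (p k) (p (k + 1)) (p l) (p (l + 1)) =
        (fbmCov H (p (k + 1)) (p (l + 1)) - fbmCov H (p k) (p (l + 1))) -
        (fbmCov H (p (k + 1)) (p l) - fbmCov H (p k) (p l)) := fun l => by
      rw [← fbmCov_increments]; ring
    simp only [e]
    rw [Finset.sum_range_sub (fun l => fbmCov H (p (k + 1)) (p l) - fbmCov H (p k) (p l)),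
      ← fbmCov_increments]
    ring
  have htot' : fbmIncCov H (p k) (p (k + 1)) (p 0) (p m) =
      ((((p (k + 1) : ℝ) - p 0) ^ (2 * (H : ℝ)) - ((p k : ℝ) - p 0) ^ (2 * (H : ℝ))) +
      (((p m : ℝ) - p k) ^ (2 * (H : ℝ)) - ((p m : ℝ) - p (k + 1)) ^ (2 * (H : ℝ)))) / 2 := by
    have a1 := hle 0 k (Nat.zero_le k)
    have a2 := hle k (k + 1) (Nat.le_succ k)
    have a3 := hle (k + 1) m hk
    rw [fbmIncCov, abs_of_nonneg (by linarith), abs_sub_comm, abs_of_nonneg (by linarith),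
      abs_sub_comm (p 0 : ℝ), abs_of_nonneg (by linarith), abs_of_nonneg (by linarith)]
    ring
  have a1 := hle 0 k (Nat.zero_le k)
  have a2 := hle k (k + 1) (Nat.le_succ k)
  have a3 := hle (k + 1) m hk
  have hH0 : 0 < 2 * (H : ℝ) := by have := H.2.1; positivity
  rcases le_total (H : ℝ) (1 / 2) with hH | hH
  -- Only the diagonal entry can be positive, so the absolute sum is twice that entry minus the
  -- telescoped total, which is nonnegative.
  · have hterm : ∀ l ∈ range m, |fbmIncCov H (p k) (p (k + 1)) (p l) (p (l + 1))| =
        -fbmIncCov H (p k) (p (k + 1)) (p l) (p (l + 1)) +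
        if l = k then 2 * ((p (k + 1) : ℝ) - p k) ^ (2 * (H : ℝ)) else 0 := by
      intro l _
      rcases lt_trichotomy l k with h | rfl | h
      · rw [if_neg h.ne, add_zero, fbmIncCov_symm, abs_of_nonpos]
        exact fbmIncCov_nonpos H hH (hle _ _ (Nat.le_succ l)) (hle _ _ h) a2
      · rw [if_pos rfl, fbmIncCov_self H a2, abs_of_nonneg (Real.rpow_nonneg (by linarith) _)]
        ring
      · rw [if_neg h.ne', add_zero, abs_of_nonpos]
        exact fbmIncCov_nonpos H hH a2 (hle _ _ h) (hle _ _ (Nat.le_succ l))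
    rw [Finset.sum_congr rfl hterm, Finset.sum_add_distrib, Finset.sum_neg_distrib, htot, htot',
      Finset.sum_ite_eq' (range m) k, if_pos (mem_range.2 hk), min_eq_left (by linarith)]
    have b1 : ((p k : ℝ) - p 0) ^ (2 * (H : ℝ)) ≤ ((p (k + 1) : ℝ) - p 0) ^ (2 * (H : ℝ)) :=
      Real.rpow_le_rpow (by linarith) (by linarith) hH0.le
    have b2 : ((p m : ℝ) - p (k + 1)) ^ (2 * (H : ℝ)) ≤ ((p m : ℝ) - p k) ^ (2 * (H : ℝ)) :=
      Real.rpow_le_rpow (by linarith) (by linarith) hH0.le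
    linarith
  -- All entries are nonnegative, so the absolute sum is the telescoped total. It consists of
  -- differences of powers `2H` between `1` and `2`, which are Lipschitz on `[0, 1]`.
  · have hterm : ∀ l ∈ range m, |fbmIncCov H (p k) (p (k + 1)) (p l) (p (l + 1))| =
        fbmIncCov H (p k) (p (k + 1)) (p l) (p (l + 1)) := by
      intro l _
      refine abs_of_nonneg ?_
      rcases lt_trichotomy l k with h | rfl | h
      · rw [fbmIncCov_symm]
        exact fbmIncCov_nonneg H hH (hle _ _ (Nat.le_succ l)) (hle _ _ h) a2
      · rw [fbmIncCov_self H a2]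
        exact Real.rpow_nonneg (by linarith) _
      · exact fbmIncCov_nonneg H hH a2 (hle _ _ h) (hle _ _ (Nat.le_succ l))
    rw [Finset.sum_congr rfl hterm, htot, htot', min_eq_right (by linarith), Real.rpow_one]
    have hH2 : 2 * (H : ℝ) ≤ 2 := by have := H.2.2; linarith
    have q0 := (p 0).2.1
    have q1 := (p m).2.2
    have b1 := rpow_sub_rpow_le_two_mul (p := 2 * (H : ℝ)) (x := (p k : ℝ) - p 0)
      (y := (p (k + 1) : ℝ) - p 0) (by linarith) hH2 (by linarith) (by linarith) (by linarith)
    have b2 := rpow_sub_rpow_le_two_mul (p := 2 * (H : ℝ)) (x := (p m : ℝ) - p (k + 1))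
      (y := (p m : ℝ) - p k) (by linarith) hH2 (by linarith) (by linarith) (by linarith)
    linarith

/-- The exponent of the Riesz variation of Cameron--Martin paths. -/
noncomputable def fbmExponent : ℝ := min (2 * (H : ℝ)) 1

theorem fbmExponent_pos : 0 < fbmExponent H :=
  lt_min (by have := H.2.1; positivity) one_pos

/-- By the reproducing property the increments of `h` are inner products with kernel increments, so
up to the factor `2` the Riesz sum is the left side of the dual Schur test, with
`sum_abs_fbmIncCov_le` as row bound. -/
theorem rieszSum_cameronMartin_le (h : CameronMartin H d) (i : Fin d) {m : ℕ} {p : ℕ → I}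
    (hp : Monotone p) : rieszSum (fbmExponent H) (fun t => h t i) m p ≤ 2 * ‖h‖ ^ 2 := by
  set e : EuclideanSpace ℝ (Fin d) := EuclideanSpace.single i 1
  have hval : ∀ t : I, h t i = ⟪h, RKHS.kerFun (CameronMartin H d) t e⟫_ℝ := fun t => by
    rw [RKHS.inner_kerFun]
    simp [e, EuclideanSpace.inner_single_right]
  have hee : ⟪e, e⟫_ℝ = 1 := by
    simp [e]
  have key := sum_sq_inner_div_le h m
    (fun k => RKHS.kerFun (CameronMartin H d) (p (k + 1)) e - RKHS.kerFun (CameronMartin H d) (p k) e)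
    (fun k => 2 * ((p (k + 1) : ℝ) - p k) ^ fbmExponent H) (fun k hk => by
      refine le_trans (le_of_eq ?_) (sum_abs_fbmIncCov_le H hp hk)
      refine Finset.sum_congr rfl fun l _ => ?_
      simp only [inner_sub_left, inner_sub_right, inner_kerFun_kerFun, hee, mul_one]
      rw [← fbmCov_increments]
      congr 1
      ring)
  have e2 : rieszSum (fbmExponent H) (fun t => h t i) m p = 2 * ∑ k ∈ range m,
      ⟪h, RKHS.kerFun (CameronMartin H d) (p (k + 1)) e -
        RKHS.kerFun (CameronMartin H d) (p k) e⟫_ℝ ^ 2 /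
        (2 * ((p (k + 1) : ℝ) - p k) ^ fbmExponent H) := by
    rw [rieszSum, Finset.mul_sum]
    refine Finset.sum_congr rfl fun k _ => ?_
    rw [inner_sub_right, ← hval, ← hval]
    ring
  rw [e2]
  linarith

/-- Since `R(0, 0) = 0`, the kernel functions at time zero have norm zero. -/
theorem cameronMartin_apply_zero (h : CameronMartin H d) : h 0 = 0 := by
  refine ext_inner_right ℝ fun v => ?_
  have h0 : RKHS.kerFun (CameronMartin H d) 0 v = 0 := by
    rw [← inner_self_eq_zero (𝕜 := ℝ), inner_kerFun_kerFun]
    have h0 : (2 * (H : ℝ)) ≠ 0 := by have := H.2.1; positivity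
    simp [fbmCov, Real.zero_rpow h0]
  rw [← RKHS.inner_kerFun, h0, inner_zero_right, inner_zero_left]

/-- A component of a Cameron--Martin path, as a path of finite Riesz variation. -/
noncomputable def componentLM (i : Fin d) : CameronMartin H d →ₗ[ℝ] YoungPath (fbmExponent H) where
  toFun h := ⟨fun t => h t i, √(2 * ‖h‖ ^ 2), fun _ _ hp =>
    Real.sqrt_le_sqrt (rieszSum_cameronMartin_le H h i hp)⟩
  map_add' h k := YoungPath.ext fun t => by
    change (h + k) t i = h t i + k t i
    rw [RKHS.coe_add]
    rfl
  map_smul' c h := YoungPath.ext fun t => by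
    change (c • h) t i = c * h t i
    rw [RKHS.coe_smul]
    rfl

noncomputable def componentCLM (i : Fin d) : CameronMartin H d →L[ℝ] YoungPath (fbmExponent H) :=
  (componentLM H i).mkContinuous (√2) fun h => by
    have := YoungPath.norm_le (f := componentLM H i h) (A := 0) (B := √2 * ‖h‖) (by
      change |h 0 i| ≤ 0
      rw [cameronMartin_apply_zero]
      simp) fun m p hp => by
        refine (Real.sqrt_le_sqrt (rieszSum_cameronMartin_le H h i hp)).trans ?_
        rw [Real.sqrt_mul zero_le_two, Real.sqrt_sq (norm_nonneg h)]
    simpa using this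

/-- The components of a Cameron--Martin path. -/
noncomputable def componentsCLM (d : ℕ) :
    CameronMartin H d →L[ℝ] (Fin d → YoungPath (fbmExponent H)) :=
  ContinuousLinearMap.pi (componentCLM H)

theorem componentsCLM_apply (i : Fin d) (h : CameronMartin H d) (t : I) :
    h t i = componentsCLM H d h i t := rfl

theorem hasSignature_cameronMartin (h : CameronMartin H d) (N : ℕ) : HasSignature N h :=
  YoungPath.hasSignature (fbmExponent_pos H) _ (fun i t => componentsCLM_apply H i h t) N

theorem contDiff_signature_apply (N : ℕ) (t : I) (w : Word d N) :
    ContDiff ℝ ∞ fun h : CameronMartin H d => signature N h t w := by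
  have e : (fun h : CameronMartin H d => signature N h t w) = fun h =>
      YoungPath.evalCLM (fbmExponent_pos H) t
        (YoungPath.iterated (fbmExponent_pos H) (componentsCLM H d h) w.1.reverse) := by
    funext h
    exact YoungPath.signature_apply (fbmExponent_pos H) _ (fun i t => componentsCLM_apply H i h t) t w
  rw [e]
  exact (YoungPath.evalCLM (fbmExponent_pos H) t).contDiff.comp
    ((YoungPath.contDiff_iterated _ _).comp (componentsCLM H d).contDiff)

end CameronMartin

theorem contDiff_signature (H : Set.Ioo (0 : ℝ) 1) (d N : ℕ) (t : I) :
    ContDiff ℝ ∞ fun h : CameronMartin H d => signature N h t :=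
  contDiff_pi.2 fun w => contDiff_signature_apply H N t w

/-! ### Filtration and calculus in the truncated tensor algebra -/

namespace TruncTensor

variable {d N : ℕ}

instance instFiniteDimensional : FiniteDimensional ℝ (TruncTensor d N) :=
  inferInstanceAs (FiniteDimensional ℝ (Word d N → ℝ))

theorem mul_apply (a b : TruncTensor d N) (w : Word d N) :
    (a * b) w = ∑ i ∈ range (w.1.length + 1), a (pre w i) * b (suf w i) := rfl

theorem one_apply (w : Word d N) : (1 : TruncTensor d N) w = if w.1 = [] then 1 else 0 := rfl

/-- The ideal of tensors without components of degree less than `k`. -/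
def filt (d N k : ℕ) : Submodule ℝ (TruncTensor d N) where
  carrier := {a | ∀ w : Word d N, w.1.length < k → a w = 0}
  add_mem' ha hb w hw := by rw [add_apply, ha w hw, hb w hw, add_zero]
  zero_mem' _ _ := rfl
  smul_mem' r a ha w hw := by rw [smul_apply, ha w hw, mul_zero]

theorem filt_anti {j k : ℕ} (h : j ≤ k) : filt d N k ≤ filt d N j := fun _ ha w hw =>
  ha w (hw.trans_le h)

theorem mem_filt_zero (a : TruncTensor d N) : a ∈ filt d N 0 := fun _ hw =>
  absurd hw (Nat.not_lt_zero _)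

theorem eq_zero_of_mem_filt {k : ℕ} (hk : N < k) {a : TruncTensor d N} (ha : a ∈ filt d N k) :
    a = 0 := funext fun w => ha w (w.2.trans_lt hk)

theorem mul_mem_filt {j k : ℕ} {a b : TruncTensor d N} (ha : a ∈ filt d N j)
    (hb : b ∈ filt d N k) : a * b ∈ filt d N (j + k) := by
  intro w hw
  rw [mul_apply]
  refine Finset.sum_eq_zero fun i hi => ?_
  have hi' := mem_range.1 hi
  by_cases h : i < j
  · rw [ha (pre w i) (by simp only [pre, List.length_take]; omega), zero_mul]
  · rw [hb (suf w i) (by simp only [suf, List.length_drop]; omega), mul_zero]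

theorem mul_mem_filt' {j k l : ℕ} {a b : TruncTensor d N} (ha : a ∈ filt d N j)
    (hb : b ∈ filt d N k) (h : l ≤ j + k) : a * b ∈ filt d N l :=
  filt_anti h (mul_mem_filt ha hb)

theorem pow_mem_filt {a : TruncTensor d N} (ha : a ∈ filt d N 1) (k : ℕ) : a ^ k ∈ filt d N k := by
  induction k with
  | zero => exact mem_filt_zero _
  | succ k ih => rw [pow_succ]; exact mul_mem_filt ih ha

theorem letter_mem_filt (i : Fin d) : letter N i ∈ filt d N 1 := by
  intro w hw
  have : w.1 = [] := List.length_eq_zero_iff.1 (by omega)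
  simp [letter, this]

theorem lie_def (a b : TruncTensor d N) : ⁅a, b⁆ = a * b - b * a := rfl

theorem freeNilpotentLie_le_filt {a : TruncTensor d N} (ha : a ∈ freeNilpotentLie d N) :
    a ∈ filt d N 1 := by
  let K : LieSubalgebra ℝ (TruncTensor d N) :=
    { filt d N 1 with
      lie_mem' := fun {x y} hx hy => by
        rw [lie_def]
        exact sub_mem (mul_mem_filt' hx hy (by omega)) (mul_mem_filt' hy hx (by omega)) }
  have : freeNilpotentLie d N ≤ K := by
    refine LieSubalgebra.lieSpan_le.2 ?_
    rintro _ ⟨i, rfl⟩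
    exact letter_mem_filt i
  exact this ha

theorem letter_mem (i : Fin d) : letter N i ∈ freeNilpotentLie d N :=
  LieSubalgebra.subset_lieSpan ⟨i, rfl⟩

/-! #### Derivatives of products and powers -/

theorem hasDerivAt_mul {a b : ℝ → TruncTensor d N} {a' b' : TruncTensor d N} {s : ℝ}
    (ha : HasDerivAt a a' s) (hb : HasDerivAt b b' s) :
    HasDerivAt (fun u => a u * b u) (a' * b s + a s * b') s := by
  refine hasDerivAt_pi.2 fun w => ?_
  have ha' := hasDerivAt_pi.1 ha
  have hb' := hasDerivAt_pi.1 hb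
  have := HasDerivAt.fun_sum (u := range (w.1.length + 1)) fun i _ =>
    (ha' (pre w i)).mul (hb' (suf w i))
  refine this.congr_deriv ?_
  rw [add_apply, mul_apply, mul_apply, ← Finset.sum_add_distrib]

theorem contDiff_mul {E : Type*} [NormedAddCommGroup E] [NormedSpace ℝ E] {n : WithTop ℕ∞}
    {a b : E → TruncTensor d N} (ha : ContDiff ℝ n a) (hb : ContDiff ℝ n b) :
    ContDiff ℝ n fun u => a u * b u :=
  contDiff_pi.2 fun w => ContDiff.sum (s := range (w.1.length + 1))
    (f := fun i u => a u (pre w i) * b u (suf w i)) fun i _ =>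
    ((contDiff_pi.1 ha (pre w i)).mul (contDiff_pi.1 hb (suf w i)))

theorem contDiff_pow {E : Type*} [NormedAddCommGroup E] [NormedSpace ℝ E] {n : WithTop ℕ∞}
    {a : E → TruncTensor d N} (ha : ContDiff ℝ n a) (k : ℕ) : ContDiff ℝ n fun u => a u ^ k := by
  induction k with
  | zero => simpa using contDiff_const
  | succ k ih => simpa only [pow_succ] using contDiff_mul ih ha

theorem contDiff_texp {n : WithTop ℕ∞} : ContDiff ℝ n (texp : TruncTensor d N → TruncTensor d N) :=
  ContDiff.sum fun k _ => (contDiff_pow contDiff_id k).const_smul _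

/-- The derivative of `a ↦ a ^ k` in the direction `x`. -/
noncomputable def dpow (a x : TruncTensor d N) : ℕ → TruncTensor d N
  | 0 => 0
  | k + 1 => x * a ^ k + a * dpow a x k

/-- The derivative of `texp` at `a` in the direction `x`. -/
noncomputable def dexp (a x : TruncTensor d N) : TruncTensor d N :=
  ∑ k ∈ range (N + 1), ((k.factorial : ℝ)⁻¹) • dpow a x k

theorem hasDerivAt_pow {a : ℝ → TruncTensor d N} {a' : TruncTensor d N} {s : ℝ}
    (ha : HasDerivAt a a' s) (k : ℕ) : HasDerivAt (fun u => a u ^ k) (dpow (a s) a' k) s := by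
  induction k with
  | zero => simpa [dpow] using hasDerivAt_const s (1 : TruncTensor d N)
  | succ k ih => simpa only [pow_succ', dpow] using hasDerivAt_mul ha ih

theorem hasDerivAt_texp {a : ℝ → TruncTensor d N} {a' : TruncTensor d N} {s : ℝ}
    (ha : HasDerivAt a a' s) : HasDerivAt (fun u => texp (a u)) (dexp (a s) a') s :=
  HasDerivAt.fun_sum fun k _ => (hasDerivAt_pow ha k).fun_const_smul _

theorem dpow_add (a x y : TruncTensor d N) (k : ℕ) :
    dpow a (x + y) k = dpow a x k + dpow a y k := by
  induction k with
  | zero => simp [dpow]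
  | succ k ih => rw [dpow, dpow, dpow, ih]; noncomm_ring

theorem dexp_add (a x y : TruncTensor d N) : dexp a (x + y) = dexp a x + dexp a y := by
  simp only [dexp, dpow_add, smul_add, Finset.sum_add_distrib]

theorem dpow_smul_smul (a x : TruncTensor d N) (s : ℝ) (k : ℕ) :
    dpow (s • a) (s • x) k = s ^ k • dpow a x k := by
  induction k with
  | zero => simp [dpow]
  | succ k ih =>
    rw [dpow, dpow, ih, smul_pow, smul_mul_smul_comm, smul_mul_smul_comm, smul_add, pow_succ' s]

theorem pow_sub_pow_mem {a a' : TruncTensor d N} {j : ℕ} (ha : a ∈ filt d N 1)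
    (ha' : a' ∈ filt d N 1) (h : a - a' ∈ filt d N j) (n : ℕ) :
    a ^ (n + 1) - a' ^ (n + 1) ∈ filt d N (j + n) := by
  induction n with
  | zero => simpa using h
  | succ n ih =>
    have e : a ^ (n + 1 + 1) - a' ^ (n + 1 + 1) =
        (a - a') * a ^ (n + 1) + a' * (a ^ (n + 1) - a' ^ (n + 1)) := by
      rw [pow_succ' a (n + 1), pow_succ' a' (n + 1)]
      noncomm_ring
    rw [e]
    exact add_mem (mul_mem_filt' h (pow_mem_filt ha _) (by omega))
      (mul_mem_filt' ha' ih (by omega))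

theorem dpow_mem {a x : TruncTensor d N} {j : ℕ} (ha : a ∈ filt d N 1) (hx : x ∈ filt d N j)
    (n : ℕ) : dpow a x (n + 1) ∈ filt d N (j + n) := by
  induction n with
  | zero => simpa [dpow] using hx
  | succ n ih =>
    rw [dpow]
    exact add_mem (mul_mem_filt' hx (pow_mem_filt ha _) (by omega))
      (mul_mem_filt' ha ih (by omega))

theorem dpow_sub_dpow_mem {a a' x x' : TruncTensor d N} {j : ℕ} (ha : a ∈ filt d N 1)
    (ha' : a' ∈ filt d N 1) (hx : x ∈ filt d N 1) (hx' : x' ∈ filt d N 1)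
    (h : a - a' ∈ filt d N j) (h' : x - x' ∈ filt d N j) (n : ℕ) :
    dpow a x (n + 1) - dpow a' x' (n + 1) ∈ filt d N (j + n) := by
  induction n with
  | zero => simpa [dpow] using h'
  | succ n ih =>
    have e : dpow a x (n + 1 + 1) - dpow a' x' (n + 1 + 1) =
        (x - x') * a ^ (n + 1) + x' * (a ^ (n + 1) - a' ^ (n + 1)) +
        ((a - a') * dpow a x (n + 1) + a' * (dpow a x (n + 1) - dpow a' x' (n + 1))) := by
      have e1 : ∀ b y : TruncTensor d N,
        dpow b y (n + 1 + 1) = y * b ^ (n + 1) + b * dpow b y (n + 1) := fun _ _ => rfl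
      rw [e1, e1]
      generalize dpow a x (n + 1) = p
      generalize dpow a' x' (n + 1) = q
      noncomm_ring
    rw [e]
    refine add_mem (add_mem (mul_mem_filt' h' (pow_mem_filt ha _) (by omega))
      (mul_mem_filt' hx' (pow_sub_pow_mem ha ha' h n) (by omega)))
      (add_mem (mul_mem_filt' h (dpow_mem ha hx n) (by omega)) (mul_mem_filt' ha' ih (by omega)))

/-- Common core of the three estimates below: the linear term of an exponential series dominates, as
all later terms lie one step deeper in the filtration. For `N = 0` the series has no linear term,
but then `p 1` vanishes. -/
theorem sum_range_sub_mem {p : ℕ → TruncTensor d N} {k : ℕ} (hk : 1 ≤ k)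
    (hp0 : p 0 = 0)
    (hp1 : p 1 ∈ filt d N k) (hp : ∀ n, p (n + 2) ∈ filt d N (k + 1)) :
    (∑ n ∈ range (N + 1), ((n.factorial : ℝ)⁻¹) • p n) - p 1 ∈ filt d N (k + 1) := by
  rcases Nat.eq_zero_or_pos N with rfl | hN
  · rw [zero_add, Finset.sum_range_one, hp0, smul_zero, zero_sub]
    intro w hw
    have hw0 := Nat.le_zero.1 w.2
    exact (neg_mem hp1 : -p 1 ∈ filt d 0 k) w (by omega)
  · obtain ⟨M, rfl⟩ : ∃ M, N = M + 1 := ⟨N - 1, by omega⟩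
    rw [Finset.sum_range_succ', Finset.sum_range_succ', hp0]
    simp only [zero_add, Nat.factorial_one, Nat.cast_one, inv_one, one_smul, smul_zero, add_zero,
      add_sub_cancel_right]
    exact sum_mem fun n _ => Submodule.smul_mem _ _ (hp n)

/-- On differences the exponential acts as the identity up to one more degree. Both its injectivity
and the iteration behind `tlog` rest on this. -/
theorem texp_sub_texp_mem {z z' : TruncTensor d N} {k : ℕ} (hk : 1 ≤ k) (hz : z ∈ filt d N 1)
    (hz' : z' ∈ filt d N 1) (h : z - z' ∈ filt d N k) :
    (texp z - texp z') - (z - z') ∈ filt d N (k + 1) := by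
  have := sum_range_sub_mem (p := fun n => z ^ n - z' ^ n) (k := k) hk (by simp) (by simpa using h)
    fun n => filt_anti (by omega) (pow_sub_pow_mem hz hz' h (n + 1))
  simpa only [texp, smul_sub, Finset.sum_sub_distrib, pow_one] using this

theorem dexp_sub_mem {a x : TruncTensor d N} {k : ℕ} (hk : 1 ≤ k) (ha : a ∈ filt d N 1)
    (hx : x ∈ filt d N k) : dexp a x - x ∈ filt d N (k + 1) := by
  have := sum_range_sub_mem (p := dpow a x) (k := k) hk rfl (by simpa [dpow] using hx)
    fun n => filt_anti (by omega) (dpow_mem ha hx (n + 1))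
  simpa [dexp, dpow] using this

theorem dexp_sub_dexp_mem {a a' x x' : TruncTensor d N} {j : ℕ} (hj : 1 ≤ j) (ha : a ∈ filt d N 1)
    (ha' : a' ∈ filt d N 1) (hx : x ∈ filt d N 1) (hx' : x' ∈ filt d N 1)
    (h : a - a' ∈ filt d N j) (h' : x - x' ∈ filt d N j) :
    (dexp a x - dexp a' x') - (x - x') ∈ filt d N (j + 1) := by
  have := sum_range_sub_mem (p := fun n => dpow a x n - dpow a' x' n) (k := j) hj (by simp [dpow])
    (by simpa [dpow] using h')
    fun n => filt_anti (by omega) (dpow_sub_dpow_mem ha ha' hx hx' h h' (n + 1))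
  simpa only [dexp, smul_sub, Finset.sum_sub_distrib, dpow, mul_zero, add_zero, pow_zero,
    mul_one] using this

/-! #### The exponential and the logarithm -/

theorem texp_zero : texp (0 : TruncTensor d N) = 1 := by
  rw [texp, Finset.sum_range_succ']
  simp

theorem texp_sub_one_mem {z : TruncTensor d N} (hz : z ∈ filt d N 1) :
    texp z - 1 ∈ filt d N 1 := by
  have h := texp_sub_texp_mem le_rfl hz (zero_mem _) (by simpa using hz)
  rw [texp_zero, sub_zero] at h
  have := add_mem (filt_anti (Nat.le_succ 1) h) hz
  simpa using this

/-- The logarithm, as the result of an iteration that converges in finitely many steps. -/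
noncomputable def tlog (g : TruncTensor d N) : TruncTensor d N :=
  (fun z => z - (texp z - g))^[N + 1] 0

/-- A finite iteration of polynomial maps is smooth on the whole algebra, also away from the group.
-/
theorem contDiff_tlog : ContDiff ℝ ∞ (tlog : TruncTensor d N → TruncTensor d N) := by
  have : ∀ n : ℕ, ContDiff ℝ ∞ fun g : TruncTensor d N => (fun z => z - (texp z - g))^[n] 0 := by
    intro n
    induction n with
    | zero => simpa using contDiff_const
    | succ n ih =>
      simp only [Function.iterate_succ_apply']
      exact ih.sub ((contDiff_texp.comp ih).sub contDiff_id)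
  exact this (N + 1)

/-- Each correction by the current error cancels its lowest degree, so the error disappears after
finitely many steps. -/
theorem iterate_log_mem {g : TruncTensor d N} (hg : g - 1 ∈ filt d N 1) (n : ℕ) :
    (fun z => z - (texp z - g))^[n] 0 ∈ filt d N 1 ∧
    texp ((fun z => z - (texp z - g))^[n] 0) - g ∈ filt d N (n + 1) := by
  induction n with
  | zero =>
    refine ⟨zero_mem _, ?_⟩
    rw [Function.iterate_zero_apply, texp_zero, ← neg_sub]
    exact neg_mem hg
  | succ n ih =>
    rw [Function.iterate_succ_apply']
    set z := (fun z => z - (texp z - g))^[n] 0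
    obtain ⟨h1, h2⟩ := ih
    have h3 : z - (texp z - g) ∈ filt d N 1 := sub_mem h1 (filt_anti (by omega) h2)
    refine ⟨h3, ?_⟩
    have h4 := texp_sub_texp_mem (k := n + 1) (by omega) h3 h1 (by
      have : z - (texp z - g) - z = -(texp z - g) := by abel
      rw [this]
      exact neg_mem h2)
    have e : texp (z - (texp z - g)) - g =
        texp (z - (texp z - g)) - texp z - (z - (texp z - g) - z) := by abel
    rw [e]
    exact h4

theorem tlog_mem {g : TruncTensor d N} (hg : g - 1 ∈ filt d N 1) : tlog g ∈ filt d N 1 :=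
  (iterate_log_mem hg _).1

theorem texp_tlog {g : TruncTensor d N} (hg : g - 1 ∈ filt d N 1) : texp (tlog g) = g :=
  sub_eq_zero.1 (eq_zero_of_mem_filt (by omega) (iterate_log_mem hg (N + 1)).2)

theorem texp_injOn {z z' : TruncTensor d N} (hz : z ∈ filt d N 1) (hz' : z' ∈ filt d N 1)
    (h : texp z = texp z') : z = z' := by
  have : ∀ k, z - z' ∈ filt d N (k + 1) := by
    intro k
    induction k with
    | zero => exact sub_mem hz hz'
    | succ k ih =>
      have := texp_sub_texp_mem (by omega) hz hz' ih
      rw [h, sub_self, zero_sub] at this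
      exact neg_mem_iff.1 this
  exact sub_eq_zero.1 (eq_zero_of_mem_filt (Nat.lt_succ_self N) (this N))

theorem tlog_texp {z : TruncTensor d N} (hz : z ∈ filt d N 1) : tlog (texp z) = z :=
  texp_injOn (tlog_mem (texp_sub_one_mem hz)) hz (texp_tlog (texp_sub_one_mem hz))

theorem mul_sub_one_mem {g k : TruncTensor d N} (hg : g - 1 ∈ filt d N 1)
    (hk : k - 1 ∈ filt d N 1) : g * k - 1 ∈ filt d N 1 := by
  have e : g * k - 1 = (g - 1) * (k - 1) + (g - 1) + (k - 1) := by noncomm_ring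
  rw [e]
  exact add_mem (add_mem (mul_mem_filt' hg hk (by omega)) hg) hk

/-- Differentiation loses one term of the truncated series; on the right side the corresponding top
term dies because `z ^ (N + 1) = 0`. -/
theorem hasDerivAt_texp_smul {z : TruncTensor d N} (hz : z ∈ filt d N 1) (s : ℝ) :
    HasDerivAt (fun u : ℝ => texp (u • z)) (texp (s • z) * z) s := by
  have h : ∀ k ∈ range (N + 1), HasDerivAt (fun u : ℝ => ((k.factorial : ℝ)⁻¹) • (u • z) ^ k)
      (((k.factorial : ℝ)⁻¹ * (k * s ^ (k - 1))) • z ^ k) s := fun k _ => by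
    simp only [smul_pow, smul_smul]
    exact ((_root_.hasDerivAt_pow k s).const_mul _).smul_const _
  refine (HasDerivAt.fun_sum h).congr_deriv ?_
  rw [Finset.sum_range_succ', texp, Finset.sum_mul, Finset.sum_range_succ]
  have e1 : ((N.factorial : ℝ)⁻¹ • (s • z) ^ N) * z = 0 := by
    rw [smul_mul_assoc, smul_pow, smul_mul_assoc, ← pow_succ,
      eq_zero_of_mem_filt (Nat.lt_succ_self N) (pow_mem_filt hz (N + 1)), smul_zero, smul_zero]
  rw [e1]
  simp only [Nat.cast_zero, zero_mul, mul_zero, zero_smul, add_zero]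
  refine Finset.sum_congr rfl fun k _ => ?_
  rw [smul_pow, smul_smul, smul_mul_assoc, ← pow_succ]
  congr 1
  rw [Nat.factorial_succ]
  push_cast
  have h1 : (k.factorial : ℝ) ≠ 0 := by positivity
  have h2 : (k : ℝ) + 1 ≠ 0 := by positivity
  field_simp

theorem commute_texp (z : TruncTensor d N) (s : ℝ) : texp (s • z) * z = z * texp (s • z) := by
  rw [texp, Finset.sum_mul, Finset.mul_sum]
  refine Finset.sum_congr rfl fun k _ => ?_
  rw [smul_pow, smul_mul_assoc, smul_mul_assoc, mul_smul_comm, mul_smul_comm, ← pow_succ,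
    ← pow_succ']

theorem const_of_hasDerivAt_zero {c : ℝ → TruncTensor d N} (h : ∀ s, HasDerivAt c 0 s) (s t : ℝ) :
    c s = c t :=
  is_const_of_deriv_eq_zero (fun s => (h s).differentiableAt) (fun s => (h s).deriv) s t

theorem texp_mul_texp_neg {z : TruncTensor d N} (hz : z ∈ filt d N 1) :
    texp z * texp (-z) = 1 := by
  have h : ∀ s : ℝ, HasDerivAt (fun u : ℝ => texp (u • z) * texp (u • (-z))) 0 s := fun s => by
    refine (hasDerivAt_mul (hasDerivAt_texp_smul hz s)
      (hasDerivAt_texp_smul (neg_mem hz) s)).congr_deriv ?_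
    rw [commute_texp (-z) s]
    noncomm_ring
  have := const_of_hasDerivAt_zero h 1 0
  simpa [texp_zero] using this

theorem texp_neg_mul_texp {z : TruncTensor d N} (hz : z ∈ filt d N 1) :
    texp (-z) * texp z = 1 := by
  simpa using texp_mul_texp_neg (neg_mem hz)

end TruncTensor

/-! ### The left invariant vector fields in logarithmic coordinates -/

theorem Submodule.exists_clm_of_notMem {E : Type*} [NormedAddCommGroup E] [NormedSpace ℝ E]
    [FiniteDimensional ℝ E] (W : Submodule ℝ E) {v : E} (hv : v ∉ W) :
    ∃ f : E →L[ℝ] ℝ, f v ≠ 0 ∧ ∀ x ∈ W, f x = 0 := by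
  obtain ⟨f, hf, hW⟩ := W.exists_le_ker_of_notMem hv
  exact ⟨LinearMap.toContinuousLinearMap f, hf, fun x hx => hW hx⟩

/-- Functionals that vanish on `W` are constant along the curve. -/
theorem Submodule.mem_of_hasDerivAt_mem {E : Type*} [NormedAddCommGroup E] [NormedSpace ℝ E]
    [FiniteDimensional ℝ E] (W : Submodule ℝ E) {c c' : ℝ → E} (hc : ∀ s, HasDerivAt c (c' s) s)
    (hc' : ∀ s, c' s ∈ W) (h0 : c 0 ∈ W) (s : ℝ) : c s ∈ W := by
  by_contra hs
  obtain ⟨f, hf, hW⟩ := W.exists_clm_of_notMem hs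
  have hd : ∀ s, HasDerivAt (fun u => f (c u)) 0 s := fun s => by
    have := f.hasFDerivAt.comp_hasDerivAt s (hc s)
    rwa [hW _ (hc' s)] at this
  have := is_const_of_deriv_eq_zero (fun s => (hd s).differentiableAt) (fun s => (hd s).deriv) s 0
  rw [hW _ h0] at this
  exact hf this

theorem Submodule.hasDerivAt_mem {E : Type*} [NormedAddCommGroup E] [NormedSpace ℝ E]
    [FiniteDimensional ℝ E] (W : Submodule ℝ E) {c : ℝ → E} {v : E} {s : ℝ}
    (hc : HasDerivAt c v s) (hW : ∀ u, c u ∈ W) : v ∈ W := by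
  by_contra hv
  obtain ⟨f, hf, hfW⟩ := W.exists_clm_of_notMem hv
  have h1 := f.hasFDerivAt.comp_hasDerivAt s hc
  have h2 : HasDerivAt (fun u => f (c u)) 0 s := by
    simp only [fun u => hfW _ (hW u)]
    exact hasDerivAt_const s 0
  exact hf (h1.unique h2)

namespace TruncTensor

variable {d N : ℕ}

/-- The Lie algebra `𝔤_N` as a linear subspace. -/
noncomputable abbrev lieSub (d N : ℕ) : Submodule ℝ (TruncTensor d N) :=
  (freeNilpotentLie d N).toSubmodule

theorem lie_mem_lieSub {a b : TruncTensor d N} (ha : a ∈ lieSub d N) (hb : b ∈ lieSub d N) :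
    a * b - b * a ∈ lieSub d N := (freeNilpotentLie d N).lie_mem ha hb

theorem mem_lieSub_of_forall_sup {a : TruncTensor d N} (h : a ∈ lieSub d N ⊔ filt d N (N + 1)) :
    a ∈ lieSub d N := by
  obtain ⟨l, hl, r, hr, rfl⟩ := Submodule.mem_sup.1 h
  rw [eq_zero_of_mem_filt (Nat.lt_succ_self N) hr, add_zero]
  exact hl

/-- The inner automorphisms `x ↦ exp(-s a) x exp(s a)` preserve `𝔤_N`. -/
theorem conj_mem_lieSub {a x : TruncTensor d N} (ha : a ∈ lieSub d N) (hx : x ∈ lieSub d N)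
    (s : ℝ) : texp (s • (-a)) * x * texp (s • a) ∈ lieSub d N := by
  have ha1 := freeNilpotentLie_le_filt ha
  set y : ℝ → TruncTensor d N := fun s => texp (s • (-a)) * x * texp (s • a) with hy
  have hd : ∀ s, HasDerivAt y (y s * a - a * y s) s := fun s => by
    refine (hasDerivAt_mul (hasDerivAt_mul (hasDerivAt_texp_smul (neg_mem ha1) s)
      (hasDerivAt_const s x)) (hasDerivAt_texp_smul ha1 s)).congr_deriv ?_
    rw [commute_texp]
    simp only [hy]
    noncomm_ring
  -- Since `y' = [y, a]` and bracketing with `a` raises the degree, membership modulo degree `k`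
  -- improves to degree `k + 1`; beyond degree `N` no remainder is left.
  have key : ∀ k s, y s ∈ lieSub d N ⊔ filt d N k := by
    intro k
    induction k with
    | zero => exact fun s => Submodule.mem_sup_right (mem_filt_zero _)
    | succ k ih =>
      refine Submodule.mem_of_hasDerivAt_mem _ hd (fun s => ?_) ?_
      · obtain ⟨l, hl, r, hr, hlr⟩ := Submodule.mem_sup.1 (ih s)
        rw [← hlr]
        have e : (l + r) * a - a * (l + r) = (l * a - a * l) + (r * a - a * r) := by noncomm_ring
        rw [e]
        exact Submodule.add_mem_sup (lie_mem_lieSub hl ha)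
          (sub_mem (mul_mem_filt' hr ha1 le_rfl) (mul_mem_filt' ha1 hr (by omega)))
      · simp only [hy, zero_smul, texp_zero, one_mul, mul_one]
        exact Submodule.mem_sup_left hx
  exact mem_lieSub_of_forall_sup (key (N + 1) s)

theorem hasDerivAt_dexp_smul {a x : TruncTensor d N} (ha : a ∈ filt d N 1) (hx : x ∈ filt d N 1)
    (s : ℝ) : HasDerivAt (fun u : ℝ => dexp (u • a) (u • x))
      (a * dexp (s • a) (s • x) + x * texp (s • a)) s := by
  have h : ∀ k ∈ range (N + 1), HasDerivAt
      (fun u : ℝ => ((k.factorial : ℝ)⁻¹) • dpow (u • a) (u • x) k)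
      (((k.factorial : ℝ)⁻¹ * (k * s ^ (k - 1))) • dpow a x k) s := fun k _ => by
    simp only [dpow_smul_smul, smul_smul]
    exact ((_root_.hasDerivAt_pow k s).const_mul _).smul_const _
  refine (HasDerivAt.fun_sum h).congr_deriv ?_
  rw [Finset.sum_range_succ', texp, dexp, Finset.mul_sum, Finset.mul_sum, Finset.sum_range_succ,
    Finset.sum_range_succ (fun k => x * ((k.factorial : ℝ)⁻¹ • (s • a) ^ k))]
  have e1 : a * ((N.factorial : ℝ)⁻¹ • dpow (s • a) (s • x) N) = 0 := by
    have : a * dpow a x N ∈ filt d N (N + 1) := by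
      rcases N with _ | M
      · simp [dpow]
      · exact mul_mem_filt' ha (dpow_mem ha hx M) (by omega)
    rw [dpow_smul_smul, mul_smul_comm, mul_smul_comm,
      eq_zero_of_mem_filt (Nat.lt_succ_self N) this, smul_zero, smul_zero]
  have e2 : x * ((N.factorial : ℝ)⁻¹ • (s • a) ^ N) = 0 := by
    rw [smul_pow, mul_smul_comm, mul_smul_comm, eq_zero_of_mem_filt (Nat.lt_succ_self N)
      (mul_mem_filt' hx (pow_mem_filt ha N) (by omega)), smul_zero, smul_zero]
  rw [e1, e2]
  simp only [Nat.cast_zero, zero_mul, mul_zero, zero_smul, add_zero]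
  rw [← Finset.sum_add_distrib]
  refine Finset.sum_congr rfl fun k _ => ?_
  rw [dpow_smul_smul, smul_pow, mul_smul_comm, mul_smul_comm, mul_smul_comm, mul_smul_comm,
    smul_smul, smul_smul, ← smul_add, add_comm (a * _), dpow]
  congr 1
  rw [Nat.factorial_succ]
  push_cast
  have h1 : (k.factorial : ℝ) ≠ 0 := by positivity
  have h2 : (k : ℝ) + 1 ≠ 0 := by positivity
  field_simp

/-- This is `∫₀¹ exp(-s a) x exp(s a) ds`, whose integrand lies in the Lie algebra. The formula is
used in differentiated form. -/
theorem texp_neg_mul_dexp_mem_lieSub {a x : TruncTensor d N} (ha : a ∈ lieSub d N)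
    (hx : x ∈ lieSub d N) : texp (-a) * dexp a x ∈ lieSub d N := by
  have ha1 := freeNilpotentLie_le_filt ha
  have hx1 := freeNilpotentLie_le_filt hx
  have hd : ∀ s : ℝ, HasDerivAt (fun u : ℝ => texp (u • (-a)) * dexp (u • a) (u • x))
      (texp (s • (-a)) * x * texp (s • a)) s := fun s => by
    refine (hasDerivAt_mul (hasDerivAt_texp_smul (neg_mem ha1) s)
      (hasDerivAt_dexp_smul ha1 hx1 s)).congr_deriv ?_
    noncomm_ring
  have h0 : dexp (0 : TruncTensor d N) 0 = 0 := by
    have := dexp_add (0 : TruncTensor d N) 0 0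
    simpa using this
  have := Submodule.mem_of_hasDerivAt_mem (lieSub d N) hd (fun s => conj_mem_lieSub ha hx s)
    (by simp only [zero_smul, h0, mul_zero]; exact zero_mem _) 1
  simpa only [one_smul] using this

theorem texp_mul_sub_mem {a x : TruncTensor d N} {k : ℕ} (ha : a ∈ filt d N 1)
    (hx : x ∈ filt d N k) : texp a * x - x ∈ filt d N (k + 1) := by
  have e : texp a * x - x = (texp a - 1) * x := by noncomm_ring
  rw [e]
  exact mul_mem_filt' (texp_sub_one_mem ha) hx (by omega)

/-- The vector field `a ↦ D log (exp a) (exp a ⊗ y)`. -/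
noncomputable def leftField (y a : TruncTensor d N) : TruncTensor d N :=
  fderiv ℝ tlog (texp a) (texp a * y)

theorem hasDerivAt_tlog {c : ℝ → TruncTensor d N} {c' : TruncTensor d N} {s : ℝ}
    (hc : HasDerivAt c c' s) : HasDerivAt (fun u => tlog (c u)) (fderiv ℝ tlog (c s) c') s :=
  ((contDiff_tlog.differentiable (by simp)) (c s)).hasFDerivAt.comp_hasDerivAt s hc

theorem hasDerivAt_line (a v : TruncTensor d N) (s : ℝ) :
    HasDerivAt (fun u : ℝ => a + u • v) v s := by
  simpa using ((hasDerivAt_id s).smul_const v).const_add a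

variable {y a a' : TruncTensor d N}

theorem texp_mul_mem (hy : y ∈ filt d N 1) : texp a * y ∈ filt d N 1 :=
  mul_mem_filt' (mem_filt_zero _) hy le_rfl

theorem line_sub_one_mem (ha : a ∈ filt d N 1) (hy : y ∈ filt d N 1) (u : ℝ) :
    texp a + u • (texp a * y) - 1 ∈ filt d N 1 := by
  rw [add_sub_right_comm]
  exact add_mem (texp_sub_one_mem ha) (Submodule.smul_mem _ _ (texp_mul_mem hy))

theorem leftField_mem_filt (hy : y ∈ filt d N 1) (ha : a ∈ filt d N 1) :
    leftField y a ∈ filt d N 1 := by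
  have h := hasDerivAt_tlog (hasDerivAt_line (texp a) (texp a * y) 0)
  rw [zero_smul, add_zero] at h
  exact Submodule.hasDerivAt_mem _ h fun u => tlog_mem (line_sub_one_mem ha hy u)

/-- Differentiate `texp (tlog g) = g` along a line that stays in the set where this identity holds.
-/
theorem dexp_leftField (hy : y ∈ filt d N 1) (ha : a ∈ filt d N 1) :
    dexp a (leftField y a) = texp a * y := by
  have h := hasDerivAt_texp (hasDerivAt_tlog (hasDerivAt_line (texp a) (texp a * y) 0))
  simp only [fun u => texp_tlog (line_sub_one_mem ha hy u)] at h
  rw [zero_smul, add_zero, tlog_texp ha] at h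
  exact h.unique (hasDerivAt_line _ _ 0)

/-- The map `X ↦ exp(-a) Dexp(a) X` preserves the Lie algebra and is the identity up to higher
degree, so its equation with right side `y` can be solved in the Lie algebra degree by degree. -/
theorem leftField_mem_lieSub (hy : y ∈ lieSub d N) (ha : a ∈ lieSub d N) :
    leftField y a ∈ lieSub d N := by
  have ha1 := freeNilpotentLie_le_filt ha
  have hy1 := freeNilpotentLie_le_filt hy
  set X := leftField y a with hX
  have hφ : texp (-a) * dexp a X = y := by
    rw [hX, dexp_leftField hy1 ha1, ← mul_assoc, texp_neg_mul_texp ha1, one_mul]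
  have key : ∀ k, X ∈ lieSub d N ⊔ filt d N (k + 1) := by
    intro k
    induction k with
    | zero => exact Submodule.mem_sup_right (leftField_mem_filt hy1 ha1)
    | succ k ih =>
      obtain ⟨l, hl, r, hr, hlr⟩ := Submodule.mem_sup.1 ih
      have h1 := texp_neg_mul_dexp_mem_lieSub ha hl
      have h2 := dexp_sub_mem (by omega) ha1 hr
      have h3 := texp_mul_sub_mem (neg_mem ha1) (k := k + 1) (x := dexp a r) (by
        simpa using add_mem (filt_anti (by omega) h2) hr)
      rw [← hlr, dexp_add, mul_add] at hφ
      have e : X = (l + y - texp (-a) * dexp a l) -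
          ((texp (-a) * dexp a r - dexp a r) + (dexp a r - r)) := by
        rw [← hφ, ← hlr]; abel
      rw [e]
      exact sub_mem (Submodule.mem_sup_left (sub_mem (add_mem hl hy) h1))
        (Submodule.mem_sup_right (add_mem h3 h2))
  exact mem_lieSub_of_forall_sup (key N)

/-- Multiplication by `y`, which has no constant term, gains one degree, and inverting `dexp` loses
none. Each degree of the field thus depends only on lower degrees of its argument, so the equation
is triangular. -/
theorem leftField_sub_mem (hy : y ∈ filt d N 1) (ha : a ∈ filt d N 1) (ha' : a' ∈ filt d N 1)
    {k : ℕ} (hk : 1 ≤ k) (h : a - a' ∈ filt d N k) :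
    leftField y a - leftField y a' ∈ filt d N (k + 1) := by
  have hX := leftField_mem_filt hy ha
  have hX' := leftField_mem_filt hy ha'
  have hr : dexp a (leftField y a) - dexp a' (leftField y a') ∈ filt d N (k + 1) := by
    rw [dexp_leftField hy ha, dexp_leftField hy ha', ← sub_mul]
    refine mul_mem_filt' (j := k) ?_ hy le_rfl
    simpa using add_mem (filt_anti (by omega) (texp_sub_texp_mem hk ha ha' h)) h
  have key : ∀ j ≤ k, leftField y a - leftField y a' ∈ filt d N (j + 1) := by
    intro j
    induction j with
    | zero => exact fun _ => sub_mem hX hX'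
    | succ j ih =>
      intro hj
      have h1 := dexp_sub_dexp_mem (j := j + 1) (by omega) ha ha' hX hX' (filt_anti hj h)
        (ih (by omega))
      have h2 := sub_mem (filt_anti (by omega) hr) h1
      simpa using h2
  exact key k le_rfl

/-- The step of the induction that shows that solutions stay in the Lie algebra. -/
theorem leftField_mem_sup (hy : y ∈ lieSub d N) (ha1 : a ∈ filt d N 1) {k : ℕ} (hk : 1 ≤ k)
    (ha : a ∈ lieSub d N ⊔ filt d N k) : leftField y a ∈ lieSub d N ⊔ filt d N (k + 1) := by
  obtain ⟨l, hl, r, hr, rfl⟩ := Submodule.mem_sup.1 ha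
  have h := leftField_sub_mem (freeNilpotentLie_le_filt hy) ha1 (freeNilpotentLie_le_filt hl) hk
    (by simpa using hr)
  have := add_mem (Submodule.mem_sup_left (leftField_mem_lieSub hy hl) :
    _ ∈ lieSub d N ⊔ filt d N (k + 1)) (Submodule.mem_sup_right h)
  simpa using this

/-- The finite induction on the degree, shared by solutions of ordinary and of Young equations. -/
theorem mem_lieSub_of_induction {X : Type*} {c : X → TruncTensor d N} (hc : ∀ s, c s ∈ filt d N 1)
    (h : ∀ k, 1 ≤ k → (∀ s, c s ∈ lieSub d N ⊔ filt d N k) →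
      ∀ s, c s ∈ lieSub d N ⊔ filt d N (k + 1)) (s : X) : c s ∈ lieSub d N := by
  have key : ∀ k s, c s ∈ lieSub d N ⊔ filt d N (k + 1) := by
    intro k
    induction k with
    | zero => exact fun s => Submodule.mem_sup_right (hc s)
    | succ k ih => exact h (k + 1) (by omega) ih
  exact mem_lieSub_of_forall_sup (key N s)

/-- The group is closed under multiplication. -/
theorem tlog_texp_mul_texp_mem {u : TruncTensor d N} (hu : u ∈ lieSub d N) (hy : y ∈ lieSub d N)
    (s : ℝ) : tlog (texp u * texp (s • y)) ∈ lieSub d N := by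
  have hu1 := freeNilpotentLie_le_filt hu
  have hy1 := freeNilpotentLie_le_filt hy
  have hg : ∀ s : ℝ, texp u * texp (s • y) - 1 ∈ filt d N 1 := fun s =>
    mul_sub_one_mem (texp_sub_one_mem hu1) (texp_sub_one_mem (Submodule.smul_mem _ _ hy1))
  -- In `s`, the logarithm of the product flows along the left invariant field of `y`; this replaces
  -- the Campbell–Hausdorff formula.
  have hd : ∀ s : ℝ, HasDerivAt (fun s : ℝ => tlog (texp u * texp (s • y)))
      (leftField y (tlog (texp u * texp (s • y)))) s := fun s => by
    have := hasDerivAt_tlog (hasDerivAt_mul (hasDerivAt_const s (texp u))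
      (hasDerivAt_texp_smul hy1 s))
    rw [zero_mul, zero_add, ← mul_assoc] at this
    rw [leftField, texp_tlog (hg s)]
    exact this
  refine mem_lieSub_of_induction (c := fun s : ℝ => tlog (texp u * texp (s • y)))
    (fun s => tlog_mem (hg s)) (fun k hk ih => ?_) s
  refine Submodule.mem_of_hasDerivAt_mem _ hd
    (fun s => leftField_mem_sup hy (tlog_mem (hg s)) hk (ih s)) ?_
  simp only [zero_smul, texp_zero, mul_one, tlog_texp hu1]
  exact Submodule.mem_sup_left hu

end TruncTensor

/-! ### The chain rule for the logarithm of the signature -/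

theorem two_le_contDiff_infty : (2 : WithTop ℕ∞) ≤ ∞ := by
  exact WithTop.coe_le_coe.2 (le_top : (2 : ℕ∞) ≤ ⊤)

namespace TruncTensor

variable {d N : ℕ}

instance instProperSpace : ProperSpace (TruncTensor d N) := FiniteDimensional.proper ℝ _

theorem abs_apply_le_norm (a : TruncTensor d N) (w : Word d N) : |a w| ≤ ‖a‖ :=
  norm_le_pi_norm (f := (a : Word d N → ℝ)) w

theorem norm_le_iff {a : TruncTensor d N} {r : ℝ} (hr : 0 ≤ r) :
    ‖a‖ ≤ r ↔ ∀ w, |a w| ≤ r :=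
  pi_norm_le_iff_of_nonneg (x := (a : Word d N → ℝ)) hr

theorem sub_apply (a b : TruncTensor d N) (w : Word d N) : (a - b) w = a w - b w := rfl

theorem sum_apply {ι : Type*} (A : Finset ι) (f : ι → TruncTensor d N) (w : Word d N) :
    (∑ i ∈ A, f i) w = ∑ i ∈ A, f i w := Finset.sum_apply w A (fun i => (f i : Word d N → ℝ))

theorem mul_letter_nil (a : TruncTensor d N) (i : Fin d) {w : Word d N} (hw : w.1 = []) :
    (a * letter N i) w = 0 := by
  rw [mul_apply, hw]
  simp [letter, suf, hw]

/-- Right multiplication by a letter appends it to words, so `dS = S ⊗ dx` is the recursion of the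
iterated integrals. -/
theorem mul_letter_concat (a : TruncTensor d N) (i j : Fin d) {w v : Word d N}
    (hw : w.1 = v.1 ++ [j]) : (a * letter N i) w = if i = j then a v else 0 := by
  have hlen : w.1.length = v.1.length + 1 := by rw [hw]; simp
  rw [mul_apply, Finset.sum_eq_single v.1.length]
  · have h1 : pre w v.1.length = v := Subtype.ext (by simp [pre, hw])
    have h2 : (suf w v.1.length).1 = [j] := by simp [suf, hw]
    rw [h1, letter, h2]
    by_cases h : i = j
    · simp [h]
    · have : ¬ [j] = [i] := by simpa using fun e => h e.symm
      simp [h, this]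
  · intro k hk hkv
    have : (suf w k).1 ≠ [i] := by
      intro e
      have := congrArg List.length e
      simp only [suf, List.length_drop, List.length_singleton, mem_range] at this hk
      omega
    simp [letter, this]
  · intro h
    exact absurd (mem_range.2 (by omega)) h

end TruncTensor

namespace YoungPath

variable {θ : ℝ} {d N : ℕ}

open TruncTensor

/-- The signature of a tuple of paths. -/
noncomputable def sig (hθ : 0 < θ) (N : ℕ) (x : Fin d → YoungPath θ) (t : I) : TruncTensor d N :=
  fun w => iterated hθ x w.1.reverse t

theorem signature_eq_sig (hθ : 0 < θ) (x : Fin d → YoungPath θ)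
    {h : I → EuclideanSpace ℝ (Fin d)} (hx : ∀ i t, h t i = x i t) (t : I) :
    signature N h t = sig hθ N x t := funext fun w => signature_apply hθ x hx t w

variable (hθ : 0 < θ) (x : Fin d → YoungPath θ)

theorem sig_nil {w : Word d N} (hw : w.1 = []) (t : I) : sig hθ N x t w = 1 := by
  simp [sig, hw, iterated, const_apply]

/-- The last letter of a word belongs to the outermost integral, and the reversal puts it at the
head of the list. -/
theorem sig_concat {w v : Word d N} {j : Fin d} (hw : w.1 = v.1 ++ [j]) (t : I) :
    sig hθ N x t w = youngIntegral (fun s => sig hθ N x s v) (x j) t := by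
  simp only [sig, hw, List.reverse_append, List.reverse_singleton, List.singleton_append, iterated]
  rfl

theorem word_cases (w : Word d N) : w.1 = [] ∨ ∃ (v : Word d N) (j : Fin d), w.1 = v.1 ++ [j] := by
  rcases List.eq_nil_or_concat w.1 with h | ⟨v, j, h⟩
  · exact Or.inl h
  · refine Or.inr ⟨⟨v, ?_⟩, j, by simpa using h⟩
    have := w.2
    rw [h] at this
    simp at this
    omega

theorem sig_zero : sig hθ N x 0 = 1 := by
  funext w
  rw [one_apply]
  rcases word_cases w with h | ⟨v, j, h⟩
  · rw [sig_nil hθ x h, if_pos h]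
  · rw [sig_concat hθ x h, if_neg (by simp [h])]
    exact youngIntegral_zero hθ (iterated hθ x v.1.reverse) (x j)

theorem sig_sub_one_mem (t : I) : sig hθ N x t - 1 ∈ filt d N 1 := by
  intro w hw
  have h : w.1 = [] := List.length_eq_zero_iff.1 (by omega)
  rw [TruncTensor.sub_apply, sig_nil hθ x h, one_apply, if_pos h, sub_self]

/-- A control of the increments of the signature. -/
noncomputable def sigControl (N : ℕ) (s t : I) : ℝ :=
  ∑ w : Word d N, rieszVar θ (iterated hθ x w.1.reverse) s t

theorem isControl_sigControl : IsControl (sigControl hθ x N) :=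
  IsControl.sum _ fun w _ => isControl_rieszVar (iterated hθ x w.1.reverse)

/-- A control of the second order increments of the signature. -/
noncomputable def sigControl₂ (N : ℕ) (s t : I) : ℝ :=
  ∑ w : Word d N, ∑ i, √(rieszVar θ (iterated hθ x w.1.reverse) s t) * √(rieszVar θ (x i) s t)

theorem isControl_sigControl₂ : IsControl (sigControl₂ hθ x N) :=
  IsControl.sum _ fun w _ => IsControl.sum _ fun i _ =>
    (isControl_rieszVar (iterated hθ x w.1.reverse)).sqrt_mul_sqrt (isControl_rieszVar (x i))

theorem sq_norm_sig_sub_le {s t : I} (hst : s ≤ t) :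
    ‖sig hθ N x t - sig hθ N x s‖ ^ 2 ≤ ((t : ℝ) - s) ^ θ * sigControl hθ x N s t := by
  have hD := (sub_rpow_mem_Icc hθ hst).1
  have hpos := mul_nonneg hD ((isControl_sigControl (N := N) hθ x).nonneg s t hst)
  have : ‖sig hθ N x t - sig hθ N x s‖ ≤ √(((t : ℝ) - s) ^ θ * sigControl hθ x N s t) := by
    rw [norm_le_iff (Real.sqrt_nonneg _)]
    intro w
    refine Real.abs_le_sqrt ((sq_sub_le (iterated hθ x w.1.reverse) hst).trans ?_)
    refine mul_le_mul_of_nonneg_left ?_ hD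
    exact Finset.single_le_sum (f := fun w : Word d N =>
      rieszVar θ (iterated hθ x w.1.reverse) s t)
      (fun w _ => (isControl_rieszVar (iterated hθ x w.1.reverse)).nonneg s t hst) (mem_univ w)
  calc _ ≤ √(((t : ℝ) - s) ^ θ * sigControl hθ x N s t) ^ 2 := by gcongr
    _ = _ := Real.sq_sqrt hpos

/-- The local form of `dS = S ⊗ dx`, obtained from the sewing estimate for each coefficient. -/
theorem norm_sig_second_order_le {s t : I} (hst : s ≤ t) :
    ‖sig hθ N x t - sig hθ N x s - ∑ i, (x i t - x i s) • (sig hθ N x s * letter N i)‖ ≤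
      sewingConst θ * (((t : ℝ) - s) ^ θ * sigControl₂ hθ x N s t) := by
  have hD := (sub_rpow_mem_Icc hθ hst).1
  have hC := (sewingConst_pos hθ).le
  have hpos := mul_nonneg hC (mul_nonneg hD ((isControl_sigControl₂ (N := N) hθ x).nonneg s t hst))
  rw [norm_le_iff hpos]
  intro w
  rw [TruncTensor.sub_apply, TruncTensor.sub_apply, TruncTensor.sum_apply]
  rcases word_cases w with h | ⟨v, j, h⟩
  · rw [sig_nil hθ x h, sig_nil hθ x h]
    simp only [smul_apply, mul_letter_nil _ _ h, mul_zero, Finset.sum_const_zero, sub_self,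
      abs_zero]
    exact hpos
  · rw [sig_concat hθ x h, sig_concat hθ x h]
    simp only [smul_apply, mul_letter_concat _ _ _ h, mul_ite, mul_zero, Finset.sum_ite_eq',
      mem_univ, if_true]
    rw [mul_comm (x j t - x j s)]
    refine (youngIntegral_estimate hθ (iterated hθ x v.1.reverse) (x j) hst).trans ?_
    refine mul_le_mul_of_nonneg_left (mul_le_mul_of_nonneg_left ?_ hD) hC
    refine le_trans ?_ (Finset.single_le_sum (f := fun w : Word d N => ∑ i,
      √(rieszVar θ (iterated hθ x w.1.reverse) s t) * √(rieszVar θ (x i) s t))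
      (fun w _ => by positivity) (mem_univ v))
    exact Finset.single_le_sum (f := fun i =>
      √(rieszVar θ (iterated hθ x v.1.reverse) s t) * √(rieszVar θ (x i) s t))
      (fun i _ => by positivity) (mem_univ j)

theorem exists_sig_mem_closedBall : ∃ R, ∀ t, sig hθ N x t ∈ Metric.closedBall 0 R := by
  refine ⟨∑ w : Word d N, 2 * ‖iterated hθ x w.1.reverse‖, fun t => ?_⟩
  rw [mem_closedBall_zero_iff, norm_le_iff (by positivity)]
  intro w
  refine (abs_apply_le (iterated hθ x w.1.reverse) hθ t).trans ?_
  exact Finset.single_le_sum (f := fun w : Word d N => 2 * ‖iterated hθ x w.1.reverse‖)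
    (fun w _ => by positivity) (mem_univ w)

theorem exists_lipschitz {E F : Type*} [NormedAddCommGroup E] [NormedSpace ℝ E] [ProperSpace E]
    [NormedAddCommGroup F] [NormedSpace ℝ F] {φ : E → F} (hφ : ContDiff ℝ 1 φ) (R : ℝ) :
    ∃ K, 0 ≤ K ∧ ∀ a ∈ Metric.closedBall (0 : E) R, ∀ b ∈ Metric.closedBall (0 : E) R,
      ‖φ b - φ a‖ ≤ K * ‖b - a‖ := by
  obtain ⟨K, hK⟩ := (isCompact_closedBall (0 : E) R).exists_bound_of_continuousOn
    (f := fderiv ℝ φ) (hφ.continuous_fderiv (by simp)).continuousOn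
  refine ⟨|K|, abs_nonneg K, fun a ha b hb => ?_⟩
  exact (convex_closedBall (0 : E) R).norm_image_sub_le_of_norm_fderiv_le
    (fun z _ => (hφ.differentiable (by simp)) z) (fun z hz => (hK z hz).trans (le_abs_self K)) ha hb

theorem exists_taylor {E F : Type*} [NormedAddCommGroup E] [NormedSpace ℝ E] [ProperSpace E]
    [NormedAddCommGroup F] [NormedSpace ℝ F] {φ : E → F} (hφ : ContDiff ℝ 2 φ) (R : ℝ) :
    ∃ K, 0 ≤ K ∧ ∀ a ∈ Metric.closedBall (0 : E) R, ∀ b ∈ Metric.closedBall (0 : E) R,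
      ‖φ b - φ a - fderiv ℝ φ a (b - a)‖ ≤ K * ‖b - a‖ ^ 2 := by
  obtain ⟨K, hK0, hK⟩ := exists_lipschitz (φ := fderiv ℝ φ) (hφ.fderiv_right (m := 1) (by norm_num)) R
  refine ⟨K, hK0, fun a ha b hb => ?_⟩
  have hseg := (convex_closedBall (0 : E) R).segment_subset ha hb
  have := (convex_segment a b).norm_image_sub_le_of_norm_fderiv_le' (f := φ)
    (φ := fderiv ℝ φ a) (C := K * ‖b - a‖)
    (fun z _ => (hφ.differentiable (by simp)) z) (fun z hz => by
      refine (hK a ha z (hseg hz)).trans (mul_le_mul_of_nonneg_left ?_ hK0)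
      have := norm_sub_le_of_mem_segment hz
      rwa [norm_sub_rev z a, norm_sub_rev a z] at *) (left_mem_segment ℝ a b)
      (right_mem_segment ℝ a b)
  rwa [mul_assoc, ← pow_two] at this

theorem comp_sig_mem {φ : TruncTensor d N → ℝ} (hφ : ContDiff ℝ 1 φ) :
    (fun t => φ (sig hθ N x t)) ∈ youngSubmodule θ := by
  obtain ⟨R, hR⟩ := exists_sig_mem_closedBall (N := N) hθ x
  obtain ⟨K, hK0, hK⟩ := exists_lipschitz hφ R
  refine mem_youngSubmodule_of_control
    ((isControl_sigControl (N := N) hθ x).const_mul (sq_nonneg K)) fun s t hst => ?_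
  have h1 := hK _ (hR s) _ (hR t)
  rw [Real.norm_eq_abs] at h1
  calc _ = |φ (sig hθ N x t) - φ (sig hθ N x s)| ^ 2 := (sq_abs _).symm
    _ ≤ (K * ‖sig hθ N x t - sig hθ N x s‖) ^ 2 := by gcongr
    _ = K ^ 2 * ‖sig hθ N x t - sig hθ N x s‖ ^ 2 := mul_pow _ _ _
    _ ≤ K ^ 2 * (((t : ℝ) - s) ^ θ * sigControl hθ x N s t) := by
      gcongr
      exact sq_norm_sig_sub_le hθ x hst
    _ = _ := by ring

theorem contDiff_apply_word {E : Type*} [NormedAddCommGroup E] [NormedSpace ℝ E]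
    {n : WithTop ℕ∞} {φ : E → TruncTensor d N} (hφ : ContDiff ℝ n φ) (w : Word d N) :
    ContDiff ℝ n fun a => φ a w := contDiff_pi.1 hφ w

/-- The chain rule for smooth functions of the signature. -/
theorem chain_rule {φ : TruncTensor d N → TruncTensor d N} (hφ : ContDiff ℝ ∞ φ) (w : Word d N)
    (t : I) : ∃ J : Fin d → ℝ,
      (∀ i, HasYoungIntegral (fun s => fderiv ℝ φ (sig hθ N x s) (sig hθ N x s * letter N i) w)
        (x i) t (J i)) ∧ φ (sig hθ N x t) w - φ (sig hθ N x 0) w = ∑ i, J i := by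
  have hfc : ∀ i, ContDiff ℝ 1 fun g : TruncTensor d N => fderiv ℝ φ g (g * letter N i) w :=
    fun i => contDiff_apply_word ((hφ.fderiv_right (m := 1) (by
      rw [one_add_one_eq_two]; exact two_le_contDiff_infty)).clm_apply
      (contDiff_mul contDiff_id contDiff_const)) w
  let f : Fin d → YoungPath θ := fun i => ⟨_, comp_sig_mem hθ x (hfc i)⟩
  refine ⟨fun i => youngIntegral (f i) (x i) t, fun i => hasYoungIntegral hθ (f i) (x i) t, ?_⟩
  obtain ⟨R, hR⟩ := exists_sig_mem_closedBall (N := N) hθ x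
  obtain ⟨K, hK0, hK⟩ := exists_taylor (hφ.of_le two_le_contDiff_infty) R
  obtain ⟨M, hM⟩ := (isCompact_closedBall (0 : TruncTensor d N) R).exists_bound_of_continuousOn
    (f := fderiv ℝ φ) (hφ.continuous_fderiv (by simp)).continuousOn
  have hC := (sewingConst_pos hθ).le
  refine eq_sum_youngIntegral hθ (ν := fun s t => K * sigControl hθ x N s t +
    |M| * sewingConst θ * sigControl₂ hθ x N s t) (C := 1)
    (((isControl_sigControl (N := N) hθ x).const_mul hK0).add
      ((isControl_sigControl₂ (N := N) hθ x).const_mul (by positivity))) f x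
    (F := fun t => φ (sig hθ N x t) w) (fun s t hst => ?_) t
  set S := sig hθ N x
  have h1 := hK _ (hR s) _ (hR t)
  have h2 := norm_sig_second_order_le (N := N) hθ x hst
  have h3 := sq_norm_sig_sub_le (N := N) hθ x hst
  -- First order Taylor expansion of `φ`, then of `S`. The two remainders are of order `‖ΔS‖²` and
  -- of sewing order, each `(t - s)^θ` times a control.
  have e : φ (S t) w - φ (S s) w - ∑ i, f i s * (x i t - x i s) =
      ((φ (S t) - φ (S s) - fderiv ℝ φ (S s) (S t - S s)) +
        fderiv ℝ φ (S s) (S t - S s - ∑ i, (x i t - x i s) • (S s * letter N i))) w := by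
    rw [map_sub (fderiv ℝ φ (S s)) (S t - S s), map_sum]
    simp only [map_smul, TruncTensor.add_apply, TruncTensor.sub_apply, TruncTensor.sum_apply,
      TruncTensor.smul_apply]
    rw [Finset.sum_congr rfl fun i _ => mul_comm (f i s) (x i t - x i s)]
    change _ - ∑ i, (x i t - x i s) * (fderiv ℝ φ (S s)) (S s * letter N i) w = _
    ring
  rw [e]
  refine (abs_apply_le_norm _ w).trans ((norm_add_le _ _).trans ?_)
  calc _ ≤ K * (((t : ℝ) - s) ^ θ * sigControl hθ x N s t) +
      |M| * (sewingConst θ * (((t : ℝ) - s) ^ θ * sigControl₂ hθ x N s t)) := by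
        refine add_le_add (h1.trans (mul_le_mul_of_nonneg_left h3 hK0)) ?_
        refine ((fderiv ℝ φ (S s)).le_opNorm _).trans ?_
        exact mul_le_mul ((hM _ (hR s)).trans (le_abs_self M)) h2 (norm_nonneg _) (abs_nonneg M)
    _ = _ := by ring

end YoungPath

/-! ### The equation in logarithmic coordinates -/

open TruncTensor

theorem TruncTensor.linear_apply_eq_sum {d N : ℕ} (l : TruncTensor d N →ₗ[ℝ] ℝ) :
    ∃ c : Word d N → ℝ, ∀ a, l a = ∑ w, c w * a w :=
  ⟨_, fun a => (LinearMap.pi_apply_eq_sum_univ (l : (Word d N → ℝ) →ₗ[ℝ] ℝ) a).trans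
    (Finset.sum_congr rfl fun _ _ => mul_comm _ _)⟩

theorem HasYoungIntegral.linear {d N : ℕ} {f : I → TruncTensor d N} {x : I → ℝ} {t : I}
    {J : TruncTensor d N} (h : ∀ w, HasYoungIntegral (fun s => f s w) x t (J w))
    (l : TruncTensor d N →ₗ[ℝ] ℝ) : HasYoungIntegral (fun s => l (f s)) x t (l J) := by
  obtain ⟨c, hc⟩ := TruncTensor.linear_apply_eq_sum l
  simp only [hc]
  exact HasYoungIntegral.sum _ fun w _ => (h w).const_mul (c w)

/-- Young integration commutes with the linear functionals that cut out `W`. -/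
theorem Submodule.youngIntegral_mem {d N : ℕ} (W : Submodule ℝ (TruncTensor d N))
    {f : I → TruncTensor d N} {x : I → ℝ} {t : I} {J : TruncTensor d N}
    (h : ∀ w, HasYoungIntegral (fun s => f s w) x t (J w)) (hf : ∀ s, f s ∈ W) : J ∈ W := by
  by_contra hJ
  obtain ⟨l, hl, hW⟩ := W.exists_clm_of_notMem hJ
  have h1 := HasYoungIntegral.linear h l
  have e : (fun s => (l : TruncTensor d N →ₗ[ℝ] ℝ) (f s)) = fun _ => 0 :=
    funext fun s => hW _ (hf s)
  rw [e] at h1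
  exact hl (h1.unique (HasYoungIntegral.zero_left x t))

/-- The equation `dZ = ∑ (leftField e_i)(Z) dh^i`, `Z_0 = 0`. -/
def SolvesLogEquation {d N : ℕ} (h : I → EuclideanSpace ℝ (Fin d)) (Z : I → TruncTensor d N) :
    Prop :=
  ∀ t, ∃ J : Fin d → TruncTensor d N,
    (∀ i w, HasYoungIntegral (fun s => leftField (letter N i) (Z s) w) (fun s => h s i) t (J i w)) ∧
    Z t = ∑ i, J i

namespace SolvesLogEquation

variable {d N : ℕ} {h : I → EuclideanSpace ℝ (Fin d)} {Z Z' : I → TruncTensor d N}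

/-- The fields improve membership in the Lie algebra by one degree, and integration stays in the
improved subspace. -/
theorem mem_lieSub (hZ : SolvesLogEquation h Z) (h1 : ∀ s, Z s ∈ filt d N 1) (t : I) :
    Z t ∈ lieSub d N := by
  refine mem_lieSub_of_induction h1 (fun k hk ih t => ?_) t
  obtain ⟨J, hJ, e⟩ := hZ t
  rw [e]
  exact sum_mem fun i _ => Submodule.youngIntegral_mem _ (hJ i)
    fun s => leftField_mem_sup (letter_mem i) (h1 s) hk (ih s)

/-- By triangularity the integrands coincide in the next degree as soon as the solutions agree in
the lower ones, and the integrals are unique. Solutions need no regularity beyond the existence of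
their integrals. -/
theorem unique (hZ : SolvesLogEquation h Z) (hZ' : SolvesLogEquation h Z')
    (h1 : ∀ s, Z s ∈ filt d N 1) (h1' : ∀ s, Z' s ∈ filt d N 1) : Z = Z' := by
  have key : ∀ k t, Z t - Z' t ∈ filt d N (k + 1) := by
    intro k
    induction k with
    | zero => exact fun t => sub_mem (h1 t) (h1' t)
    | succ k ih =>
      intro t w hw
      obtain ⟨J, hJ, e⟩ := hZ t
      obtain ⟨J', hJ', e'⟩ := hZ' t
      rw [TruncTensor.sub_apply, e, e', TruncTensor.sum_apply, TruncTensor.sum_apply, sub_eq_zero]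
      refine Finset.sum_congr rfl fun i _ => ?_
      have e2 : (fun s => leftField (letter N i) (Z s) w) =
          fun s => leftField (letter N i) (Z' s) w := by
        funext s
        have := leftField_sub_mem (letter_mem_filt (N := N) i) (h1 s) (h1' s) (by omega) (ih s) w hw
        rwa [TruncTensor.sub_apply, sub_eq_zero] at this
      have := hJ i w
      rw [e2] at this
      exact this.unique (hJ' i w)
  exact funext fun t => sub_eq_zero.1 (eq_zero_of_mem_filt (Nat.lt_succ_self N) (key N t))

end SolvesLogEquation

namespace YoungPath

variable {θ : ℝ} {d N : ℕ} (hθ : 0 < θ) (x : Fin d → YoungPath θ)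
  {h : I → EuclideanSpace ℝ (Fin d)}

/-- The chain rule for `tlog`: as `S` is the exponential of its logarithm, the derivative of `tlog`
at `S` along `S ⊗ e_i` is `leftField` at `tlog S`. -/
theorem solvesLogEquation (hx : ∀ i t, h t i = x i t) :
    SolvesLogEquation h fun t => tlog (sig hθ N x t) := by
  intro t
  choose J hJ e using fun w => chain_rule hθ x (contDiff_tlog (d := d) (N := N)) w t
  let J' : Fin d → TruncTensor d N := fun i w => J w i
  refine ⟨J', fun i w => ?_, ?_⟩
  · have e1 : (fun s => h s i) = x i := funext (hx i)
    rw [e1]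
    simp only [leftField, texp_tlog (sig_sub_one_mem hθ x _)]
    exact hJ w i
  · funext w
    change tlog (sig hθ N x t) w = (∑ i, J' i) w
    rw [TruncTensor.sum_apply]
    change _ = ∑ i, J w i
    rw [← e w, sig_zero, ← texp_zero, tlog_texp (zero_mem _),
      TruncTensor.zero_apply, sub_zero]

end YoungPath

/-! ### Coordinates with respect to a basis of the Lie algebra. -/

section Coordinates

variable {d N n : ℕ} (b : Module.Basis (Fin n) ℝ (freeNilpotentLie d N))

/-- The linear coordinates on the Lie algebra, extended to the tensor algebra. -/
theorem exists_coordExt : ∃ P : TruncTensor d N →ₗ[ℝ] (Fin n → ℝ),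
    ∀ (z) (hz : z ∈ freeNilpotentLie d N), P z = b.equivFun ⟨z, hz⟩ := by
  obtain ⟨P, hP⟩ := LinearMap.exists_extend (p := lieSub d N) (b.equivFun : _ →ₗ[ℝ] (Fin n → ℝ))
  exact ⟨P, fun z hz => LinearMap.congr_fun hP ⟨z, hz⟩⟩

/-- A linear extension of the coordinates on the Lie algebra. -/
noncomputable def coordExt : TruncTensor d N →L[ℝ] (Fin n → ℝ) :=
  LinearMap.toContinuousLinearMap (exists_coordExt b).choose

theorem coordExt_apply {z : TruncTensor d N} (hz : z ∈ freeNilpotentLie d N) :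
    coordExt b z = b.equivFun ⟨z, hz⟩ := (exists_coordExt b).choose_spec z hz

/-- The element of the Lie algebra with coordinates `u`. -/
noncomputable def lieOfCoord (u : Fin n → ℝ) : TruncTensor d N := (b.equivFun.symm u : _)

theorem lieOfCoord_mem (u : Fin n → ℝ) : lieOfCoord b u ∈ freeNilpotentLie d N :=
  (b.equivFun.symm u).2

theorem coordExt_lieOfCoord (u : Fin n → ℝ) : coordExt b (lieOfCoord b u) = u := by
  rw [coordExt_apply b (lieOfCoord_mem b u)]
  exact b.equivFun.apply_symm_apply u

theorem lieOfCoord_coordExt {z : TruncTensor d N} (hz : z ∈ freeNilpotentLie d N) :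
    lieOfCoord b (coordExt b z) = z := by
  rw [coordExt_apply b hz, lieOfCoord, LinearEquiv.symm_apply_apply]

theorem lieOfCoord_mem_filt (u : Fin n → ℝ) : lieOfCoord b u ∈ filt d N 1 :=
  freeNilpotentLie_le_filt (lieOfCoord_mem b u)

theorem expCoord_eq (u : Fin n → ℝ) : expCoord b u = texp (lieOfCoord b u) := rfl

theorem expCoord_injective : Function.Injective (expCoord b) := fun u v h => by
  have := texp_injOn (lieOfCoord_mem_filt b u) (lieOfCoord_mem_filt b v) h
  rw [← coordExt_lieOfCoord b u, this, coordExt_lieOfCoord]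

theorem logCoord_texp {z : TruncTensor d N} (hz : z ∈ freeNilpotentLie d N) :
    logCoord b (texp z) = coordExt b z := by
  have : texp z = expCoord b (coordExt b z) := by rw [expCoord_eq, lieOfCoord_coordExt b hz]
  rw [this]
  exact Function.leftInverse_invFun (expCoord_injective b) _

theorem logCoord_eq {g : TruncTensor d N} (hg : g - 1 ∈ filt d N 1)
    (hz : tlog g ∈ freeNilpotentLie d N) : logCoord b g = coordExt b (tlog g) := by
  rw [← logCoord_texp b hz, texp_tlog hg]

/-- The product stays in the group, so the abstract inverse `logCoord` may be replaced by the smooth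
map `coordExt b ∘ tlog` before differentiating. -/
theorem leftInvariantField_eq (i : Fin d) (u : Fin n → ℝ) :
    leftInvariantField b i u = coordExt b (leftField (letter N i) (lieOfCoord b u)) := by
  have hu := lieOfCoord_mem b u
  have hu1 := lieOfCoord_mem_filt b u
  have hy1 := letter_mem_filt (N := N) i
  have e : (fun ε : ℝ => logCoord b (expCoord b u * texp (ε • letter N i))) = fun ε =>
      coordExt b (tlog (texp (lieOfCoord b u) * texp (ε • letter N i))) := by
    funext ε
    exact logCoord_eq b (mul_sub_one_mem (texp_sub_one_mem hu1)
      (texp_sub_one_mem (Submodule.smul_mem _ _ hy1)))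
      (tlog_texp_mul_texp_mem hu (letter_mem i) ε)
  have hd := hasDerivAt_tlog (hasDerivAt_mul (hasDerivAt_const (0 : ℝ) (texp (lieOfCoord b u)))
    (hasDerivAt_texp_smul hy1 0))
  rw [zero_smul, texp_zero, zero_mul, zero_add, mul_one, one_mul] at hd
  rw [leftInvariantField, e]
  exact ((coordExt b).hasFDerivAt.comp_hasDerivAt 0 hd).deriv

theorem lieOfCoord_leftInvariantField (i : Fin d) (u : Fin n → ℝ) :
    lieOfCoord b (leftInvariantField b i u) = leftField (letter N i) (lieOfCoord b u) := by
  rw [leftInvariantField_eq, lieOfCoord_coordExt]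
  exact leftField_mem_lieSub (letter_mem i) (lieOfCoord_mem b u)

theorem lieOfCoord_apply (u : Fin n → ℝ) (w : Word d N) :
    lieOfCoord b u w = ∑ j, u j * (b j : TruncTensor d N) w := by
  have : lieOfCoord b u = ∑ j, u j • (b j : TruncTensor d N) := by
    rw [lieOfCoord, Module.Basis.equivFun_symm_apply]
    push_cast
    rfl
  rw [this, TruncTensor.sum_apply]
  rfl

variable {h : I → EuclideanSpace ℝ (Fin d)}

theorem SolvesEquation.solvesLogEquation {U : I → Fin n → ℝ} (hU : SolvesEquation b h U) :
    SolvesLogEquation h fun t => lieOfCoord b (U t) := by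
  intro t
  choose J hJ e using fun j => hU t j
  refine ⟨fun i => lieOfCoord b fun j => J j i, fun i w => ?_, ?_⟩
  · simp only [← lieOfCoord_leftInvariantField, lieOfCoord_apply]
    refine HasYoungIntegral.sum _ fun j _ => ?_
    simp only [mul_comm _ ((b j : TruncTensor d N) w)]
    exact (hJ j i).const_mul _
  · funext w
    simp only [lieOfCoord_apply, TruncTensor.sum_apply, e]
    rw [Finset.sum_comm]
    simp only [Finset.sum_mul]

/-- Coordinates lose nothing here because the solution takes values in the Lie algebra. -/
theorem SolvesLogEquation.solvesEquation {Z : I → TruncTensor d N} (hZ : SolvesLogEquation h Z)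
    (h1 : ∀ s, Z s ∈ filt d N 1) : SolvesEquation b h fun t => coordExt b (Z t) := by
  intro t j
  obtain ⟨J, hJ, e⟩ := hZ t
  let l : TruncTensor d N →ₗ[ℝ] ℝ := LinearMap.proj j ∘ₗ (coordExt b).toLinearMap
  refine ⟨fun i => l (J i), fun i => ?_, ?_⟩
  · simp only [leftInvariantField_eq, lieOfCoord_coordExt b (hZ.mem_lieSub h1 _)]
    exact HasYoungIntegral.linear (hJ i) l
  · change l (Z t) = _
    rw [e, map_sum]

theorem SolvesEquation.unique {U U' : I → Fin n → ℝ} (hU : SolvesEquation b h U)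
    (hU' : SolvesEquation b h U') : U = U' := by
  have := hU.solvesLogEquation.unique hU'.solvesLogEquation
    (fun s => lieOfCoord_mem_filt b _) (fun s => lieOfCoord_mem_filt b _)
  funext t
  rw [← coordExt_lieOfCoord b (U t), ← coordExt_lieOfCoord b (U' t)]
  exact congrArg _ (congrFun this t)

end Coordinates

/-! ### Signature and Itô–Lyons map of Cameron–Martin paths. -/

section CameronMartin

variable (H : Set.Ioo (0 : ℝ) 1) {d : ℕ} (N : ℕ) (h : CameronMartin H d)

theorem signature_eq_cameronMartin (t : I) : signature N h t =
    YoungPath.sig (fbmExponent_pos H) N (componentsCLM H d h) t :=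
  YoungPath.signature_eq_sig _ _ (fun i t => componentsCLM_apply H i h t) t

theorem signature_sub_one_mem (t : I) : signature N h t - 1 ∈ filt d N 1 := by
  rw [signature_eq_cameronMartin]
  exact YoungPath.sig_sub_one_mem _ _ t

theorem solvesLogEquation_signature : SolvesLogEquation h fun t => tlog (signature N h t) := by
  simp only [signature_eq_cameronMartin]
  exact YoungPath.solvesLogEquation _ _ (fun i t => componentsCLM_apply H i h t)

theorem tlog_signature_mem (t : I) : tlog (signature N h t) ∈ freeNilpotentLie d N :=
  (solvesLogEquation_signature H N h).mem_lieSub (fun s => tlog_mem (signature_sub_one_mem H N h s)) t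

theorem signature_mem_carnotGroup (t : I) : signature N h t ∈ carnotGroup d N :=
  ⟨_, tlog_signature_mem H N h t, texp_tlog (signature_sub_one_mem H N h t)⟩

variable {N} {n : ℕ} (b : Module.Basis (Fin n) ℝ (freeNilpotentLie d N))

theorem solvesEquation_signature :
    SolvesEquation b h fun t => coordExt b (tlog (signature N h t)) :=
  (solvesLogEquation_signature H N h).solvesEquation b
    (fun s => tlog_mem (signature_sub_one_mem H N h s))

theorem itoLyons_eq (t : I) : itoLyons b h t = coordExt b (tlog (signature N h t)) := by
  have hex : ∃ U, SolvesEquation b h U := ⟨_, solvesEquation_signature H h b⟩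
  rw [itoLyons, dif_pos hex]
  exact congrFun (hex.choose_spec.unique b (solvesEquation_signature H h b)) t

theorem logCoord_signature (t : I) :
    logCoord b (signature N h t) = coordExt b (tlog (signature N h t)) :=
  logCoord_eq b (signature_sub_one_mem H N h t) (tlog_signature_mem H N h t)

theorem expCoord_itoLyons (t : I) : expCoord b (itoLyons b h t) = signature N h t := by
  rw [itoLyons_eq, expCoord_eq, lieOfCoord_coordExt b (tlog_signature_mem H N h t),
    texp_tlog (signature_sub_one_mem H N h t)]

theorem contDiff_itoLyons (t : I) : ContDiff ℝ ∞ fun h : CameronMartin H d => itoLyons b h t := by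
  simp only [itoLyons_eq]
  exact (coordExt b).contDiff.comp (contDiff_tlog.comp (contDiff_signature H d N t))

end CameronMartin

/-! ### Smooth paths belong to the Cameron--Martin space -/

-- A cut-off makes the function Schwartz without changing it on the interval, so Fourier inversion
-- applies. The argument is scaled by `2π` to clear the exponent.
open scoped FourierTransform SchwartzMap in
theorem exists_schwartz_spectral {φ : ℝ → ℝ} (hφ : ContDiff ℝ ∞ φ) :
    ∃ g : 𝓢(ℝ, ℂ), ∀ t ∈ Set.Icc (0 : ℝ) 1,
      (φ t : ℂ) = ∫ ξ : ℝ, Complex.exp ((ξ * t : ℝ) * Complex.I) * g ξ := by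
  let χ : ContDiffBump (0 : ℝ) := ⟨1, 2, one_pos, one_lt_two⟩
  let f : ℝ → ℂ := fun s => ((χ s * φ (2 * Real.pi * s) : ℝ) : ℂ)
  have hf : ContDiff ℝ ∞ f := by
    refine Complex.ofRealCLM.contDiff.comp ?_
    exact χ.contDiff.mul (hφ.comp (contDiff_const.mul contDiff_id))
  have hs : HasCompactSupport f := by
    refine HasCompactSupport.intro' (K := Metric.closedBall 0 2) (isCompact_closedBall 0 2)
      Metric.isClosed_closedBall fun s hs => ?_
    have : χ s = 0 := χ.zero_of_le_dist (by
      rw [Metric.mem_closedBall, not_le] at hs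
      exact hs.le)
    simp [f, this]
  let F : 𝓢(ℝ, ℂ) := hs.toSchwartzMap hf
  refine ⟨𝓕 F, fun t ht => ?_⟩
  have hpi := Real.pi_gt_three
  have h1 : F (t / (2 * Real.pi)) = (φ t : ℂ) := by
    have hχ : χ (t / (2 * Real.pi)) = 1 := χ.one_of_mem_closedBall (by
      rw [mem_closedBall_zero_iff, Real.norm_eq_abs, abs_of_nonneg (by
        have := ht.1; positivity)]
      rw [div_le_iff₀ (by positivity)]
      simp only [χ]
      linarith [ht.2])
    change ((χ (t / (2 * Real.pi)) * φ (2 * Real.pi * (t / (2 * Real.pi))) : ℝ) : ℂ) = _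
    rw [hχ, one_mul, mul_div_cancel₀ t (by positivity)]
  have h2 : 𝓕⁻ (𝓕 F) = F := FourierTransform.fourierInv_fourier_eq F
  rw [← h1]
  conv_lhs => rw [← h2, SchwartzMap.fourierInv_coe, Real.fourierInv_eq']
  refine integral_congr_ae (Filter.Eventually.of_forall fun ξ => ?_)
  simp only [smul_eq_mul]
  congr 3
  have : (2 * Real.pi) * ⟪ξ, t / (2 * Real.pi)⟫_ℝ = ξ * t := by
    rw [real_inner_eq_re_inner, RCLike.inner_apply]
    simp
    field_simp
  rw [this]

theorem rpow_le_one_add_cube {r p : ℝ} (hr : 0 < r) (hp0 : 0 ≤ p) (hp : p ≤ 3) :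
    r ^ p ≤ 1 + r ^ 3 := by
  rcases le_total r 1 with h | h
  · have := Real.rpow_le_one hr.le h hp0
    have : 0 ≤ r ^ 3 := by positivity
    linarith
  · have := Real.rpow_le_rpow_of_exponent_le h hp
    rw [show (3 : ℝ) = ((3 : ℕ) : ℝ) by norm_num, Real.rpow_natCast] at this
    linarith

-- As `φ 0 = 0`, `φ t` is the integral of `(exp(iξt) - 1) g(ξ)`. Its real part folded onto the half
-- line involves the functions `1 - cos` and `sin` that also represent the covariance; the decay of
-- `g` absorbs the weight.
open scoped SchwartzMap in
theorem exists_spectral_density (H : Set.Ioo (0 : ℝ) 1) {φ : ℝ → ℝ} (hφ : ContDiff ℝ ∞ φ)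
    (h0 : φ 0 = 0) : ∃ a b : ℝ → ℝ,
      IntegrableOn (fun r => (a r ^ 2 + b r ^ 2) * r ^ (1 + 2 * (H : ℝ))) (Set.Ioi 0) ∧
      ∀ t ∈ Set.Icc (0 : ℝ) 1,
        IntegrableOn (fun r => (1 - Real.cos (t * r)) * a r + Real.sin (t * r) * b r) (Set.Ioi 0) ∧
        φ t = ∫ r in Set.Ioi (0 : ℝ), ((1 - Real.cos (t * r)) * a r + Real.sin (t * r) * b r) := by
  obtain ⟨g, hg⟩ := exists_schwartz_spectral hφ
  have hgc := g.continuous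
  have hgi : Integrable g := g.integrable
  set a : ℝ → ℝ := fun r => -((g r).re + (g (-r)).re) with ha
  set b : ℝ → ℝ := fun r => (g (-r)).im - (g r).im with hb
  have hac : Continuous a := by fun_prop
  have hbc : Continuous b := by fun_prop
  refine ⟨a, b, ?_, fun t ht => ?_⟩
  · obtain ⟨C, hC0, hC⟩ := g.decay 0 0
    have hC' : ∀ r, ‖g r‖ ≤ C := fun r => by simpa using hC r
    have hint : Integrable fun r => ‖g r‖ + |r| ^ 3 * ‖g r‖ := by
      have := g.integrable_pow_mul volume 3
      simp only [Real.norm_eq_abs] at this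
      exact hgi.norm.add this
    have hint' : Integrable fun r => ‖g (-r)‖ + |r| ^ 3 * ‖g (-r)‖ := by
      simpa using hint.comp_neg
    have hdom : IntegrableOn (fun r => 4 * C * ((‖g r‖ + |r| ^ 3 * ‖g r‖) +
        (‖g (-r)‖ + |r| ^ 3 * ‖g (-r)‖))) (Set.Ioi 0) :=
      ((hint.add hint').const_mul _).integrableOn
    refine Integrable.mono' hdom ?_ ?_
    · refine AEStronglyMeasurable.mul (by fun_prop) ?_
      exact (Measurable.pow_const measurable_id _).aestronglyMeasurable
    · filter_upwards [ae_restrict_mem measurableSet_Ioi] with r hr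
      have hr0 : 0 < r := hr
      have hp := rpow_le_one_add_cube (p := 1 + 2 * (H : ℝ)) hr0 (by have := H.2.1; linarith)
        (by have := H.2.2; linarith)
      have hp0 : 0 ≤ r ^ (1 + 2 * (H : ℝ)) := Real.rpow_nonneg hr0.le _
      have e1 : |a r| ≤ ‖g r‖ + ‖g (-r)‖ := by
        rw [ha]
        simp only [abs_neg]
        exact (abs_add_le _ _).trans (add_le_add (Complex.abs_re_le_norm _)
          (Complex.abs_re_le_norm _))
      have e2 : |b r| ≤ ‖g r‖ + ‖g (-r)‖ := by
        rw [hb]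
        refine (abs_sub _ _).trans ?_
        linarith [Complex.abs_im_le_norm (g r), Complex.abs_im_le_norm (g (-r))]
      set n := ‖g r‖ + ‖g (-r)‖ with hn
      have hn0 : 0 ≤ n := by positivity
      have hn2 : n ≤ 2 * C := by linarith [hC' r, hC' (-r)]
      have e3 : a r ^ 2 + b r ^ 2 ≤ 4 * C * n := by
        have h1 : a r ^ 2 ≤ n ^ 2 := by rw [← sq_abs]; gcongr
        have h2 : b r ^ 2 ≤ n ^ 2 := by rw [← sq_abs]; gcongr
        nlinarith
      rw [Real.norm_of_nonneg (by positivity), abs_of_pos hr0]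
      calc _ ≤ (4 * C * n) * (1 + r ^ 3) := by gcongr
        _ = _ := by rw [hn]; ring
  · set F : ℝ → ℝ := fun ξ => (Complex.exp ((ξ * t : ℝ) * Complex.I) * g ξ - g ξ).re with hF
    have hFe : ∀ ξ, F ξ = -((1 - Real.cos (t * ξ)) * (g ξ).re + Real.sin (t * ξ) * (g ξ).im) := by
      intro ξ
      simp only [hF, Complex.sub_re, Complex.mul_re, Complex.exp_ofReal_mul_I_re,
        Complex.exp_ofReal_mul_I_im]
      rw [mul_comm ξ t]
      ring
    have hi : ∀ t : ℝ, Integrable fun ξ : ℝ => Complex.exp ((ξ * t : ℝ) * Complex.I) * g ξ := by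
      intro t
      refine hgi.bdd_mul (c := 1) (by fun_prop) (Filter.Eventually.of_forall fun ξ => ?_)
      rw [Complex.norm_exp_ofReal_mul_I]
    have hFi : Integrable F := ((hi t).sub hgi).re
    have hφF : φ t = ∫ ξ, F ξ := by
      have e1 := hg t ht
      have e2 := hg 0 (by simp)
      simp only [mul_zero, Complex.ofReal_zero, zero_mul, Complex.exp_zero, one_mul, h0] at e2
      have e3 : ∫ ξ : ℝ, (Complex.exp ((ξ * t : ℝ) * Complex.I) * g ξ - g ξ) = (φ t : ℂ) := by
        rw [integral_sub (hi t) hgi, ← e1, ← e2, sub_zero]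
      have e4 := congrArg Complex.re e3
      rw [Complex.ofReal_re] at e4
      rw [← e4, hF]
      exact (integral_re (𝕜 := ℂ) ((hi t).sub hgi)).symm
    have hsum : ∀ r, (1 - Real.cos (t * r)) * a r + Real.sin (t * r) * b r = F r + F (-r) := by
      intro r
      have hneg : t * -r = -(t * r) := by ring
      rw [hFe, hFe, hneg, Real.cos_neg, Real.sin_neg]
      simp only [ha, hb]
      ring
    simp only [hsum]
    refine ⟨(hFi.add hFi.comp_neg).integrableOn, ?_⟩
    rw [hφF, integral_add hFi.integrableOn hFi.comp_neg.integrableOn, integral_comp_neg_Ioi,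
      neg_zero, add_comm, ← setIntegral_union (Set.Iic_disjoint_Ioi le_rfl) measurableSet_Ioi
      hFi.integrableOn hFi.integrableOn, Set.Iic_union_Ioi, setIntegral_univ]

/-- Optimize the scaling: `s = 1 / q`, or a large `s` if `q = 0`. A bound by a sum of squares thus
becomes a linear bound. -/
theorem abs_le_two_mul_of_homogeneous_bound {l q C : ℝ}
    (hq : 0 ≤ q) (h : ∀ s > 0, s * |l| ≤ C * (1 + s ^ 2 * q ^ 2)) : |l| ≤ 2 * C * q := by
  rcases hq.eq_or_lt with rfl | hq
  · by_contra hl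
    simp only [mul_zero, not_le] at hl
    have := h ((|C| + 1) / |l|) (by positivity)
    rw [div_mul_cancel₀ _ hl.ne'] at this
    simp only [ne_eq, OfNat.ofNat_ne_zero, not_false_eq_true, zero_pow, mul_zero, add_zero,
      mul_one] at this
    linarith [le_abs_self C]
  · have := h q⁻¹ (inv_pos.2 hq)
    rw [← mul_pow, inv_mul_cancel₀ hq.ne', inv_mul_le_iff₀ hq] at this
    linarith

section

variable (H : Set.Ioo (0 : ℝ) 1) (d : ℕ)

/-- Finite combinations of kernel functions. -/
noncomputable def kerSum : (I →₀ EuclideanSpace ℝ (Fin d)) →ₗ[ℝ] CameronMartin H d :=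
  Finsupp.lsum ℝ fun x => (RKHS.kerFun (CameronMartin H d) x).toLinearMap

variable {d}

theorem kerSum_apply (v : I →₀ EuclideanSpace ℝ (Fin d)) :
    kerSum H d v = ∑ x ∈ v.support, RKHS.kerFun (CameronMartin H d) x (v x) := rfl

theorem kerSum_single (x : I) (w : EuclideanSpace ℝ (Fin d)) :
    kerSum H d (Finsupp.single x w) = RKHS.kerFun (CameronMartin H d) x w := by
  simp [kerSum]

theorem denseRange_kerSum : DenseRange (kerSum H d) := by
  have h := RKHS.kerFun_dense (CameronMartin H d)
  have hle : Submodule.span ℝ {y | ∃ (x : I) (v : EuclideanSpace ℝ (Fin d)), RKHS.kerFun (CameronMartin H d) x v = y} ≤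
      LinearMap.range (kerSum H d) := by
    rw [Submodule.span_le]
    rintro _ ⟨x, v, rfl⟩
    exact ⟨Finsupp.single x v, kerSum_single H x v⟩
  have h2 := Submodule.topologicalClosure_mono hle
  rw [h, top_le_iff] at h2
  intro y
  have : y ∈ (LinearMap.range (kerSum H d)).topologicalClosure := by rw [h2]; trivial
  rwa [← SetLike.mem_coe, Submodule.topologicalClosure_coe, LinearMap.coe_range] at this

/-- The spectral representation of the norm of a combination of kernel functions. -/
theorem norm_kerSum_sq (v : I →₀ EuclideanSpace ℝ (Fin d)) :
    IntegrableOn (fun r : ℝ => (‖∑ x ∈ v.support, (1 - Real.cos (x * r)) • v x‖ ^ 2 +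
      ‖∑ x ∈ v.support, Real.sin (x * r) • v x‖ ^ 2) * r ^ (-1 - 2 * (H : ℝ))) (Set.Ioi 0) ∧
    ∫ r in Set.Ioi (0 : ℝ), (‖∑ x ∈ v.support, (1 - Real.cos (x * r)) • v x‖ ^ 2 +
      ‖∑ x ∈ v.support, Real.sin (x * r) • v x‖ ^ 2) * r ^ (-1 - 2 * (H : ℝ)) =
      2 * fbmConst H * ‖kerSum H d v‖ ^ 2 := by
  have e1 : (fun r : ℝ => (‖∑ x ∈ v.support, (1 - Real.cos (x * r)) • v x‖ ^ 2 +
      ‖∑ x ∈ v.support, Real.sin (x * r) • v x‖ ^ 2) * r ^ (-1 - 2 * (H : ℝ))) = fun r : ℝ =>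
      ∑ x ∈ v.support, ∑ x' ∈ v.support, ⟪v x, v x'⟫_ℝ *
        (((1 - Real.cos (x * r)) * (1 - Real.cos (x' * r)) +
          Real.sin (x * r) * Real.sin (x' * r)) * r ^ (-1 - 2 * (H : ℝ))) := by
    funext r
    simp only [← real_inner_self_eq_norm_sq, sum_inner, inner_sum, real_inner_smul_left,
      real_inner_smul_right, ← Finset.sum_add_distrib, Finset.sum_mul]
    rw [Finset.sum_comm]
    refine Finset.sum_congr rfl fun x _ => Finset.sum_congr rfl fun x' _ => ?_
    rw [real_inner_comm]
    ring
  have hi : ∀ x x' : I, IntegrableOn (fun r : ℝ => ⟪v x, v x'⟫_ℝ *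
      (((1 - Real.cos (x * r)) * (1 - Real.cos (x' * r)) +
        Real.sin (x * r) * Real.sin (x' * r)) * r ^ (-1 - 2 * (H : ℝ)))) (Set.Ioi 0) :=
    fun x x' => (fbm_cov_spectral H x.2.1 x'.2.1).1.const_mul _
  rw [e1]
  refine ⟨integrable_finsetSum _ fun x _ => integrable_finsetSum _ fun x' _ => hi x x', ?_⟩
  rw [integral_finsetSum _ fun x _ => integrable_finsetSum _ fun x' _ => hi x x', kerSum_apply,
    ← real_inner_self_eq_norm_sq, sum_inner, Finset.mul_sum]
  refine Finset.sum_congr rfl fun x _ => ?_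
  rw [integral_finsetSum _ fun x' _ => hi x x', inner_sum, Finset.mul_sum]
  refine Finset.sum_congr rfl fun x' _ => ?_
  rw [integral_const_mul, (fbm_cov_spectral H x.2.1 x'.2.1).2, inner_kerFun_kerFun]
  ring

/-- Riesz representation of the functional that the path should induce on kernel combinations. In
spectral form it pairs `a`, `b`, square integrable with weight `r^(1+2H)`, with functions square
integrable with the inverse weight, whose norm is that of the combination. -/
theorem exists_cameronMartin_of_contDiff {φ : ℝ → ℝ} (hφ : ContDiff ℝ ∞ φ) (h0 : φ 0 = 0) (v : EuclideanSpace ℝ (Fin d)) :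
    ∃ h : CameronMartin H d, ∀ t : I, h t = φ t • v := by
  obtain ⟨a, b, hab, hφt⟩ := exists_spectral_density H hφ h0
  set M := ∫ r in Set.Ioi (0 : ℝ), (a r ^ 2 + b r ^ 2) * r ^ (1 + 2 * (H : ℝ)) with hM
  have hM0 : 0 ≤ M := setIntegral_nonneg measurableSet_Ioi fun r hr =>
    mul_nonneg (by positivity) (Real.rpow_nonneg (le_of_lt hr) _)
  have hc := fbmConst_pos H
  let l : (I →₀ EuclideanSpace ℝ (Fin d)) →ₗ[ℝ] ℝ := Finsupp.lsum ℝ fun x : I => φ x • (innerSL ℝ v).toLinearMap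
  have hl : ∀ u, l u = ∑ x ∈ u.support, φ x * ⟪v, u x⟫_ℝ := fun u => rfl
  set C := ‖v‖ * (M + 2 * fbmConst H) with hC
  have hbound1 : ∀ u, |l u| ≤ C * (1 + ‖kerSum H d u‖ ^ 2) := by
    intro u
    obtain ⟨i1, i2⟩ := norm_kerSum_sq H u
    set A : ℝ → EuclideanSpace ℝ (Fin d) := fun r => ∑ x ∈ u.support, (1 - Real.cos (x * r)) • u x with hA
    set B : ℝ → EuclideanSpace ℝ (Fin d) := fun r => ∑ x ∈ u.support, Real.sin (x * r) • u x with hB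
    have e1 : l u = ∫ r in Set.Ioi (0 : ℝ), (⟪v, A r⟫_ℝ * a r + ⟪v, B r⟫_ℝ * b r) := by
      have e2 : ∀ r, ⟪v, A r⟫_ℝ * a r + ⟪v, B r⟫_ℝ * b r = ∑ x ∈ u.support,  ⟪v, u x⟫_ℝ *
          ((1 - Real.cos (x * r)) * a r + Real.sin (x * r) * b r) := by
        intro r
        simp only [hA, hB, inner_sum, real_inner_smul_right, Finset.sum_mul,
          ← Finset.sum_add_distrib]
        exact Finset.sum_congr rfl fun x _ => by ring
      simp only [e2]
      rw [hl, integral_finsetSum _ fun (x : I) _ => (hφt x x.2).1.const_mul _]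
      refine Finset.sum_congr rfl fun (x : I) _ => ?_
      rw [integral_const_mul, ← (hφt x x.2).2, mul_comm]
    have hdom := (hab.add i1).const_mul ‖v‖
    have hle : ∀ r ∈ Set.Ioi (0 : ℝ), ‖⟪v, A r⟫_ℝ * a r + ⟪v, B r⟫_ℝ * b r‖ ≤
        ‖v‖ * ((a r ^ 2 + b r ^ 2) * r ^ (1 + 2 * (H : ℝ)) +
          (‖A r‖ ^ 2 + ‖B r‖ ^ 2) * r ^ (-1 - 2 * (H : ℝ))) := by
      intro r hr
      have hr0 : 0 < r := hr
      set p := r ^ (1 + 2 * (H : ℝ)) with hp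
      set q := r ^ (-1 - 2 * (H : ℝ)) with hq
      have hp0 : 0 < p := Real.rpow_pos_of_pos hr0 _
      have hq0 : 0 < q := Real.rpow_pos_of_pos hr0 _
      have hpq : p * q = 1 := by
        rw [hp, hq, ← Real.rpow_add hr0]
        norm_num
      have amgm : ∀ y z : ℝ, |y| * |z| ≤ z ^ 2 * p + y ^ 2 * q := by
        intro y z
        have h1 : (√p * √q) = 1 := by rw [← Real.sqrt_mul hp0.le, hpq, Real.sqrt_one]
        have h2 := two_mul_le_add_sq (|z| * √p) (|y| * √q)
        rw [mul_pow, mul_pow, sq_abs, sq_abs, Real.sq_sqrt hp0.le, Real.sq_sqrt hq0.le] at h2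
        have h3 : 2 * (|z| * √p) * (|y| * √q) = 2 * (|y| * |z|) * (√p * √q) := by ring
        rw [h3, h1] at h2
        have : 0 ≤ |y| * |z| := by positivity
        linarith
      have b1 := abs_real_inner_le_norm v (A r)
      have b2 := abs_real_inner_le_norm v (B r)
      have c1 := amgm ‖A r‖ (a r)
      have c2 := amgm ‖B r‖ (b r)
      rw [abs_of_nonneg (norm_nonneg _)] at c1 c2
      calc _ ≤ |⟪v, A r⟫_ℝ| * |a r| + |⟪v, B r⟫_ℝ| * |b r| := by
            rw [Real.norm_eq_abs, ← abs_mul, ← abs_mul]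
            exact abs_add_le _ _
        _ ≤ (‖v‖ * ‖A r‖) * |a r| + (‖v‖ * ‖B r‖) * |b r| := by gcongr
        _ = ‖v‖ * (‖A r‖ * |a r| + ‖B r‖ * |b r|) := by ring
        _ ≤ ‖v‖ * ((a r ^ 2 * p + ‖A r‖ ^ 2 * q) + (b r ^ 2 * p + ‖B r‖ ^ 2 * q)) := by gcongr
        _ = _ := by ring
    rw [e1, ← Real.norm_eq_abs]
    refine (norm_integral_le_of_norm_le hdom ((ae_restrict_iff' measurableSet_Ioi).2
      (Filter.Eventually.of_forall hle))).trans ?_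
    simp only [Pi.add_apply]
    rw [integral_const_mul, integral_add hab i1, i2, ← hM, hC, mul_assoc ‖v‖ (M + _)]
    refine mul_le_mul_of_nonneg_left ?_ (norm_nonneg v)
    nlinarith [sq_nonneg ‖kerSum H d u‖, mul_nonneg hM0 (sq_nonneg ‖kerSum H d u‖)]
  have hbound : ∀ u, ‖l u‖ ≤ 2 * C * ‖kerSum H d u‖ := fun u =>
    abs_le_two_mul_of_homogeneous_bound (norm_nonneg _) fun s hs => by
      have := hbound1 (s • u)
      rwa [map_smul, map_smul, smul_eq_mul, abs_mul, abs_of_pos hs, norm_smul,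
        Real.norm_of_nonneg hs.le, mul_pow] at this
  have hdense := denseRange_kerSum H (d := d)
  -- The bound also makes the functional well defined on the range of `kerSum`, so `kerSum` need not
  -- be injective.
  refine ⟨(InnerProductSpace.toDual ℝ (CameronMartin H d)).symm
    (LinearMap.extendOfNorm l (kerSum H d)), fun t => ?_⟩
  refine ext_inner_right ℝ fun w => ?_
  rw [← RKHS.inner_kerFun, InnerProductSpace.toDual_symm_apply, ← kerSum_single,
    LinearMap.extendOfNorm_eq hdense ⟨_, hbound⟩, real_inner_smul_left]
  simp [l]

end

/-! ### Loops of exponentials whose directions span the Lie algebra -/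

namespace TruncTensor

variable {d N : ℕ}

/-- The product of the exponentials `exp (τ e_i)` over a list of steps `(i, τ)`. -/
noncomputable def stepProd (N : ℕ) (L : List (Fin d × ℝ)) : TruncTensor d N :=
  (L.map fun p => texp (p.2 • letter N p.1)).prod

/-- The steps that lead back. -/
def revSteps (L : List (Fin d × ℝ)) : List (Fin d × ℝ) := (L.map fun p => (p.1, -p.2)).reverse

/-- Conjugation by the product of a list of steps. -/
noncomputable def stepConj (L : List (Fin d × ℝ)) (x : TruncTensor d N) : TruncTensor d N :=
  stepProd N L * x * stepProd N (revSteps L)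

/-- The directions in which the product of a loop moves when a step is prolonged. -/
def IsStepDir (L : List (Fin d × ℝ)) (x : TruncTensor d N) : Prop :=
  ∃ L₁ i τ L₂, L = L₁ ++ (i, τ) :: L₂ ∧ x = stepConj L₁ (letter N i)

@[simp] theorem stepProd_nil : stepProd N ([] : List (Fin d × ℝ)) = 1 := rfl

theorem stepProd_cons (p : Fin d × ℝ) (L : List (Fin d × ℝ)) :
    stepProd N (p :: L) = texp (p.2 • letter N p.1) * stepProd N L := by
  simp [stepProd]

theorem stepProd_append (L L' : List (Fin d × ℝ)) :
    stepProd N (L ++ L') = stepProd N L * stepProd N L' := by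
  simp [stepProd]

theorem revSteps_append (L L' : List (Fin d × ℝ)) :
    revSteps (L ++ L') = revSteps L' ++ revSteps L := by
  simp [revSteps]

theorem stepProd_revSteps_mul (L : List (Fin d × ℝ)) :
    stepProd N L * stepProd N (revSteps L) = 1 := by
  induction L with
  | nil => simp [revSteps]
  | cons p L ih =>
    have e : revSteps (p :: L) = revSteps L ++ [(p.1, -p.2)] := by simp [revSteps]
    rw [e, stepProd_append, stepProd_cons, stepProd_cons, stepProd_nil, mul_one, mul_assoc,
      ← mul_assoc (stepProd N L), ih, one_mul, neg_smul]
    exact texp_mul_texp_neg ((filt d N 1).smul_mem _ (letter_mem_filt _))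

theorem revSteps_revSteps (L : List (Fin d × ℝ)) : revSteps (revSteps L) = L := by
  simp [revSteps, Function.comp_def]

theorem revSteps_mul_stepProd (L : List (Fin d × ℝ)) :
    stepProd N (revSteps L) * stepProd N L = 1 := by
  simpa only [revSteps_revSteps] using stepProd_revSteps_mul (N := N) (revSteps L)

theorem stepConj_append (L L' : List (Fin d × ℝ)) (x : TruncTensor d N) :
    stepConj (L ++ L') x = stepConj L (stepConj L' x) := by
  simp only [stepConj, stepProd_append, revSteps_append, mul_assoc]

theorem stepConj_of_loop {L : List (Fin d × ℝ)} (hL : stepProd N L = 1) (x : TruncTensor d N) :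
    stepConj L x = x := by
  have h := stepProd_revSteps_mul (N := N) L
  rw [hL, one_mul] at h
  rw [stepConj, hL, h, one_mul, mul_one]

theorem IsStepDir.append_right {L : List (Fin d × ℝ)} {x : TruncTensor d N} (h : IsStepDir L x)
    (L' : List (Fin d × ℝ)) : IsStepDir (L ++ L') x := by
  obtain ⟨L₁, i, τ, L₂, rfl, rfl⟩ := h
  exact ⟨L₁, i, τ, L₂ ++ L', by simp, rfl⟩

theorem IsStepDir.append_left {L L' : List (Fin d × ℝ)} (hL : stepProd N L = 1)
    {x : TruncTensor d N} (h : IsStepDir L' x) : IsStepDir (L ++ L') x := by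
  obtain ⟨L₁, i, τ, L₂, rfl, rfl⟩ := h
  refine ⟨L ++ L₁, i, τ, L₂, by simp, ?_⟩
  rw [stepConj_append, stepConj_of_loop hL]

variable (d N) in
/-- The span of all conjugates of the letters. -/
noncomputable def conjSpan : Submodule ℝ (TruncTensor d N) :=
  Submodule.span ℝ {x | ∃ L i, x = stepConj L (letter N i)}

/-- Take a loop whose directions span a maximal subspace. Append a detour that follows `L'`, makes a
step of length zero along `e_i` and returns: the result is again a loop, with the additional
direction `stepConj L' e_i`. By maximality this direction was already in the span. -/
theorem exists_loop_conjSpan_le :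
    ∃ L : List (Fin d × ℝ), stepProd N L = 1 ∧ conjSpan d N ≤ Submodule.span ℝ {x | IsStepDir L x} := by
  let s : Set (Submodule ℝ (TruncTensor d N)) :=
    {W | ∃ L : List (Fin d × ℝ), stepProd N L = 1 ∧ W = Submodule.span ℝ {x | IsStepDir L x}}
  obtain ⟨W, ⟨L, hL, rfl⟩, hmax⟩ := (wellFounded_gt (α := Submodule ℝ (TruncTensor d N))).has_min s
    ⟨_, [], rfl, rfl⟩
  refine ⟨L, hL, Submodule.span_le.2 ?_⟩
  rintro _ ⟨L', i, rfl⟩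
  have hloop : stepProd N (L' ++ (i, 0) :: revSteps L') = 1 := by
    rw [stepProd_append, stepProd_cons, zero_smul, texp_zero, one_mul, stepProd_revSteps_mul]
  have hle : Submodule.span ℝ {x : TruncTensor d N | IsStepDir L x} ≤
      Submodule.span ℝ {x | IsStepDir (L ++ (L' ++ (i, 0) :: revSteps L')) x} :=
    Submodule.span_mono fun x hx => IsStepDir.append_right hx _
  have hnot := hmax _ ⟨L ++ (L' ++ (i, 0) :: revSteps L'), by
    rw [stepProd_append, hL, hloop, one_mul], rfl⟩
  have heq := hle.eq_of_not_lt hnot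
  rw [heq]
  exact Submodule.subset_span (IsStepDir.append_left hL ⟨L', i, 0, revSteps L', rfl, rfl⟩)

theorem letter_mem_conjSpan (i : Fin d) : letter N i ∈ conjSpan d N :=
  Submodule.subset_span ⟨[], i, by simp [stepConj, revSteps]⟩

theorem stepConj_mem_conjSpan (L : List (Fin d × ℝ)) {x : TruncTensor d N}
    (hx : x ∈ conjSpan d N) : stepConj L x ∈ conjSpan d N := by
  induction hx using Submodule.span_induction with
  | mem x h =>
    obtain ⟨L', i, rfl⟩ := h
    exact Submodule.subset_span ⟨L ++ L', i, (stepConj_append _ _ _).symm⟩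
  | zero => simp [stepConj]
  | add x y _ _ hx hy =>
    have : stepConj L (x + y) = stepConj L x + stepConj L y := by
      simp only [stepConj, mul_add, add_mul]
    rw [this]
    exact add_mem hx hy
  | smul r x _ hx =>
    have : stepConj L (r • x) = r • stepConj L x := by
      simp only [stepConj, mul_smul_comm, smul_mul_assoc]
    rw [this]
    exact Submodule.smul_mem _ r hx

/-- The bracket is the derivative at `0` of `exp(s e_i) x exp(-s e_i)`, a curve in the subspace. -/
theorem letter_lie_mem_conjSpan (i : Fin d) {x : TruncTensor d N} (hx : x ∈ conjSpan d N) :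
    ⁅letter N i, x⁆ ∈ conjSpan d N := by
  have hl := letter_mem_filt (N := N) i
  have h := hasDerivAt_mul (hasDerivAt_mul (hasDerivAt_texp_smul hl 0) (hasDerivAt_const 0 x))
    (hasDerivAt_texp_smul (neg_mem hl) 0)
  refine (conjSpan d N).hasDerivAt_mem (h.congr_deriv ?_) fun s => ?_
  · simp only [zero_smul, texp_zero, lie_def]
    noncomm_ring
  · have := stepConj_mem_conjSpan [(i, s)] hx
    simpa [stepConj, revSteps, stepProd_cons] using this

/-- Elements of `conjSpan` whose bracket preserves `conjSpan` form a Lie subalgebra, by the Jacobi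
identity, and the letters are among them. -/
theorem freeNilpotentLie_le_conjSpan {z : TruncTensor d N} (hz : z ∈ freeNilpotentLie d N) :
    z ∈ conjSpan d N := by
  have key : z ∈ conjSpan d N ∧ ∀ x ∈ conjSpan d N, ⁅z, x⁆ ∈ conjSpan d N := by
    induction hz using LieSubalgebra.lieSpan_induction with
    | mem x h =>
      obtain ⟨i, rfl⟩ := h
      exact ⟨letter_mem_conjSpan i, fun x hx => letter_lie_mem_conjSpan i hx⟩
    | zero => exact ⟨zero_mem _, fun x _ => by rw [zero_lie]; exact zero_mem _⟩
    | add x y _ _ hx hy =>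
      exact ⟨add_mem hx.1 hy.1, fun z hz => by
        rw [add_lie]; exact add_mem (hx.2 z hz) (hy.2 z hz)⟩
    | smul r x _ hx =>
      exact ⟨Submodule.smul_mem _ r hx.1, fun z hz => by
        rw [smul_lie]; exact Submodule.smul_mem _ r (hx.2 z hz)⟩
    | lie x y _ _ hx hy =>
      exact ⟨hx.2 y hy.1, fun z hz => by
        rw [lie_lie]; exact sub_mem (hx.2 _ (hy.2 z hz)) (hy.2 _ (hx.2 z hz))⟩
  exact key.1

/-- There is a loop of exponentials whose directions span the Lie algebra. -/
theorem exists_loop_lieSub_le :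
    ∃ L : List (Fin d × ℝ), stepProd N L = 1 ∧
      lieSub d N ≤ Submodule.span ℝ {x | IsStepDir L x} := by
  obtain ⟨L, hL, h⟩ := exists_loop_conjSpan_le (d := d) (N := N)
  exact ⟨L, hL, fun z hz => h (freeNilpotentLie_le_conjSpan hz)⟩

end TruncTensor

/-! ### Signatures of smooth paths -/

namespace TruncTensor

variable {d N : ℕ}

theorem word_nil_or_concat (w : Word d N) :
    w.1 = [] ∨ ∃ (v : Word d N) (j : Fin d), w.1 = v.1 ++ [j] := YoungPath.word_cases w

/-- A solution of `dY = Y ⊗ dx` along a smooth path is its signature. -/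
theorem signature_eq_of_hasDerivAt {h : I → EuclideanSpace ℝ (Fin d)} {x x' : Fin d → ℝ → ℝ}
    (hx : ∀ i t, HasDerivAt (x i) (x' i t) t) (hx' : ∀ i, Continuous (x' i))
    (hh : ∀ i (t : I), h t i = x i t) {Y : ℝ → TruncTensor d N} (hY0 : Y 0 = 1)
    (hY : ∀ t, HasDerivAt Y (∑ i, x' i t • (Y t * letter N i)) t) (t : I) :
    signature N h t = Y t := by
  have hYw : ∀ w t, HasDerivAt (fun s => Y s w) ((∑ i, x' i t • (Y t * letter N i)) w) t :=
    fun w t => hasDerivAt_pi.1 (hY t) w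
  have hnil : ∀ w : Word d N, w.1 = [] → ∀ t, Y t w = 1 := by
    intro w hw t
    have hd : ∀ t, HasDerivAt (fun s => Y s w) 0 t := fun t => (hYw w t).congr_deriv (by
      rw [sum_apply]
      exact Finset.sum_eq_zero fun i _ => by rw [smul_apply, mul_letter_nil _ _ hw, mul_zero])
    have := is_const_of_deriv_eq_zero (fun t => (hd t).differentiableAt) (fun t => (hd t).deriv) t 0
    rw [this, hY0, one_apply, if_pos hw]
  have hconcat : ∀ (w v : Word d N) (j : Fin d), w.1 = v.1 ++ [j] → ∀ t,
      HasDerivAt (fun s => Y s w) (Y t v * x' j t) t := fun w v j hw t =>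
    (hYw w t).congr_deriv (by
      rw [sum_apply]
      simp only [smul_apply, mul_letter_concat _ _ _ hw, mul_ite, mul_zero, Finset.sum_ite_eq',
        mem_univ, if_true]
      exact mul_comm _ _)
  have hYc : Continuous Y := continuous_iff_continuousAt.2 fun t => (hY t).continuousAt
  have hYwc : ∀ w, Continuous fun s => Y s w := fun w =>
    continuous_iff_continuousAt.2 fun t => (hYw w t).continuousAt
  have hlip : ∀ w : Word d N, ∃ K : ℝ, ∀ s t : I, |Y t w - Y s w| ≤ K * |(t : ℝ) - s| := by
    intro w
    rcases word_nil_or_concat w with hw | ⟨v, j, hw⟩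
    · exact ⟨0, fun s t => by simp [hnil w hw]⟩
    · obtain ⟨K, hK⟩ := isCompact_Icc.exists_bound_of_continuousOn (s := Set.Icc (0 : ℝ) 1)
        ((hYwc v).mul (hx' j)).continuousOn
      exact ⟨K, fun s t => (convex_Icc (0 : ℝ) 1).norm_image_sub_le_of_norm_hasDerivWithin_le
        (fun r _ => (hconcat w v j hw r).hasDerivWithinAt) hK s.2 t.2⟩
  -- The coefficients of `Y` indexed by reversed words, as in `iteratedIntegral`; the value zero for
  -- long words is never used.
  let Z : List (Fin d) → I → ℝ := fun w t =>
    if hw : w.length ≤ N then Y t ⟨w.reverse, by simpa using hw⟩ else 0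
  have hZ : ∀ w, w.length ≤ N → iteratedIntegral h w = Z w := by
    refine fun w hw => iteratedIntegral_unique Z (fun t => ?_) (fun i w hw t => ?_) w hw
    · simp only [Z, List.length_nil, Nat.zero_le, dif_pos]
      exact hnil _ rfl t
    · have hw1 : w.length ≤ N := hw.le
      have hw2 : (i :: w).length ≤ N := hw
      obtain ⟨K, hK⟩ := hlip ⟨w.reverse, by simpa using hw1⟩
      obtain ⟨M, hM⟩ := isCompact_Icc.exists_bound_of_continuousOn (s := Set.Icc (0 : ℝ) 1)
        (hx' i).continuousOn
      have e1 : Z w = fun t : I => Y t ⟨w.reverse, by simpa using hw1⟩ :=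
        funext fun t => dif_pos hw1
      have e2 : Z (i :: w) = fun t : I => Y t ⟨(i :: w).reverse, by simpa using hw⟩ :=
        funext fun t => dif_pos hw2
      rw [e1, e2]
      refine HasYoungIntegral.of_hasDerivAt (f' := x i) (x' := x' i)
        (F' := fun t => Y t ⟨(i :: w).reverse, by simpa using hw⟩) hK (fun t => hM t t.2) (hx i)
        (hh i) (fun t => hconcat _ ⟨w.reverse, by simpa using hw1⟩ i List.reverse_cons t) (fun _ => rfl) ?_ t
      rw [Set.Icc.coe_zero, hY0, one_apply, if_neg (by simp)]
  funext w
  rw [signature, hZ _ (by simpa using w.2)]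
  simp only [Z, List.length_reverse, w.2, dif_pos, List.reverse_reverse]

end TruncTensor

/-! ### Smooth paths that move along the coordinate axes one after the other -/

open Real (smoothTransition) in
theorem hasDerivAt_smoothTransition (t : ℝ) :
    HasDerivAt smoothTransition (deriv smoothTransition t) t :=
  ((Real.smoothTransition.contDiff (n := 1)).differentiable (by simp) t).hasDerivAt

open Real (smoothTransition) in
theorem deriv_smoothTransition_of_one_lt {t : ℝ} (ht : 1 < t) : deriv smoothTransition t = 0 := by
  have : smoothTransition =ᶠ[nhds t] fun _ => 1 := by
    filter_upwards [lt_mem_nhds ht] with s hs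
    exact Real.smoothTransition.one_of_one_le hs.le
  rw [this.deriv_eq, deriv_const]

namespace TruncTensor

variable {d N : ℕ}

/-- The `i`-th coordinate of the path that performs the steps of a list one after the other, the
first one during the time interval `[k / c, (k + 1) / c]`. -/
noncomputable def stepPath (c : ℝ) (i : Fin d) : ℕ → List (Fin d × ℝ) → ℝ → ℝ
  | _, [], _ => 0
  | k, p :: L, t => (if p.1 = i then p.2 * Real.smoothTransition (c * t - k) else 0) +
      stepPath c i (k + 1) L t

/-- The derivative of `stepPath`. -/
noncomputable def stepVel (c : ℝ) (i : Fin d) : ℕ → List (Fin d × ℝ) → ℝ → ℝ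
  | _, [], _ => 0
  | k, p :: L, t => (if p.1 = i then p.2 * (deriv Real.smoothTransition (c * t - k) * c) else 0) +
      stepVel c i (k + 1) L t

/-- The signature of the path `stepPath`. -/
noncomputable def stepSig (N : ℕ) (c : ℝ) : ℕ → List (Fin d × ℝ) → ℝ → TruncTensor d N
  | _, [], _ => 1
  | k, p :: L, t => texp ((p.2 * Real.smoothTransition (c * t - k)) • letter N p.1) *
      stepSig N c (k + 1) L t

theorem hasDerivAt_step (c : ℝ) (k : ℕ) (t : ℝ) :
    HasDerivAt (fun t : ℝ => Real.smoothTransition (c * t - k))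
      (deriv Real.smoothTransition (c * t - k) * c) t := by
  have h : HasDerivAt (fun t : ℝ => c * t - k) c t := by
    simpa using ((hasDerivAt_id t).const_mul c).sub_const (k : ℝ)
  exact (hasDerivAt_smoothTransition _).comp t h

theorem hasDerivAt_stepPath (c : ℝ) (i : Fin d) (k : ℕ) (L : List (Fin d × ℝ)) (t : ℝ) :
    HasDerivAt (stepPath c i k L) (stepVel c i k L t) t := by
  induction L generalizing k with
  | nil => exact hasDerivAt_const _ _
  | cons p L ih =>
    refine HasDerivAt.fun_add ?_ (ih (k + 1))
    split_ifs
    · exact (hasDerivAt_step c k t).const_mul _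
    · exact hasDerivAt_const _ _

theorem contDiff_stepPath (c : ℝ) (i : Fin d) (k : ℕ) (L : List (Fin d × ℝ)) :
    ContDiff ℝ ∞ (stepPath c i k L) := by
  induction L generalizing k with
  | nil => exact contDiff_const
  | cons p L ih =>
    refine ContDiff.add ?_ (ih (k + 1))
    split_ifs
    · exact contDiff_const.mul (Real.smoothTransition.contDiff.comp
        ((contDiff_const.mul contDiff_id).sub contDiff_const))
    · exact contDiff_const

theorem continuous_stepVel (c : ℝ) (i : Fin d) (k : ℕ) (L : List (Fin d × ℝ)) :
    Continuous (stepVel c i k L) := by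
  have : stepVel c i k L = deriv (stepPath c i k L) :=
    funext fun t => (hasDerivAt_stepPath c i k L t).deriv.symm
  rw [this]
  exact (contDiff_stepPath c i k L).continuous_deriv (by simp)

theorem stepPath_zero (c : ℝ) (i : Fin d) (k : ℕ) (L : List (Fin d × ℝ)) :
    stepPath c i k L 0 = 0 := by
  induction L generalizing k with
  | nil => rfl
  | cons p L ih =>
    rw [stepPath, ih, Real.smoothTransition.zero_of_nonpos (by simp)]
    simp

theorem stepSig_of_le {c : ℝ} {k : ℕ} {t : ℝ} (h : c * t ≤ k) (L : List (Fin d × ℝ)) :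
    stepSig N c k L t = 1 := by
  induction L generalizing k with
  | nil => rfl
  | cons p L ih =>
    rw [stepSig, ih (by push_cast; linarith), Real.smoothTransition.zero_of_nonpos (by linarith),
      mul_zero, zero_smul, texp_zero, mul_one]

theorem stepSig_of_ge {c : ℝ} {k : ℕ} {t : ℝ} {L : List (Fin d × ℝ)} (h : k + L.length ≤ c * t) :
    stepSig N c k L t = stepProd N L := by
  induction L generalizing k with
  | nil => rfl
  | cons p L ih =>
    rw [List.length_cons] at h
    push_cast at h
    have : (0 : ℝ) ≤ L.length := Nat.cast_nonneg _
    rw [stepSig, ih (by push_cast; linarith), Real.smoothTransition.one_of_one_le (by linarith),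
      mul_one, stepProd_cons]

/-- Noncommutativity does no harm: while a step moves, the later factors are still `1`, and once
they move its velocity is zero. -/
theorem hasDerivAt_stepSig (c : ℝ) (k : ℕ) (L : List (Fin d × ℝ)) (t : ℝ) :
    HasDerivAt (stepSig N c k L) (∑ i, stepVel c i k L t • (stepSig N c k L t * letter N i)) t := by
  induction L generalizing k with
  | nil => simpa [stepVel] using! hasDerivAt_const t (1 : TruncTensor d N)
  | cons p L ih =>
    have hs := ((hasDerivAt_step c k t).const_mul p.2)
    have h1 := (hasDerivAt_texp_smul (letter_mem_filt (N := N) p.1)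
      (p.2 * Real.smoothTransition (c * t - k))).scomp t hs
    refine (hasDerivAt_mul h1 (ih (k + 1))).congr_deriv ?_
    simp only [stepVel, stepSig, add_smul, Finset.sum_add_distrib, Function.comp_apply]
    congr 1
    · simp only [ite_smul, zero_smul, Finset.sum_ite_eq, mem_univ, if_true, smul_mul_assoc]
      rcases le_or_gt (c * t) (k + 1 : ℕ) with hle | hgt
      · rw [stepSig_of_le hle, mul_one, mul_one]
      · rw [deriv_smoothTransition_of_one_lt (by push_cast at hgt; linarith)]
        simp
    · rw [Finset.mul_sum]
      exact Finset.sum_congr rfl fun i _ => by rw [mul_smul_comm, mul_assoc]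

/-- The path is linear in the step lengths. Prolonging a step is thus motion along a line in the
Cameron–Martin space, as directional derivatives require. -/
theorem stepPath_perturb (c : ℝ) (i : Fin d) (k : ℕ) (L₁ L₂ : List (Fin d × ℝ)) (j : Fin d)
    (τ ε t : ℝ) : stepPath c i k (L₁ ++ (j, τ + ε) :: L₂) t =
      stepPath c i k (L₁ ++ (j, τ) :: L₂) t +
        ε * stepPath c i (k + L₁.length) [(j, 1)] t := by
  induction L₁ generalizing k with
  | nil =>
    simp only [List.nil_append, stepPath, List.length_nil, add_zero]
    split_ifs <;> ring
  | cons p L ih =>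
    simp only [List.cons_append, stepPath, ih, List.length_cons]
    rw [show k + 1 + L.length = k + (L.length + 1) by omega]
    ring

theorem signature_stepPath {L : List (Fin d × ℝ)} {h : I → EuclideanSpace ℝ (Fin d)}
    (hh : ∀ i (t : I), h t i = stepPath L.length i 0 L t) :
    signature N h 1 = stepProd N L := by
  rw [signature_eq_of_hasDerivAt (fun i t => hasDerivAt_stepPath L.length i 0 L t)
    (fun i => continuous_stepVel _ i 0 L) hh (stepSig_of_le (by simp) L)
    (hasDerivAt_stepSig _ 0 L) 1]
  exact stepSig_of_ge (by simp)

end TruncTensor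

/-! ### Paths at which the Itô--Lyons map is a submersion -/

namespace CameronMartin

open TruncTensor

variable (H : Set.Ioo (0 : ℝ) 1) {d N n : ℕ}

theorem exists_of_coordinates {x : Fin d → ℝ → ℝ} (hx : ∀ i, ContDiff ℝ ∞ (x i))
    (h0 : ∀ i, x i 0 = 0) : ∃ h : CameronMartin H d, ∀ i (t : I), h t i = x i t := by
  choose k hk using fun i =>
    exists_cameronMartin_of_contDiff H (hx i) (h0 i) (EuclideanSpace.single i (1 : ℝ))
  refine ⟨∑ i, k i, fun j t => ?_⟩
  have e : (∑ i, k i : CameronMartin H d) t = ∑ i, k i t := by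
    rw [← RKHS.coeCLM_apply (𝕜 := ℝ), map_sum, Finset.sum_apply]
    rfl
  rw [e]
  simp only [hk]
  simp [Pi.single_apply]

theorem exists_stepPath (c : ℝ) (k : ℕ) (L : List (Fin d × ℝ)) :
    ∃ h : CameronMartin H d, ∀ i (t : I), h t i = stepPath c i k L t :=
  exists_of_coordinates H (fun i => contDiff_stepPath c i k L) fun i => stepPath_zero c i k L

/-- In a loop, the perturbed step and its successors multiply to the inverse of what precedes, so
the inserted letter appears conjugated. -/
theorem hasDerivAt_stepProd (L₁ L₂ : List (Fin d × ℝ)) (i : Fin d) (τ : ℝ)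
    (hL : stepProd N (L₁ ++ (i, τ) :: L₂) = 1) :
    HasDerivAt (fun ε : ℝ => stepProd N (L₁ ++ (i, τ + ε) :: L₂)) (stepConj L₁ (letter N i)) 0 := by
  have h1 : HasDerivAt (fun ε : ℝ => texp ((τ + ε) • letter N i))
      (texp (τ • letter N i) * letter N i) 0 := by
    have h := (hasDerivAt_texp_smul (letter_mem_filt (N := N) i) (τ + 0)).comp_const_add τ 0
    rwa [add_zero] at h
  have h2 := hasDerivAt_mul (hasDerivAt_mul (hasDerivAt_const (0 : ℝ) (stepProd N L₁)) h1)
    (hasDerivAt_const (0 : ℝ) (stepProd N L₂))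
  simp only [stepProd_append, stepProd_cons, ← mul_assoc] at hL ⊢
  refine h2.congr_deriv ?_
  have h3 : texp (τ • letter N i) * stepProd N L₂ = stepProd N (revSteps L₁) := by
    calc _ = (stepProd N (revSteps L₁) * stepProd N L₁) *
          (texp (τ • letter N i) * stepProd N L₂) := by rw [revSteps_mul_stepProd, one_mul]
      _ = stepProd N (revSteps L₁) * (stepProd N L₁ * texp (τ • letter N i) * stepProd N L₂) := by
          simp only [mul_assoc]
      _ = _ := by rw [hL, mul_one]
  rw [zero_mul, zero_add, mul_zero, add_zero, stepConj, commute_texp, ← h3]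
  simp only [mul_assoc]

theorem fderiv_tlog_one {x : TruncTensor d N} (hx : x ∈ filt d N 1) : fderiv ℝ tlog 1 x = x := by
  have h := hasDerivAt_tlog (hasDerivAt_texp_smul hx 0)
  simp only [fun s : ℝ => tlog_texp ((filt d N 1).smul_mem s hx)] at h
  rw [zero_smul, texp_zero, one_mul] at h
  simpa using h.unique ((hasDerivAt_id (0 : ℝ)).smul_const x)

theorem stepConj_mem_filt (L : List (Fin d × ℝ)) (i : Fin d) :
    stepConj L (letter N i) ∈ filt d N 1 :=
  have h0 : ∀ a : TruncTensor d N, a ∈ filt d N 0 := fun _ _ hw => absurd hw (Nat.not_lt_zero _)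
  mul_mem_filt' (j := 1) (k := 0) (mul_mem_filt' (j := 0) (k := 1) (h0 _) (letter_mem_filt i) le_rfl)
    (h0 _) le_rfl

/-- Run the loop of `exists_loop_lieSub_le` as a smooth path. Prolonging its steps realizes every
step direction as a derivative, since `tlog` has identity derivative at `1` on degrees at least one.
-/
theorem exists_loop_submersion (b : Module.Basis (Fin n) ℝ (freeNilpotentLie d N)) :
    ∃ h : CameronMartin H d, itoLyons b h 1 = 0 ∧
      Function.Surjective (fderiv ℝ (fun k : CameronMartin H d => itoLyons b k 1) h) := by
  obtain ⟨L, hL, hspan⟩ := exists_loop_lieSub_le (d := d) (N := N)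
  obtain ⟨h, hh⟩ := exists_stepPath H L.length 0 L
  have hS : signature N h 1 = 1 := by rw [signature_stepPath hh, hL]
  have hlog : tlog (1 : TruncTensor d N) = 0 := by
    rw [← texp_zero, tlog_texp (zero_mem _)]
  refine ⟨h, by rw [itoLyons_eq, hS, hlog, map_zero], ?_⟩
  set D := fderiv ℝ (fun k : CameronMartin H d => itoLyons b k 1) h with hD
  have hdiff : DifferentiableAt ℝ (fun k : CameronMartin H d => itoLyons b k 1) h :=
    (contDiff_itoLyons H b 1).differentiable (by simp) h
  have hdir : ∀ x : TruncTensor d N, IsStepDir L x → coordExt b x ∈ LinearMap.range D.toLinearMap := by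
    rintro x ⟨L₁, i, τ, L₂, rfl, rfl⟩
    set L := L₁ ++ (i, τ) :: L₂
    obtain ⟨k, hk⟩ := exists_stepPath H (L.length : ℝ) L₁.length [(i, (1 : ℝ))]
    have hpath : ∀ ε : ℝ, signature N ⇑(h + ε • k) 1 = stepProd N (L₁ ++ (i, τ + ε) :: L₂) := by
      intro ε
      refine signature_stepPath fun j t => ?_
      have hlen : (L₁ ++ (i, τ + ε) :: L₂).length = L.length := by simp [L]
      rw [hlen, stepPath_perturb, ← hh, zero_add, ← hk, RKHS.coe_add, RKHS.coe_smul]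
      rfl
    have hder : HasDerivAt (fun ε : ℝ => itoLyons b ⇑(h + ε • k) 1)
        (coordExt b (stepConj L₁ (letter N i))) 0 := by
      simp only [itoLyons_eq, hpath]
      have h1 := hasDerivAt_tlog (hasDerivAt_stepProd L₁ L₂ i τ hL)
      rw [add_zero, hL] at h1
      rw [fderiv_tlog_one (stepConj_mem_filt L₁ i)] at h1
      exact (coordExt b).hasFDerivAt.comp_hasDerivAt 0 h1
    have hline : HasDerivAt (fun ε : ℝ => h + ε • k) k 0 := by
      simpa using ((hasDerivAt_id (0 : ℝ)).smul_const k).const_add h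
    have hdiff' : HasFDerivAt (fun k : CameronMartin H d => itoLyons b k 1) D (h + (0 : ℝ) • k) := by
      rw [zero_smul, add_zero]
      exact hdiff.hasFDerivAt
    have hcomp : HasDerivAt (fun ε : ℝ => itoLyons b ⇑(h + ε • k) 1) (D k) 0 := by
      have := HasFDerivAt.comp_hasDerivAt (0 : ℝ) hdiff' hline
      exact this
    exact ⟨k, hcomp.unique hder⟩
  intro u
  have hmem : lieOfCoord b u ∈ Submodule.span ℝ {x | IsStepDir L x} := hspan (lieOfCoord_mem b u)
  have hmap : Submodule.span ℝ {x | IsStepDir L x} ≤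
      (LinearMap.range D.toLinearMap).comap (coordExt b).toLinearMap :=
    Submodule.span_le.2 hdir
  obtain ⟨k, hk⟩ := hmap hmem
  exact ⟨k, by simpa [coordExt_lieOfCoord] using hk⟩

end CameronMartin

/-! ### Submersions are open -/

/-- Surjectivity of the derivative is an open condition: composed with a right inverse of the
derivative at `a`, it stays invertible nearby. Since `f` maps neighbourhoods of `a` onto
neighbourhoods of `f a`, such points lie over every nearby value. -/
theorem eventually_exists_surjective_fderiv {E F : Type*} [NormedAddCommGroup E] [NormedSpace ℝ E]
    [CompleteSpace E] [NormedAddCommGroup F] [NormedSpace ℝ F] [FiniteDimensional ℝ F] {f : E → F}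
    (hf : ContDiff ℝ 1 f) {a : E} (ha : Function.Surjective (fderiv ℝ f a)) :
    ∀ᶠ y in nhds (f a), ∃ x, f x = y ∧ Function.Surjective (fderiv ℝ f x) := by
  have := FiniteDimensional.complete ℝ F
  have hopen : ∀ᶠ x in nhds a, Function.Surjective (fderiv ℝ f x) := by
    obtain ⟨R, hR⟩ := (fderiv ℝ f a).exists_rightInverse_of_surjective (LinearMap.range_eq_top.2 ha)
    have hc : Continuous fun x => (fderiv ℝ f x).comp R :=
      (hf.continuous_fderiv (by simp)).clm_comp continuous_const
    have hunit : ∀ᶠ T : F →L[ℝ] F in nhds ((fderiv ℝ f a).comp R), IsUnit T := by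
      rw [hR]
      exact Units.nhds (1 : (F →L[ℝ] F)ˣ)
    filter_upwards [hc.continuousAt.eventually hunit] with x hx
    obtain ⟨u, hu⟩ := hx
    intro y
    refine ⟨R ((↑u⁻¹ : F →L[ℝ] F) y), ?_⟩
    have := congrArg (fun T : F →L[ℝ] F => T y) u.mul_inv
    rw [hu] at this
    exact this
  have hmap := (hf.contDiffAt.hasStrictFDerivAt (by simp)).map_nhds_eq_of_surj
    (LinearMap.range_eq_top.2 ha)
  rw [← hmap, Filter.eventually_map]
  exact hopen.mono fun x hx => ⟨x, rfl, hx⟩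

/-! ### Dilations -/

namespace TruncTensor

variable {d N : ℕ}

/-- The dilation, which multiplies tensors of degree `k` by `r ^ k`. -/
def dilation (r : ℝ) : TruncTensor d N →ₗ[ℝ] TruncTensor d N where
  toFun a w := r ^ w.1.length * a w
  map_add' _ _ := funext fun _ => mul_add _ _ _
  map_smul' _ _ := funext fun _ => mul_left_comm _ _ _

theorem dilation_apply (r : ℝ) (a : TruncTensor d N) (w : Word d N) :
    dilation r a w = r ^ w.1.length * a w := rfl

theorem dilation_mul (r : ℝ) (a c : TruncTensor d N) :
    dilation r (a * c) = dilation r a * dilation r c := by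
  funext w
  rw [dilation_apply, mul_apply, mul_apply, Finset.mul_sum]
  refine Finset.sum_congr rfl fun i hi => ?_
  have hlen : w.1.length = (pre w i).1.length + (suf w i).1.length := by
    rw [← List.length_append]
    simp [pre, suf]
  rw [dilation_apply, dilation_apply, hlen, pow_add]
  ring

theorem dilation_one (r : ℝ) : dilation r (1 : TruncTensor d N) = 1 := by
  funext w
  rw [dilation_apply, one_apply]
  split_ifs with h <;> simp [h]

theorem dilation_pow (r : ℝ) (a : TruncTensor d N) (k : ℕ) :
    dilation r (a ^ k) = dilation r a ^ k := by
  induction k with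
  | zero => simp [dilation_one]
  | succ k ih => rw [pow_succ, pow_succ, dilation_mul, ih]

theorem dilation_texp (r : ℝ) (a : TruncTensor d N) :
    dilation r (texp a) = texp (dilation r a) := by
  simp only [texp, map_sum, map_smul, dilation_pow]

theorem dilation_mem_filt (r : ℝ) {a : TruncTensor d N} {k : ℕ} (ha : a ∈ filt d N k) :
    dilation r a ∈ filt d N k := fun w hw => by rw [dilation_apply, ha w hw, mul_zero]

theorem tlog_dilation (r : ℝ) {g : TruncTensor d N} (hg : g - 1 ∈ filt d N 1) :
    tlog (dilation r g) = dilation r (tlog g) := by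
  conv_lhs => rw [← texp_tlog hg, dilation_texp]
  exact tlog_texp (dilation_mem_filt r (tlog_mem hg))

theorem dilation_letter (r : ℝ) (i : Fin d) : dilation r (letter N i) = r • letter N i := by
  funext w
  rw [dilation_apply, smul_apply, letter]
  split_ifs with h <;> simp [h]

theorem dilation_mem_lie (r : ℝ) {z : TruncTensor d N} (hz : z ∈ freeNilpotentLie d N) :
    dilation r z ∈ freeNilpotentLie d N := by
  induction hz using LieSubalgebra.lieSpan_induction with
  | mem x h =>
    obtain ⟨i, rfl⟩ := h
    rw [dilation_letter]
    exact LieSubalgebra.smul_mem _ r (letter_mem i)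
  | zero => rw [map_zero]; exact zero_mem _
  | add x y _ _ hx hy => rw [map_add]; exact add_mem hx hy
  | smul s x _ hx => rw [map_smul]; exact LieSubalgebra.smul_mem _ s hx
  | lie x y _ _ hx hy =>
    rw [lie_def, map_sub, dilation_mul, dilation_mul]
    exact LieSubalgebra.lie_mem _ hx hy

theorem dilation_dilation_inv {r : ℝ} (hr : r ≠ 0) (a : TruncTensor d N) :
    dilation r⁻¹ (dilation r a) = a := by
  funext w
  rw [dilation_apply, dilation_apply, inv_pow, inv_mul_cancel_left₀ (pow_ne_zero _ hr)]

theorem tendsto_dilation {z : TruncTensor d N} (hz : z ∈ filt d N 1) :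
    Filter.Tendsto (fun r => dilation r z) (nhds 0) (nhds 0) := by
  have hc : Continuous fun r => dilation r z :=
    continuous_pi fun w => (continuous_pow w.1.length).mul continuous_const
  have h0 : dilation 0 z = 0 := by
    funext w
    rw [dilation_apply, zero_apply]
    rcases Nat.eq_zero_or_pos w.1.length with h | h
    · rw [hz w (by omega), mul_zero]
    · rw [zero_pow h.ne', zero_mul]
  simpa only [h0] using hc.tendsto 0

/-- The rescaled iterated integrals satisfy the recursion of the scaled path: one factor `r` comes
from the integrator, the others from the integrand. -/
theorem signature_smul {h : I → EuclideanSpace ℝ (Fin d)} (hh : HasSignature N h) (r : ℝ) (t : I) :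
    signature N (r • h) t = dilation r (signature N h t) := by
  funext w
  rw [dilation_apply, signature, signature,
    iteratedIntegral_unique (N := N) (fun w t => r ^ w.length * iteratedIntegral h w t) ?_ ?_ _
      (by simpa using w.2), List.length_reverse]
  · exact fun t => by simp [iteratedIntegral]
  · intro i w hw t
    obtain ⟨J, hJ⟩ := hh i w hw t
    have e : iteratedIntegral h (i :: w) t = J := hJ.youngIntegral_eq
    rw [e, List.length_cons, pow_succ, mul_assoc]
    exact (hJ.const_mul_right r).const_mul (r ^ w.length)

end TruncTensor

/-! ### Surjectivity -/

namespace CameronMartin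

open TruncTensor

variable (H : Set.Ioo (0 : ℝ) 1) {d N n : ℕ} (b : Module.Basis (Fin n) ℝ (freeNilpotentLie d N))

/-- Dilations in coordinates. -/
noncomputable def coordDilation (r : ℝ) : (Fin n → ℝ) →ₗ[ℝ] (Fin n → ℝ) :=
  (coordExt b).toLinearMap ∘ₗ dilation r ∘ₗ (lieSub d N).subtype ∘ₗ b.equivFun.symm.toLinearMap

theorem coordDilation_apply (r : ℝ) (u : Fin n → ℝ) :
    coordDilation b r u = coordExt b (dilation r (lieOfCoord b u)) := rfl

theorem coordDilation_inv {r : ℝ} (hr : r ≠ 0) (u : Fin n → ℝ) :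
    coordDilation b r⁻¹ (coordDilation b r u) = u := by
  rw [coordDilation_apply, coordDilation_apply,
    lieOfCoord_coordExt b (dilation_mem_lie r (lieOfCoord_mem b u)), dilation_dilation_inv hr,
    coordExt_lieOfCoord]

theorem itoLyons_smul (r : ℝ) (h : CameronMartin H d) (t : I) :
    itoLyons b ⇑(r • h) t = coordDilation b r (itoLyons b h t) := by
  rw [itoLyons_eq, itoLyons_eq, RKHS.coe_smul, signature_smul (hasSignature_cameronMartin H h N),
    tlog_dilation r (signature_sub_one_mem H N h t), coordDilation_apply,
    lieOfCoord_coordExt b (tlog_signature_mem H N h t)]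

/-- A strong contraction moves `u` into the neighbourhood of zero reached by submersion points.
Scaling the path by `r⁻¹` undoes the dilation, and differentiating the homogeneity relation carries
surjectivity along. -/
theorem exists_submersion (u : Fin n → ℝ) : ∃ h : CameronMartin H d, itoLyons b h 1 = u ∧
    Function.Surjective (fderiv ℝ (fun k : CameronMartin H d => itoLyons b k 1) h) := by
  obtain ⟨h₀, hz, hsurj⟩ := exists_loop_submersion H b
  have hsm := contDiff_itoLyons H b 1
  have hev := eventually_exists_surjective_fderiv (hsm.of_le (by simp)) hsurj
  rw [hz] at hev
  have hlim : Filter.Tendsto (fun r => coordDilation b r u) (nhds 0) (nhds 0) := by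
    have := ((coordExt b).continuous.tendsto 0).comp (tendsto_dilation (lieOfCoord_mem_filt b u))
    rwa [map_zero] at this
  obtain ⟨r, hr, hr0⟩ := (((hlim.eventually hev).filter_mono nhdsWithin_le_nhds).and
    (eventually_mem_nhdsWithin (a := (0 : ℝ)) (s := Set.Ioi 0))).exists
  have hr0 : r ≠ 0 := ne_of_gt hr0
  obtain ⟨h, hh, hs⟩ := hr
  refine ⟨r⁻¹ • h, by rw [itoLyons_smul, hh, coordDilation_inv b hr0], fun v => ?_⟩
  set A := LinearMap.toContinuousLinearMap (coordDilation b r⁻¹) with hA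
  obtain ⟨k, hk⟩ := hs (coordDilation b r v)
  refine ⟨r⁻¹ • k, ?_⟩
  have hline : HasDerivAt (fun ε : ℝ => h + ε • k) k 0 := by
    simpa using ((hasDerivAt_id (0 : ℝ)).smul_const k).const_add h
  have hline' : HasDerivAt (fun ε : ℝ => r⁻¹ • (h + ε • k)) (r⁻¹ • k) 0 := hline.const_smul r⁻¹
  have hd : ∀ x, HasFDerivAt (fun k : CameronMartin H d => itoLyons b k 1)
      (fderiv ℝ (fun k : CameronMartin H d => itoLyons b k 1) x) x :=
    fun x => (hsm.differentiable (by simp) x).hasFDerivAt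
  have d1 := HasFDerivAt.comp_hasDerivAt (0 : ℝ) (hd (h + (0 : ℝ) • k)) hline
  have d2 := HasFDerivAt.comp_hasDerivAt (0 : ℝ) (hd (r⁻¹ • (h + (0 : ℝ) • k))) hline'
  have d3 := A.hasFDerivAt.comp_hasDerivAt (0 : ℝ) d1
  -- One curve written in two ways: its derivative is that of the endpoint map at `r⁻¹ • h` along
  -- `r⁻¹ • k`, and also the dilation of the derivative at `h` along `k`.
  have e : (fun k : CameronMartin H d => itoLyons b k 1) ∘ (fun ε : ℝ => r⁻¹ • (h + ε • k)) =
      A ∘ (fun k : CameronMartin H d => itoLyons b k 1) ∘ fun ε : ℝ => h + ε • k :=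
    funext fun ε => itoLyons_smul H b r⁻¹ (h + ε • k) 1
  rw [e] at d2
  have := d2.unique d3
  rw [zero_smul, add_zero, hk] at this
  rw [this]
  exact coordDilation_inv b hr0 v

end CameronMartin

/-! ### The tangent space of the group -/

section Tangent

open TruncTensor

variable {d N n : ℕ} (b : Module.Basis (Fin n) ℝ (freeNilpotentLie d N))

theorem contDiff_expCoord : ContDiff ℝ ∞ (expCoord b) :=
  contDiff_texp.comp (LinearMap.toContinuousLinearMap
    ((lieSub d N).subtype ∘ₗ b.equivFun.symm.toLinearMap)).contDiff

theorem expCoord_mem (u : Fin n → ℝ) : expCoord b u ∈ carnotGroup d N :=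
  ⟨_, lieOfCoord_mem b u, rfl⟩

theorem expCoord_coordExt_tlog {g : TruncTensor d N} (hg : g ∈ carnotGroup d N) :
    expCoord b (coordExt b (tlog g)) = g := by
  obtain ⟨z, hz, rfl⟩ := hg
  rw [tlog_texp (freeNilpotentLie_le_filt hz), expCoord_eq, lieOfCoord_coordExt b hz]

/-- Lines pushed through the chart give tangent vectors; conversely a curve in the group is pulled
back by the smooth inverse `coordExt b ∘ tlog`. -/
theorem range_fderiv_expCoord (u : Fin n → ℝ) :
    Set.range (fderiv ℝ (expCoord b) u) = carnotTangent (expCoord b u) := by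
  have hd : HasFDerivAt (expCoord b) (fderiv ℝ (expCoord b) u) u :=
    ((contDiff_expCoord b).differentiable (by simp) u).hasFDerivAt
  ext v
  constructor
  · rintro ⟨x, rfl⟩
    have hline : HasDerivAt (fun ε : ℝ => u + ε • x) x 0 := by
      simpa using ((hasDerivAt_id (0 : ℝ)).smul_const x).const_add u
    refine ⟨fun ε => expCoord b (u + ε • x), fun ε => expCoord_mem b _, by simp, ?_⟩
    have hd' : HasFDerivAt (expCoord b) (fderiv ℝ (expCoord b) u) (u + (0 : ℝ) • x) := by
      simpa using hd
    exact hd'.comp_hasDerivAt (0 : ℝ) hline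
  · rintro ⟨γ, hγ, h0, hv⟩
    have h1 := (coordExt b).hasFDerivAt.comp_hasDerivAt (0 : ℝ) (hasDerivAt_tlog hv)
    have hu : coordExt b (tlog (γ 0)) = u := by
      rw [h0, expCoord_eq, tlog_texp (lieOfCoord_mem_filt b u), coordExt_lieOfCoord]
    have hd' : HasFDerivAt (expCoord b) (fderiv ℝ (expCoord b) u)
        ((coordExt b ∘ fun ε => tlog (γ ε)) 0) := by
      rw [Function.comp_apply, hu]
      exact hd
    have h2 := hd'.comp_hasDerivAt (0 : ℝ) h1
    have e : expCoord b ∘ (coordExt b ∘ fun ε => tlog (γ ε)) = γ :=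
      funext fun ε => expCoord_coordExt_tlog b (hγ ε)
    rw [e] at h2
    exact ⟨_, h2.unique hv⟩

end Tangent

/-- The endpoint signature is the chart composed with the Itô–Lyons map. Where the latter has
surjective derivative, the range is that of the derivative of the chart. -/
theorem CameronMartin.exists_signature_submersion (H : Set.Ioo (0 : ℝ) 1) {d N : ℕ}
    {g : TruncTensor d N} (hg : g ∈ carnotGroup d N) : ∃ h : CameronMartin H d,
      signature N h 1 = g ∧
      Set.range (fderiv ℝ (fun k : CameronMartin H d => signature N k 1) h) = carnotTangent g := by
  have : FiniteDimensional ℝ (freeNilpotentLie d N) :=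
    inferInstanceAs (FiniteDimensional ℝ (TruncTensor.lieSub d N))
  let b := Module.finBasis ℝ (freeNilpotentLie d N)
  obtain ⟨h, hh, hs⟩ := exists_submersion H b (coordExt b (TruncTensor.tlog g))
  have hg' := expCoord_coordExt_tlog b hg
  refine ⟨h, by rw [← expCoord_itoLyons H h b, hh, hg'], ?_⟩
  have e : (fun k : CameronMartin H d => signature N k 1) =
      expCoord b ∘ fun k : CameronMartin H d => itoLyons b k 1 :=
    funext fun k => (expCoord_itoLyons H k b 1).symm
  rw [e, fderiv_comp h ((contDiff_expCoord b).differentiable (by simp) _)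
    ((contDiff_itoLyons H b 1).differentiable (by simp) h), hh, ContinuousLinearMap.coe_comp,
    hs.range_comp, range_fderiv_expCoord, hg']

theorem mainTheorem3 (H : Set.Ioo (0 : ℝ) 1) (hH : (1 : ℝ) / 4 < H) (d N : ℕ) :
    -- the endpoint signature map is well defined and smooth from the Cameron--Martin space
    -- to the free Carnot group
    (∀ h : CameronMartin H d, HasSignature N h ∧ ∀ t : I, signature N h t ∈ carnotGroup d N) ∧
    ContDiff ℝ ∞ (fun h : CameronMartin H d => signature N h 1) ∧
    -- every group element is reached by a path at which this map is a submersion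
    (∀ g ∈ carnotGroup d N, ∃ h : CameronMartin H d,
      signature N h 1 = g ∧
      Set.range (fderiv ℝ (fun k : CameronMartin H d => signature N k 1) h) = carnotTangent g) ∧
    -- the same for the Itô--Lyons map in the coordinates given by a basis of the Lie algebra
    (∀ (n : ℕ) (b : Module.Basis (Fin n) ℝ (freeNilpotentLie d N)),
      (∀ h : CameronMartin H d, ∃! U : I → Fin n → ℝ, SolvesEquation b h U) ∧
      (∀ (h : CameronMartin H d) (t : I), itoLyons b h t = logCoord b (signature N h t)) ∧
      ContDiff ℝ ∞ (fun h : CameronMartin H d => itoLyons b h 1) ∧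
      ∀ u : Fin n → ℝ, ∃ h : CameronMartin H d,
        itoLyons b h 1 = u ∧
        Function.Surjective (fderiv ℝ (fun k : CameronMartin H d => itoLyons b k 1) h)) := by
  refine ⟨fun h => ⟨hasSignature_cameronMartin H h N,
      signature_mem_carnotGroup H N h⟩, contDiff_signature H d N 1,
    fun g hg => CameronMartin.exists_signature_submersion H hg, fun n b => ⟨fun h =>
      ⟨_, solvesEquation_signature H h b, fun U hU =>
        hU.unique b (solvesEquation_signature H h b)⟩, fun h t => ?_,
      contDiff_itoLyons H b 1, CameronMartin.exists_submersion H b⟩⟩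
  rw [itoLyons_eq, logCoord_signature]
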